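/- Let $F$ be a non-Archimedean local field of characteristic $0$ with residue field of size $q$, let $W_F$ be its Weil group with inertia group $I_F$ and norm $|\cdot|$, and fix a Frobenius element $\mathrm{Fr}\in W_F$. Let $N\ge 3$. If $N$ is even put $s=-1$, $G=\mathrm{SO}_{N+1}(F)$ (split) and $G^\vee=\mathrm{Sp}_N(\mathbb C)$; if $N$ is odd put $s=1$, $G=\mathrm{Sp}_{N-1}(F)$ and $G^\vee=\mathrm{SO}_N(\mathbb C)$. Let $z\in\{\pm1\}$ be a central element of $G^\vee$ (so $z=1$ if $N$ is odd). **Parameters.** An $L$-parameter of $G$ is a $G^\vee$-conjugacy class of continuous homomorphisms $\phi:W_F\times \mathrm{SL}_2(\mathbb C)\to G^\vee$, algebraic on $\mathrm{SL}_2(\mathbb C)$, with $\phi(W_F)$ consisting of semisimple elements. An $A$-parameter is a $G^\vee$-conjugacy class of continuous homomorphisms $\psi: W_F\times \mathrm{SL}_2(\mathbb C)\times \mathrm{SL}_2(\mathbb C)\to G^\vee$, algebraic on $\mathrm{SL}_2(\mathbb C)\times\mathrm{SL}_2(\mathbb C)$, with $\psi(W_F)$ bounded and consisting of semisimple elements.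 With $t_w=\mathrm{diag}(|w|^{1/2},|w|^{-1/2})$ put $\chi_\phi(w)=\phi(w,t_w)$, $\phi_\psi(w,x)=\psi(w,x,t_w)$ and $\chi_\psi=\chi_{\phi_\psi}$, as conjugacy classes of homomorphisms. For a partition $\lambda$ let $\mathcal O^\vee_\lambda$ be the class of unipotent elements of $G^\vee$ with Jordan block sizes $\lambda$; $\lambda(\phi)$ is the partition with $\phi(1,\begin{pmatrix}1&1\\0&1\end{pmatrix})\in\mathcal O^\vee_{\lambda(\phi)}$. The infinitesimal character $\chi_{z,\mathcal O^\vee_\lambda}$ is $\chi_{\psi_0}$, where $\psi_0$ is the $A$-parameter that is trivial on $I_F$ and on the first $\mathrm{SL}_2(\mathbb C)$, has $\psi_0(\mathrm{Fr})=z$, and maps $\begin{pmatrix}1&1\\0&1\end{pmatrix}$ in the second $\mathrm{SL}_2(\mathbb C)$ into $\mathcal O^\vee_\lambda$. **Partitions.** Call an integer *good* if it is odd in case $s=1$, even in case $s=-1$. Let $\mathcal P^{s}(N)$ be the set of partitions of $N$ in which every part that is not good has even multiplicity. Let $d:\mathcal P^{s}(N)\to\mathcal P^{-s}(N-s)$ be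 the Barbasch--Vogan--Lusztig--Spaltenstein duality: for $s=-1$, add $1$ to the largest part, take the $B$-collapse and transpose; for $s=1$, subtract $1$ from the smallest part, take the $C$-collapse and transpose. For $\lambda\in\mathcal P^s(N)$ let $S(\lambda)$ be the set of good parts, and let $S_0(\lambda)=\{\nu_1<\dots<\nu_r\}\subset S(\lambda)$ be the set of parts of odd multiplicity. Divide $S(\lambda)$ into blocks: two distinct elements lie in the same block if and only if both lie in one of the following intervals. For $s=-1$: $[\nu_{r-2j-1},\nu_{r-2j}]$ for $0\le j<\lfloor r/2\rfloor$, and $(0,\nu_1]$ if $r$ is odd. For $s=1$: $[\nu_{r-2j},\nu_{r-2j+1}]$ for $0<j<r/2$, and $[\nu_r,\infty)$. A block $\theta$, with least element $\theta_{\min}$ and greatest element $\theta_{\max}$, is *admissible* if there is a block $\theta'$ with $\theta'_{\max}=\theta_{\min}-2$, or $\theta_{\min}=\theta_{\max}=2\notin S_0(\lambda)$, or $\theta_{\max}>\theta_{\min}=2\in S_0(\lambda)$. Let $\mathbb J(\lambda)=\{\theta_{\min}-1:\theta \text{ admissible}\}$. For $J\subset\mathbb J(\lambda)$ let $T_J(\lambda)$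 be obtained from $\lambda$ by replacing, for each $c\in J$, the parts $c-1,c+1$ by $c,c$ (for $c=1$ the part $2$ is replaced by $1,1$). The relative special piece of $\lambda$ is $\mathrm{Spc}(\lambda)=\{T_J(\lambda):J\subset\mathbb J(\lambda)\}$. **Near-tempered parameters.** Let $\nu_k$ be the $k$-dimensional irreducible algebraic representation of $\mathrm{SL}_2(\mathbb C)$, and let $z$ also denote the character of $W_F/I_F$ with $\mathrm{Fr}\mapsto z$. For $\mu=T_J(\lambda)$, $J\subset \mathbb J(\lambda)$, let $\mathfrak m_{\lambda,J}$ be the (near-tempered) table consisting of the pairs $(a,1)$, for the parts $a$ that remain when the parts $c-1,c+1$ are removed from $\lambda$ for all $c\in J$, and the pairs $(c,2)$ for $c\in J$. Let $\psi_{z,\mathfrak m_{\lambda,J}}$ be the $A$-parameter of $G$ whose composition with $G^\vee\subset \mathrm{GL}_N(\mathbb C)$ is isomorphic to $\bigoplus_{(a,b)\in\mathfrak m_{\lambda,J}} z\otimes\nu_a\otimes\nu_b$, and let $\phi_{z,\lambda,\mu}=\phi_{\psi_{z,\mathfrak m_{\lambda,J}}}$. **Theorem.** Let $\lambda\in\mathcal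 P^{s}(N)$, and let $\phi$ be an $L$-parameter of $G$ with $\chi_\phi=\chi_{z,\mathcal O^\vee_\lambda}$ and $d(\lambda(\phi))=d(\lambda)$. Then there is $\mu\in\mathrm{Spc}(\lambda)$ with $\phi=\phi_{z,\lambda,\mu}$; that is, $\phi$ is the $L$-parameter of the $A$-parameter $\psi_{z,\mathfrak m_{\lambda,J}}$ of a near-tempered table $\mathfrak m_{\lambda,J}$ with $J\subset\mathbb J(\lambda)$. -/

import Mathlib

open scoped ValuativeRel TensorProduct DirectSum

noncomputable section

/-! ## The Weil group of a non-archimedean local field -/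

section Weil

variable (F : Type*) [Field F] [ValuativeRel F]

/-- The ring of integers of the algebraic closure of `F`. -/
abbrev IntegersBar : Type _ := integralClosure 𝒪[F] (AlgebraicClosure F)

/-- The maximal ideal of the ring of integers of the algebraic closure: all integral elements some
power of which lies in the ideal generated by the maximal ideal of `𝒪[F]`. -/
def maxIdealBar : Ideal (IntegersBar F) :=
  ((𝓂[F]).map (algebraMap 𝒪[F] (IntegersBar F))).radical

/-- The size of the residue field of `F`. -/
def residueCard : ℕ := Nat.card 𝓀[F]

variable {F}

/-- The action of a Galois automorphism on the integers of the algebraic closure. -/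
def galIntegers (σ : Gal(AlgebraicClosure F/F)) : IntegersBar F ≃ₐ[𝒪[F]] IntegersBar F :=
  (σ.restrictScalars 𝒪[F]).mapIntegralClosure

/-- `σ` acts on the residue field of the algebraic closure as `x ↦ x ^ (q ^ n)`, with `n` an integer
that may be negative: for `n = a - b` this says that `σ(x) ^ (q ^ b) = x ^ (q ^ a)`
in the residue field. -/
def ActsAsFrobeniusPow (σ : Gal(AlgebraicClosure F/F)) (n : ℤ) : Prop :=
  ∃ a b : ℕ, n = (a : ℤ) - b ∧ ∀ x : IntegersBar F,
    galIntegers σ x ^ (residueCard F ^ b) - x ^ (residueCard F ^ a) ∈ maxIdealBar F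

lemma pow_sub_pow_mem {R : Type*} [CommRing R] {I : Ideal R} {x y : R} (h : x - y ∈ I) (n : ℕ) :
    x ^ n - y ^ n ∈ I :=
  I.mem_of_dvd (sub_dvd_pow_sub_pow x y n) h

lemma ActsAsFrobeniusPow.one : ActsAsFrobeniusPow (1 : Gal(AlgebraicClosure F/F)) 0 :=
  ⟨0, 0, by simp, fun x => by
    have : galIntegers (1 : Gal(AlgebraicClosure F/F)) x = x := rfl
    simp [this]⟩

lemma ActsAsFrobeniusPow.mul {σ τ : Gal(AlgebraicClosure F/F)} {m n : ℤ}
    (hσ : ActsAsFrobeniusPow σ m) (hτ : ActsAsFrobeniusPow τ n) :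
    ActsAsFrobeniusPow (σ * τ) (m + n) := by
  obtain ⟨a, b, rfl, h⟩ := hσ
  obtain ⟨a', b', rfl, h'⟩ := hτ
  refine ⟨a + a', b + b', by push_cast; ring, fun x => ?_⟩
  have e : galIntegers (σ * τ) x = galIntegers σ (galIntegers τ x) := rfl
  have h1 := pow_sub_pow_mem (h (galIntegers τ x)) (residueCard F ^ b')
  have h2 := pow_sub_pow_mem (h' x) (residueCard F ^ a)
  have h3 := add_mem h1 h2
  rw [e]
  convert h3 using 1
  simp only [← pow_mul, pow_add]
  rw [mul_comm (residueCard F ^ b') (residueCard F ^ a),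
    mul_comm (residueCard F ^ a') (residueCard F ^ a)]
  ring

lemma ActsAsFrobeniusPow.inv {σ : Gal(AlgebraicClosure F/F)} {m : ℤ}
    (hσ : ActsAsFrobeniusPow σ m) : ActsAsFrobeniusPow σ⁻¹ (-m) := by
  obtain ⟨a, b, rfl, h⟩ := hσ
  refine ⟨b, a, by ring, fun x => ?_⟩
  have e : galIntegers σ (galIntegers σ⁻¹ x) = x :=
    Subtype.ext (σ.apply_symm_apply (x : AlgebraicClosure F))
  have h1 := h (galIntegers σ⁻¹ x)
  rw [e] at h1
  rw [← neg_sub]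
  exact neg_mem h1

variable (F)

/-- The Weil group of `F`, as the group of pairs `(σ, n)` of a Galois automorphism `σ` and an
integer `n` such that `σ` acts on the residue field as the `n`-th power of Frobenius (the integer
is determined by `σ`). It has the subspace topology of `Gal × ℤ`, with `ℤ` discrete: the inertia
group `n = 0` is open and carries the Krull topology. -/
def WeilGroup : Subgroup (Gal(AlgebraicClosure F/F) × Multiplicative ℤ) where
  carrier := {w | ActsAsFrobeniusPow w.1 w.2.toAdd}
  one_mem' := ActsAsFrobeniusPow.one
  mul_mem' := fun h h' => h.mul h'
  inv_mem' := fun h => h.inv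

variable {F}

/-- The exponent `n` for which `w` acts on the residue field as `x ↦ x ^ (q ^ n)`. -/
def weilDeg (w : WeilGroup F) : ℤ := w.1.2.toAdd

/-- Membership in the inertia subgroup. -/
def IsInertia (w : WeilGroup F) : Prop := weilDeg w = 0

/-- Frobenius elements of the Weil group. -/
def IsFrobenius (w : WeilGroup F) : Prop := weilDeg w = 1

/-- The square root `|w|^{1/2}` of the norm `|w| = q ^ n` of the Weil group, as a complex unit. -/
def weilNormHalf [TopologicalSpace F] [IsNonarchimedeanLocalField F] : WeilGroup F →* ℂˣ where
  toFun w := Units.mk0 ((Real.sqrt ((residueCard F : ℝ) ^ weilDeg w) : ℝ) : ℂ) (by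
    have : 0 < residueCard F := Nat.card_pos
    have h : 0 < Real.sqrt ((residueCard F : ℝ) ^ weilDeg w) := by positivity
    exact_mod_cast h.ne')
  map_one' := by
    ext
    simp [weilDeg]
  map_mul' v w := by
    have : 0 < residueCard F := Nat.card_pos
    have h0 : (residueCard F : ℝ) ≠ 0 := by positivity
    ext
    have : weilDeg (v * w) = weilDeg v + weilDeg w := rfl
    simp only [Units.val_mk0, Units.val_mul, this, zpow_add₀ h0]
    rw [Real.sqrt_mul (by positivity)]
    push_cast
    rfl

/-- The unramified character of the Weil group that maps Frobenius elements to the sign `z`. -/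
def unramifiedSign (z : ℤˣ) : WeilGroup F →* ℂˣ where
  toFun w := Units.map (Int.castRingHom ℂ : ℤ →* ℂ) (z ^ weilDeg w)
  map_one' := by simp [weilDeg]
  map_mul' v w := by
    have : weilDeg (v * w) = weilDeg v + weilDeg w := rfl
    rw [this, zpow_add, map_mul]

end Weil

/-! ## The dual group and its parameters -/

/-- The group `SL₂(ℂ)`. -/
abbrev SL2 : Type := Matrix.SpecialLinearGroup (Fin 2) ℂ

/-- The diagonal torus of `SL₂(ℂ)`. -/
def diagSL2 : ℂˣ →* SL2 where
  toFun t := ⟨!![(t : ℂ), 0; 0, ((t⁻¹ : ℂˣ) : ℂ)], by simp [Matrix.det_fin_two]⟩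
  map_one' := by
    ext i j
    fin_cases i <;> fin_cases j <;> simp
  map_mul' s t := Subtype.ext (by
    change !![((s * t : ℂˣ) : ℂ), 0; 0, (((s * t)⁻¹ : ℂˣ) : ℂ)] =
      !![(s : ℂ), 0; 0, ((s⁻¹ : ℂˣ) : ℂ)] * !![(t : ℂ), 0; 0, ((t⁻¹ : ℂˣ) : ℂ)]
    simp [mul_comm])

/-- The standard unipotent element of `SL₂(ℂ)`. -/
def unipSL2 : SL2 := ⟨!![1, 1; 0, 1], by simp [Matrix.det_fin_two]⟩

/-- The sign attached to the group: `-1` for even `N` (the group is `SO_{N+1}(F)`, with dual group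
`Sp_N(ℂ)`) and `1` for odd `N` (the group is `Sp_{N-1}(F)`, with dual group `SO_N(ℂ)`). -/
def groupSign (N : ℕ) : ℤ := if Even N then -1 else 1

/-- The antidiagonal non-degenerate bilinear form: alternating for even `N`, symmetric for
odd `N`. -/
def dualForm (N : ℕ) : Matrix (Fin N) (Fin N) ℂ :=
  Matrix.of fun i j =>
    if (i : ℕ) + j + 1 = N then (if i ≤ j then 1 else (groupSign N : ℂ)) else 0

/-- The complex dual group: `Sp_N(ℂ)` for even `N` and `SO_N(ℂ)` for odd `N`. -/
def DualGroup (N : ℕ) : Subgroup (GL (Fin N) ℂ) where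
  carrier := {g | (g : Matrix (Fin N) (Fin N) ℂ).transpose * dualForm N * g = dualForm N ∧
    (g : Matrix (Fin N) (Fin N) ℂ).det = 1}
  one_mem' := by simp
  mul_mem' := by
    rintro g h ⟨hg, hg'⟩ ⟨hh, hh'⟩
    refine ⟨?_, by simp [hg', hh']⟩
    calc ((g * h : GL (Fin N) ℂ) : Matrix (Fin N) (Fin N) ℂ).transpose * dualForm N *
          ((g * h : GL (Fin N) ℂ) : Matrix (Fin N) (Fin N) ℂ)
        = (h : Matrix (Fin N) (Fin N) ℂ).transpose *
            ((g : Matrix (Fin N) (Fin N) ℂ).transpose * dualForm N * g) * h := by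
          simp [Matrix.transpose_mul, Matrix.mul_assoc]
      _ = dualForm N := by rw [hg, hh]
  inv_mem' := by
    rintro g ⟨hg, hg'⟩
    have e : (g : Matrix (Fin N) (Fin N) ℂ) * ((g⁻¹ : GL (Fin N) ℂ) : Matrix (Fin N) (Fin N) ℂ)
        = 1 := by rw [← Units.val_mul, mul_inv_cancel]; rfl
    refine ⟨?_, ?_⟩
    · have e' := congrArg Matrix.transpose e
      rw [Matrix.transpose_mul, Matrix.transpose_one] at e'
      calc ((g⁻¹ : GL (Fin N) ℂ) : Matrix (Fin N) (Fin N) ℂ).transpose * dualForm N *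
            ((g⁻¹ : GL (Fin N) ℂ) : Matrix (Fin N) (Fin N) ℂ)
          = ((g⁻¹ : GL (Fin N) ℂ) : Matrix (Fin N) (Fin N) ℂ).transpose *
              ((g : Matrix (Fin N) (Fin N) ℂ).transpose * dualForm N * g) *
              ((g⁻¹ : GL (Fin N) ℂ) : Matrix (Fin N) (Fin N) ℂ) := by rw [hg]
        _ = (((g⁻¹ : GL (Fin N) ℂ) : Matrix (Fin N) (Fin N) ℂ).transpose *
              (g : Matrix (Fin N) (Fin N) ℂ).transpose) * dualForm N *
              ((g : Matrix (Fin N) (Fin N) ℂ) *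
                ((g⁻¹ : GL (Fin N) ℂ) : Matrix (Fin N) (Fin N) ℂ)) := by
            simp only [Matrix.mul_assoc]
        _ = dualForm N := by rw [e, e', Matrix.one_mul, Matrix.mul_one]
    · have := congrArg Matrix.det e
      rwa [Matrix.det_mul, hg', one_mul, Matrix.det_one] at this

/-- The matrix of an element of the dual group. -/
abbrev matOf {N : ℕ} (g : DualGroup N) : Matrix (Fin N) (Fin N) ℂ :=
  ((g : GL (Fin N) ℂ) : Matrix (Fin N) (Fin N) ℂ)

/-- Two homomorphisms into the dual group are in the same conjugation class. -/
def SameClass {Γ : Type*} [Group Γ] {N : ℕ} (f f' : Γ →* DualGroup N) : Prop :=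
  ∃ g : DualGroup N, ∀ x, g * f x * g⁻¹ = f' x

/-- The `N`-dimensional representation given by a homomorphism into the dual group and the standard
embedding of the dual group in `GL_N(ℂ)`. -/
def stdRep {Γ : Type*} [Group Γ] {N : ℕ} (f : Γ →* DualGroup N) :
    Representation ℂ Γ (Fin N → ℂ) :=
  ((Matrix.toLinAlgEquiv' : Matrix (Fin N) (Fin N) ℂ ≃ₐ[ℂ] _) :
      Matrix (Fin N) (Fin N) ℂ →* ((Fin N → ℂ) →ₗ[ℂ] (Fin N → ℂ))).comp
    ((Units.coeHom (Matrix (Fin N) (Fin N) ℂ)).comp ((DualGroup N).subtype.comp f))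

section Parameters

variable (F : Type*) [Field F] [ValuativeRel F] (N : ℕ)

/-- Representatives of `L`-parameters: continuous homomorphisms `W_F × SL₂(ℂ) → G^∨` that are
algebraic on `SL₂(ℂ)` and map `W_F` to semisimple elements. Equality of `L`-parameters is
`SameClass`. -/
structure LParameter where
  hom : WeilGroup F × SL2 →* DualGroup N
  continuous_hom : Continuous hom
  algebraic : ∃ P : Fin N → Fin N → MvPolynomial (Fin 2 × Fin 2) ℂ, ∀ (x : SL2) (i j : Fin N),
    matOf (hom (1, x)) i j = MvPolynomial.eval (fun p => x p.1 p.2) (P i j)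
  semisimple : ∀ w : WeilGroup F, Module.End.IsSemisimple (Matrix.toLin' (matOf (hom (w, 1))))

/-- Representatives of `A`-parameters: continuous homomorphisms `W_F × SL₂(ℂ) × SL₂(ℂ) → G^∨` that
are algebraic on `SL₂(ℂ) × SL₂(ℂ)` and map `W_F` to a bounded set of semisimple elements. -/
structure AParameter where
  hom : WeilGroup F × SL2 × SL2 →* DualGroup N
  continuous_hom : Continuous hom
  algebraic : ∃ P : Fin N → Fin N → MvPolynomial ((Fin 2 × Fin 2) ⊕ (Fin 2 × Fin 2)) ℂ,
    ∀ (x y : SL2) (i j : Fin N), matOf (hom (1, x, y)) i j =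
      MvPolynomial.eval (Sum.elim (fun p => x p.1 p.2) (fun p => y p.1 p.2)) (P i j)
  semisimple : ∀ w : WeilGroup F, Module.End.IsSemisimple (Matrix.toLin' (matOf (hom (w, 1, 1))))
  bounded : ∃ C : ℝ, ∀ (w : WeilGroup F) (i j : Fin N), ‖matOf (hom (w, 1, 1)) i j‖ ≤ C

variable {F N} [TopologicalSpace F] [IsNonarchimedeanLocalField F]

/-- The homomorphism `w ↦ (w, diag(|w|^{1/2}, |w|^{-1/2}))`. -/
def rF : WeilGroup F →* WeilGroup F × SL2 :=
  (MonoidHom.id _).prod (diagSL2.comp weilNormHalf)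

/-- The homomorphism `(w, x) ↦ (w, x, diag(|w|^{1/2}, |w|^{-1/2}))`. -/
def rF' : WeilGroup F × SL2 →* WeilGroup F × SL2 × SL2 :=
  (MonoidHom.fst _ _).prod
    ((MonoidHom.snd _ _).prod ((diagSL2.comp weilNormHalf).comp (MonoidHom.fst _ _)))

/-- The infinitesimal character of an `L`-parameter (up to `SameClass`). -/
def LParameter.infChar (φ : LParameter F N) : WeilGroup F →* DualGroup N := φ.hom.comp rF

/-- The unipotent element of an `L`-parameter. -/
def LParameter.unipotent (φ : LParameter F N) : DualGroup N := φ.hom (1, unipSL2)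

/-- The (homomorphism of the) `L`-parameter attached to an `A`-parameter. -/
def AParameter.lHom (ψ : AParameter F N) : WeilGroup F × SL2 →* DualGroup N := ψ.hom.comp rF'

/-- The infinitesimal character of an `A`-parameter (up to `SameClass`). -/
def AParameter.infChar (ψ : AParameter F N) : WeilGroup F →* DualGroup N := ψ.lHom.comp rF

end Parameters

/-! ## Unipotent classes -/

/-- The unipotent Jordan block of size `k`. -/
def unipJordanBlock (k : ℕ) : Matrix (Fin k) (Fin k) ℂ :=
  Matrix.of fun i j => if j = i then 1 else if (j : ℕ) = i + 1 then 1 else 0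

open scoped Classical in
/-- The class of the dual group that consists of unipotent matrices whose multiset of sizes of
Jordan blocks is the partition `lam`. -/
def unipotentClass (N : ℕ) (lam : Multiset ℕ) : Set (DualGroup N) :=
  {u | 0 ∉ lam ∧ ∃ (e : (Σ i : lam, Fin (i : ℕ)) ≃ Fin N) (g : GL (Fin N) ℂ),
    (g : Matrix (Fin N) (Fin N) ℂ) * matOf u * ((g⁻¹ : GL (Fin N) ℂ) : Matrix (Fin N) (Fin N) ℂ) =
      Matrix.reindex e e (Matrix.blockDiagonal' fun i : lam => unipJordanBlock (i : ℕ))}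

section QuasiBasic

variable {F : Type*} [Field F] [ValuativeRel F] {N : ℕ}

/-- `ψ` represents the quasi-basic `A`-parameter `ψ_{z, O_lam}`: it is trivial on
`I_F × SL₂(ℂ)` (first factor), it maps the Frobenius element to the central element `z`, and it maps
the unipotent of the second `SL₂(ℂ)` into the class `O_lam`. -/
def AParameter.IsQuasiBasic (ψ : AParameter F N) (Fr : WeilGroup F) (z : ℤˣ)
    (lam : Multiset ℕ) : Prop :=
  (∀ (w : WeilGroup F) (x : SL2), IsInertia w → ψ.hom (w, x, 1) = 1) ∧
  matOf (ψ.hom (Fr, 1, 1)) = ((z : ℤ) : ℂ) • (1 : Matrix (Fin N) (Fin N) ℂ) ∧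
  ψ.hom (1, 1, unipSL2) ∈ unipotentClass N lam

end QuasiBasic

/-! ## Partitions. A partition is the multiset of its parts, all of them positive. -/

section Partitions

open scoped Classical

/-- The parity of parts preferred by the sign `s`: odd for `s = 1` and even for `s = -1`. -/
def GoodParity (s : ℤ) (c : ℕ) : Prop := (s = 1 ∧ Odd c) ∨ (s = -1 ∧ Even c)

/-- The set of partitions of `N` of the form `μ ∪ ν ∪ ν` with all parts of `μ` of good parity
(orthogonal partitions for `s = 1`, symplectic partitions for `s = -1`). -/
def partitionSet (s : ℤ) (N : ℕ) : Set (Multiset ℕ) :=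
  {lam | 0 ∉ lam ∧ lam.sum = N ∧
    ∃ μ ν : Multiset ℕ, (∀ c ∈ μ, GoodParity s c) ∧ lam = μ + ν + ν}

/-! ### The duality map -/

/-- The sum of the `k` largest parts. -/
def topSum (lam : Multiset ℕ) (k : ℕ) : ℕ := ((lam.sort (· ≥ ·)).take k).sum

/-- The dominance order on partitions of the same number. -/
def Dominates (lam kap : Multiset ℕ) : Prop := ∀ k, topSum kap k ≤ topSum lam k

/-- `kap` is the largest partition in `partitionSet s` dominated by `lam`. -/
def IsCollapse (s : ℤ) (lam kap : Multiset ℕ) : Prop :=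
  (kap ∈ partitionSet s lam.sum ∧ Dominates lam kap) ∧
  ∀ kap' ∈ partitionSet s lam.sum, Dominates lam kap' → Dominates kap kap'

/-- The collapse of a partition: the `B`-collapse for `s = 1` and odd sum, the `C`-collapse for
`s = -1` and even sum. -/
def collapse (s : ℤ) (lam : Multiset ℕ) : Multiset ℕ :=
  if h : ∃ kap, IsCollapse s lam kap then h.choose else 0

/-- The transposed partition. -/
def transposePart (lam : Multiset ℕ) : Multiset ℕ :=
  ((Multiset.range lam.sum).map fun k => lam.countP (k < ·)).filter (0 < ·)

/-- Increase the largest part by one. -/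
def incLargest (lam : Multiset ℕ) : Multiset ℕ := (lam.sup + 1) ::ₘ lam.erase lam.sup

/-- Decrease the smallest part by one (and drop it if it becomes zero). -/
def decSmallest (lam : Multiset ℕ) : Multiset ℕ :=
  ((sInf {c | c ∈ lam} - 1) ::ₘ lam.erase (sInf {c | c ∈ lam})).filter (0 < ·)

/-- The Barbasch--Vogan--Lusztig--Spaltenstein duality on partitions: from type `C_n` (`s = -1`)
to type `B_n` it is the transpose of the `B`-collapse of `lam⁺`, from type `B_n` (`s = 1`) to type
`C_n` it is the transpose of the `C`-collapse of `lam⁻`. -/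
def bvDual (s : ℤ) (lam : Multiset ℕ) : Multiset ℕ :=
  if s = -1 then transposePart (collapse 1 (incLargest lam))
  else transposePart (collapse (-1) (decSmallest lam))

/-! ### Relative special pieces -/

/-- `S(lam)`: the set of parts of good parity. -/
def goodSupp (s : ℤ) (lam : Multiset ℕ) : Finset ℕ := lam.toFinset.filter (GoodParity s)

/-- `S₀(lam)`: the set of parts of odd multiplicity. -/
def oddSupp (lam : Multiset ℕ) : Finset ℕ := lam.toFinset.filter fun c => Odd (lam.count c)

/-- The rank from the top in `S₀(lam)`: the largest element has rank `0`, the next one rank `1`, and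
so on. -/
def oddRank (lam : Multiset ℕ) (c : ℕ) : ℕ := ((oddSupp lam).filter (c < ·)).card

/-- `a` and `b` lie in a common interval of the equivalence relation on `S(lam)`. Write
`S₀(lam) = {ν₁ < ... < ν_r}`. For `s = -1` the intervals are `[ν_{r-2j-1}, ν_{r-2j}]` for
`0 ≤ j < ⌊r/2⌋`, and everything up to `ν₁` if `r` is odd. For `s = 1` they are
`[ν_{r-2j}, ν_{r-2j+1}]` for `0 < j < r/2`, and everything from `ν_r` on. -/
def Linked (s : ℤ) (lam : Multiset ℕ) (a b : ℕ) : Prop :=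
  (∃ u ∈ oddSupp lam, ∃ v ∈ oddSupp lam, oddRank lam u = oddRank lam v + 1 ∧
    ((s = -1 ∧ Even (oddRank lam v)) ∨ (s = 1 ∧ Odd (oddRank lam v))) ∧
    u ≤ a ∧ u ≤ b ∧ a ≤ v ∧ b ≤ v) ∨
  (s = -1 ∧ Odd (oddSupp lam).card ∧
    ∃ v ∈ oddSupp lam, oddRank lam v + 1 = (oddSupp lam).card ∧ a ≤ v ∧ b ≤ v) ∨
  (s = 1 ∧ ∃ u ∈ oddSupp lam, oddRank lam u = 0 ∧ u ≤ a ∧ u ≤ b)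

/-- The block (equivalence class) of `a` in `S(lam)`. -/
def blockOf (s : ℤ) (lam : Multiset ℕ) (a : ℕ) : Finset ℕ :=
  (goodSupp s lam).filter fun b => b = a ∨ Linked s lam a b

/-- The set of blocks `S†(lam)`. -/
def blocks (s : ℤ) (lam : Multiset ℕ) : Finset (Finset ℕ) := (goodSupp s lam).image (blockOf s lam)

/-- The smallest element of a block. -/
def blockMin (θ : Finset ℕ) : ℕ := sInf (θ : Set ℕ)

/-- The largest element of a block. -/
def blockMax (θ : Finset ℕ) : ℕ := θ.sup id

/-- Admissible blocks. -/
def AdmissibleBlock (s : ℤ) (lam : Multiset ℕ) (θ : Finset ℕ) : Prop :=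
  (∃ θ' ∈ blocks s lam, blockMax θ' + 2 = blockMin θ) ∨
  (blockMax θ = 2 ∧ blockMin θ = 2 ∧ 2 ∉ oddSupp lam) ∨
  (2 < blockMax θ ∧ blockMin θ = 2 ∧ 2 ∈ oddSupp lam)

/-- The set `𝕁(lam)` of integers `θ_min - 1`, for admissible blocks `θ`. -/
def JSet (s : ℤ) (lam : Multiset ℕ) : Finset ℕ :=
  ((blocks s lam).filter (AdmissibleBlock s lam)).image fun θ => blockMin θ - 1

/-- The union of the partitions `(c-1 c+1)` over `c ∈ J`, where `(0 2)` is read as `(2)`. -/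
def outerPairs (J : Finset ℕ) : Multiset ℕ :=
  (∑ c ∈ J, ({c - 1, c + 1} : Multiset ℕ)).filter (0 < ·)

/-- The operation `T_J`, which for all `c ∈ J` replaces the parts `(c-1 c+1)` by `(c c)`. -/
def TJ (J : Finset ℕ) (lam : Multiset ℕ) : Multiset ℕ :=
  (lam + ∑ c ∈ J, ({c, c} : Multiset ℕ)) - outerPairs J

/-- The relative special piece of `lam`. -/
def Spc (s : ℤ) (lam : Multiset ℕ) : Set (Multiset ℕ) := {mu | ∃ J ⊆ JSet s lam, mu = TJ J lam}

/-- The near-tempered table `𝔪_{lam, J}`, as a multiset of pairs `(a, b)`. -/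
def ntTable (lam : Multiset ℕ) (J : Finset ℕ) : Multiset (ℕ × ℕ) :=
  (lam - outerPairs J).map (fun a => (a, 1)) + J.val.map (fun c => (c, 2))

end Partitions

/-! ## The representations attached to tables -/

/-- The action of `g ∈ SL₂(ℂ)` on polynomials in two variables `X₀, X₁`, which extends the standard
action on the span of the variables. -/
def polyRep : Representation ℂ SL2 (MvPolynomial (Fin 2) ℂ) where
  toFun g := (MvPolynomial.aeval fun j : Fin 2 =>
    ∑ i : Fin 2, g i j • (MvPolynomial.X i : MvPolynomial (Fin 2) ℂ)).toLinearMap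
  map_one' := by
    have : (MvPolynomial.aeval fun j : Fin 2 => ∑ i : Fin 2, (1 : SL2) i j •
        (MvPolynomial.X i : MvPolynomial (Fin 2) ℂ)) = AlgHom.id ℂ _ := by
      ext j : 1
      fin_cases j <;> simp
    rw [this]
    rfl
  map_mul' g h := by
    have : (MvPolynomial.aeval fun j : Fin 2 => ∑ i : Fin 2, (g * h) i j •
        (MvPolynomial.X i : MvPolynomial (Fin 2) ℂ)) =
        (MvPolynomial.aeval fun j : Fin 2 => ∑ i : Fin 2, g i j •
          (MvPolynomial.X i : MvPolynomial (Fin 2) ℂ)).comp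
        (MvPolynomial.aeval fun j : Fin 2 => ∑ i : Fin 2, h i j •
          (MvPolynomial.X i : MvPolynomial (Fin 2) ℂ)) := by
      ext j : 1
      simp only [MvPolynomial.aeval_X, AlgHom.comp_apply, Fin.sum_univ_two, map_add, map_smul,
        Matrix.SpecialLinearGroup.coe_mul, Matrix.mul_apply]
      module
    rw [this]
    rfl

/-- The `k`-dimensional irreducible algebraic representation `ν_k` of `SL₂(ℂ)`, for `k ≥ 1`, on
binary forms of degree `k - 1`. -/
def nuRep (k : ℕ) :
    Representation ℂ SL2 (MvPolynomial.homogeneousSubmodule (Fin 2) ℂ (k - 1)) :=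
  polyRep.subrepresentation _ fun g p hp => by
    have h := MvPolynomial.IsHomogeneous.aeval (n := 1)
      ((MvPolynomial.mem_homogeneousSubmodule _ _).1 hp)
      (fun j : Fin 2 => ∑ i : Fin 2, g i j • (MvPolynomial.X i : MvPolynomial (Fin 2) ℂ))
      (fun j => (MvPolynomial.mem_homogeneousSubmodule _ _).1
        (Submodule.sum_mem _ fun i _ => Submodule.smul_mem _ _
          ((MvPolynomial.mem_homogeneousSubmodule _ _).2 (MvPolynomial.isHomogeneous_X ℂ i))))
    rw [one_mul] at h
    exact (MvPolynomial.mem_homogeneousSubmodule _ _).2 h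

section TableRep

variable {F : Type*} [Field F] [ValuativeRel F]

/-- The one-dimensional representation of `W_F` that maps Frobenius elements to `z` and is trivial
on the inertia group. -/
def signRep (z : ℤˣ) : Representation ℂ (WeilGroup F) ℂ where
  toFun w := ((unramifiedSign z w : ℂˣ) : ℂ) • LinearMap.id
  map_one' := by ext; simp
  map_mul' v w := by ext; simp [mul_comm]

/-- The representation `z ⊗ ν_a ⊗ ν_b` of `W_F × SL₂(ℂ) × SL₂(ℂ)`. -/
def pairRep (z : ℤˣ) (a b : ℕ) : Representation ℂ (WeilGroup F × SL2 × SL2)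
    (ℂ ⊗[ℂ] (MvPolynomial.homogeneousSubmodule (Fin 2) ℂ (a - 1) ⊗[ℂ]
      MvPolynomial.homogeneousSubmodule (Fin 2) ℂ (b - 1))) :=
  Representation.tprod ((signRep z).comp (MonoidHom.fst _ _))
    (Representation.tprod
      ((nuRep a).comp ((MonoidHom.fst _ _).comp (MonoidHom.snd (WeilGroup F) (SL2 × SL2))))
      ((nuRep b).comp ((MonoidHom.snd _ _).comp (MonoidHom.snd (WeilGroup F) (SL2 × SL2)))))

/-- The representation `ψ_{z, 𝔪}`, the direct sum of `z ⊗ ν_a ⊗ ν_b` over the entries `(a, b)` of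
the table `𝔪`. -/
def tableRep (z : ℤˣ) (m : Multiset (ℕ × ℕ)) : Representation ℂ (WeilGroup F × SL2 × SL2)
    (⨁ i : m, ℂ ⊗[ℂ] (MvPolynomial.homogeneousSubmodule (Fin 2) ℂ (i.1.1 - 1) ⊗[ℂ]
      MvPolynomial.homogeneousSubmodule (Fin 2) ℂ (i.1.2 - 1))) :=
  Representation.directSum fun i : m => pairRep z i.1.1 i.1.2

variable [TopologicalSpace F] [IsNonarchimedeanLocalField F] {N : ℕ}

/-- `φ = φ_{z, lam, mu}`: for a subset `J` of `𝕁(lam)` with `mu = T_J(lam)`, the `L`-parameter `φ` is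
the one attached to the `A`-parameter of the group whose underlying representation is
`ψ_{z, 𝔪_{lam, J}}`. -/
def LParameter.IsNearTempered (φ : LParameter F N) (z : ℤˣ) (lam mu : Multiset ℕ) : Prop :=
  ∃ J ⊆ JSet (groupSign N) lam, mu = TJ J lam ∧
    ∃ ψ : AParameter F N,
      Nonempty ((stdRep ψ.hom).Equiv (tableRep z (ntTable lam J))) ∧
      SameClass φ.hom ψ.lHom

end TableRep

end

/-! For a partition `lam` let Q_lam(x) be the sum of max(a - x, 0) over its parts a (`qf`).
Multiplicities are the second differences of Q, dominance is the pointwise order of the functions Q,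
the rank of (u - 1)^x is Q(x) for a unipotent u of Jordan type `lam`, and `lam` lies in
`partitionSet s` exactly when Q is even at all arguments of good parity. All combinatorics is done
with Q.

Two opposite inequalities are combined. In terms of Q, a collapse rounds down to even values at
arguments of one parity and restores convexity in between. So equality of the duals gives Q_lam ≤
Q_{lam(φ)} + 1, and it fixes the parity of Q_lam where equality holds at arguments of bad parity
(`qf_le_add_one_of_even`, `qf_le_add_one_of_odd`). On the other hand φ is unramified. Complete
reducibility for SL₂ and semisimplicity of Frobenius split it into summands ν_k on which z φ(Fr, 1)
acts by (√q)^m, that is, into a multisegment (m, k). The infinitesimal character says that this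
multisegment has the same exponents as the centred one with lengths `lam`. Centred segments are
nested, so they maximise the number of segments through any two exponents; summation gives
Q_{lam(φ)} ≤ Q_lam (`qf_map_snd_le`).

Hence Q_lam - Q_{lam(φ)} is the indicator function of a finite set J (`defectSet`) of integers of
bad parity. For c in J the parity of Q_lam(c) is that of the number of parts of odd multiplicity
above c, and its value says that no interval defining the blocks crosses c. This gives J ⊆ 𝕁(lam)
(`mem_JSet_of_gap`). The image of φ preserves a bilinear form, so the multisegment is symmetric
under m ↦ -m. A total rank deficit of one can then sit only at a symmetric pair of exponents (-x,
x), and inclusion-exclusion determines the multisegment: it is centred, with lengths those of `lam`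
without the pairs c - 1, c + 1, together with (1, c) and (-1, c) for c in J (`eq_of_segRank_eq`).

It remains to let a second SL₂ mix the two copies of ν_c by 2 × 2 matrices. As c has bad parity, the
invariant form on ν_c has the sign opposite to that of the dual group, so the form pairs the two
copies through (form on ν_c) ⊗ (determinant form on ℂ²), which SL₂ preserves (`mixRep_isometry`,
`PairedDecomposition.pos_neg_antisymm`). The action commutes with the first SL₂, and its torus
element diag(√q, 1/√q) is z φ(Fr, 1). This is the required A-parameter. -/

noncomputable section

/-! ## Partitions and their truncated sums -/

section TruncatedSums

/-- The sum of the truncated differences `max (a - x) 0` over the parts `a` of `lam`. -/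
def qf (lam : Multiset ℕ) (x : ℕ) : ℕ := (lam.map (· - x)).sum

@[simp] lemma qf_nil (x : ℕ) : qf 0 x = 0 := rfl

@[simp] lemma qf_cons (a : ℕ) (lam : Multiset ℕ) (x : ℕ) :
    qf (a ::ₘ lam) x = (a - x) + qf lam x := by simp [qf]

lemma qf_add (lam mu : Multiset ℕ) (x : ℕ) : qf (lam + mu) x = qf lam x + qf mu x := by
  simp [qf]

@[simp] lemma qf_zero (lam : Multiset ℕ) : qf lam 0 = lam.sum := by simp [qf]

/-- The second difference of x ↦ max(a - x, 0) is the indicator of a = x + 1. All multiplicities are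
recovered from truncated sums in this way. -/
lemma count_add_two_mul_qf (lam : Multiset ℕ) (x : ℕ) :
    lam.count (x + 1) + 2 * qf lam (x + 1) = qf lam x + qf lam (x + 2) := by
  induction lam using Multiset.induction with
  | empty => simp
  | cons a lam ih =>
    simp only [qf_cons, Multiset.count_cons]
    split_ifs <;> omega

lemma qf_eq_zero {lam : Multiset ℕ} {x : ℕ} (h : ∀ a ∈ lam, a ≤ x) : qf lam x = 0 := by
  induction lam using Multiset.induction with
  | empty => simp
  | cons a lam ih =>
    rw [qf_cons, ih fun b hb => h b (Multiset.mem_cons_of_mem hb)]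
    have := h a (Multiset.mem_cons_self a lam)
    omega

lemma qf_eq_zero_of_sum_le {lam : Multiset ℕ} {x : ℕ} (h : lam.sum ≤ x) : qf lam x = 0 :=
  qf_eq_zero fun _ ha => (Multiset.single_le_sum (fun _ _ => Nat.zero_le _) _ ha).trans h

lemma eq_of_qf_eq {lam mu : Multiset ℕ} (h0 : 0 ∉ lam) (h0' : 0 ∉ mu)
    (h : ∀ x, qf lam x = qf mu x) : lam = mu := by
  ext a
  rcases a with _ | x
  · rw [Multiset.count_eq_zero.2 h0, Multiset.count_eq_zero.2 h0']
  · have h1 := count_add_two_mul_qf lam x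
    have h2 := count_add_two_mul_qf mu x
    simp only [h] at h1
    omega

lemma qf_filter_pos (lam : Multiset ℕ) (x : ℕ) : qf (lam.filter (0 < ·)) x = qf lam x := by
  induction lam using Multiset.induction with
  | empty => simp
  | cons a lam ih =>
    rcases Nat.eq_zero_or_pos a with rfl | h
    · rw [Multiset.filter_cons_of_neg _ (by simp), ih]; simp
    · rw [Multiset.filter_cons_of_pos (p := (0 < ·)) _ h]; simp [ih]

lemma qf_add_card_mul {lam : Multiset ℕ} {x : ℕ} (h : ∀ a ∈ lam, x ≤ a) :
    qf lam x + lam.card * x = lam.sum := by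
  induction lam using Multiset.induction with
  | empty => simp
  | cons a lam ih =>
    have h1 := ih fun b hb => h b (Multiset.mem_cons_of_mem hb)
    have h2 := h a (Multiset.mem_cons_self a lam)
    rw [qf_cons, Multiset.card_cons, Multiset.sum_cons, add_mul]
    omega

lemma eq_of_second_difference_eq {f g : ℕ → ℕ} {B : ℕ} (hf : ∀ x, B ≤ x → f x = 0)
    (hg : ∀ x, B ≤ x → g x = 0)
    (h : ∀ x, f x + f (x + 2) + 2 * g (x + 1) = g x + g (x + 2) + 2 * f (x + 1)) (x : ℕ) :
    f x = g x := by
  have key : ∀ n x, B ≤ x + n → f x = g x := by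
    intro n
    induction n with
    | zero => intro x hx; rw [hf x hx, hg x hx]
    | succ n ih =>
      intro x hx
      have h1 := ih (x + 1) (by omega)
      have h2 := ih (x + 2) (by omega)
      have h3 := h x
      omega
  exact key B x (by omega)

/-- Converse of convexity: the second differences of Q are taken as multiplicities. -/
lemma exists_qf_eq_of_convex {Q : ℕ → ℕ} (hQ : ∀ x, 2 * Q (x + 1) ≤ Q x + Q (x + 2)) {B : ℕ}
    (hB : ∀ x, B ≤ x → Q x = 0) : ∃ K : Multiset ℕ, 0 ∉ K ∧ ∀ x, qf K x = Q x := by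
  let K : Multiset ℕ := ∑ x ∈ Finset.range B,
    Multiset.replicate (Q x + Q (x + 2) - 2 * Q (x + 1)) (x + 1)
  have hK : ∀ a ∈ K, 1 ≤ a ∧ a ≤ B := by
    intro a ha
    obtain ⟨x, hx, ha⟩ := Multiset.mem_sum.1 ha
    have := Multiset.eq_of_mem_replicate ha
    have := Finset.mem_range.1 hx
    omega
  have hc : ∀ x, K.count (x + 1) + 2 * Q (x + 1) = Q x + Q (x + 2) := by
    intro x
    have : K.count (x + 1) = Q x + Q (x + 2) - 2 * Q (x + 1) := by
      simp only [K, Multiset.count_sum', Multiset.count_replicate]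
      rcases lt_or_ge x B with h | h
      · rw [Finset.sum_eq_single_of_mem x (Finset.mem_range.2 h)]
        · simp
        · intro y _ hy
          rw [if_neg (by omega)]
      · rw [hB x h, hB (x + 2) (by omega)]
        simp only [add_zero, Nat.zero_sub]
        refine Finset.sum_eq_zero fun y hy => ?_
        have := Finset.mem_range.1 hy
        rw [if_neg (by omega)]
    have := hQ x
    omega
  refine ⟨K, fun h => absurd (hK 0 h).1 (by omega), ?_⟩
  refine eq_of_second_difference_eq (B := B)
    (fun x hx => qf_eq_zero fun a ha => (hK a ha).2.trans hx) hB fun x => ?_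
  have h1 := hc x
  have h2 := count_add_two_mul_qf K x
  omega

/-- Sums of the k largest parts and truncated sums are Legendre conjugates: topSum k is the minimum
over x of Q(x) + k x. This is the inequality; the next lemmas show that it is attained for
decreasing lists, for every k and for every x. -/
lemma List.sum_take_le (l : List ℕ) (k x : ℕ) :
    (l.take k).sum ≤ (l.map (· - x)).sum + k * x := by
  induction l generalizing k with
  | nil => simp
  | cons a l ih =>
    rcases k with _ | k
    · simp
    · have := ih k
      simp only [List.take_succ_cons, List.sum_cons, List.map_cons, add_mul]
      omega

lemma List.sum_map_sub_eq_zero {l : List ℕ} {x : ℕ} (h : ∀ a ∈ l, a ≤ x) :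
    (l.map (· - x)).sum = 0 := by
  refine List.sum_eq_zero fun b hb => ?_
  obtain ⟨a, ha, rfl⟩ := List.mem_map.1 hb
  have := h a ha
  omega

lemma List.exists_sum_take_eq {l : List ℕ} (hl : l.Pairwise (· ≥ ·)) (k : ℕ) :
    ∃ x, (x = 0 ∨ x ∈ l) ∧ (l.take k).sum = (l.map (· - x)).sum + k * x := by
  induction l generalizing k with
  | nil => exact ⟨0, by simp⟩
  | cons a l ih =>
    obtain ⟨h1, h2⟩ := List.pairwise_cons.1 hl
    rcases k with _ | k
    · refine ⟨a, by simp, ?_⟩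
      rw [List.sum_map_sub_eq_zero]
      · simp
      · intro b hb
        rcases List.mem_cons.1 hb with rfl | hb
        · exact le_rfl
        · exact h1 b hb
    · obtain ⟨x, hx, e⟩ := ih h2 k
      have hxa : x ≤ a := by
        rcases hx with rfl | hx
        · exact Nat.zero_le _
        · exact h1 x hx
      refine ⟨x, hx.imp_right (List.mem_cons_of_mem _), ?_⟩
      simp only [List.take_succ_cons, List.sum_cons, List.map_cons, add_mul]
      omega

lemma List.exists_sum_take_eq' {l : List ℕ} (hl : l.Pairwise (· ≥ ·)) (x : ℕ) :
    ∃ k, (l.take k).sum = (l.map (· - x)).sum + k * x := by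
  induction l with
  | nil => exact ⟨0, by simp⟩
  | cons a l ih =>
    obtain ⟨h1, h2⟩ := List.pairwise_cons.1 hl
    rcases le_or_gt a x with h | h
    · refine ⟨0, ?_⟩
      rw [List.sum_map_sub_eq_zero]
      · simp
      · intro b hb
        rcases List.mem_cons.1 hb with rfl | hb
        · exact h
        · exact (h1 b hb).trans h
    · obtain ⟨k, e⟩ := ih h2
      refine ⟨k + 1, ?_⟩
      simp only [List.take_succ_cons, List.sum_cons, List.map_cons, add_mul]
      omega

lemma qf_eq_sum_sort (lam : Multiset ℕ) (x : ℕ) :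
    qf lam x = ((lam.sort (· ≥ ·)).map (· - x)).sum := by
  conv_lhs => rw [← Multiset.sort_eq lam (· ≥ ·)]
  rw [qf, Multiset.map_coe, Multiset.sum_coe]

/-- Legendre conjugation preserves the pointwise order in both directions. -/
lemma dominates_iff_qf_le {lam kap : Multiset ℕ} :
    Dominates lam kap ↔ ∀ x, qf kap x ≤ qf lam x := by
  have key (mu : Multiset ℕ) := Multiset.pairwise_sort mu (· ≥ ·)
  constructor
  · intro h x
    obtain ⟨k, hk⟩ := List.exists_sum_take_eq' (key kap) x
    have h1 := h k
    have h2 := List.sum_take_le (lam.sort (· ≥ ·)) k x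
    rw [← qf_eq_sum_sort] at hk h2
    unfold topSum at h1
    omega
  · intro h k
    obtain ⟨x, -, hx⟩ := List.exists_sum_take_eq (key lam) k
    have h2 := List.sum_take_le (kap.sort (· ≥ ·)) k x
    have h1 := h x
    rw [← qf_eq_sum_sort] at hx h2
    unfold topSum
    omega

end TruncatedSums

/-! ### Orthogonal and symplectic partitions in terms of truncated sums -/

section PartitionSets

/-- A good part a contributes a - x, which is even or truncated to zero; the remaining parts are
counted twice. -/
lemma even_qf_of_mem_partitionSet {s : ℤ} {N : ℕ} {lam : Multiset ℕ}
    (h : lam ∈ partitionSet s N) {x : ℕ} (hx : GoodParity s x) : Even (qf lam x) := by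
  obtain ⟨-, -, μ, ν, hμ, rfl⟩ := h
  have h1 : Even (qf μ x) := by
    clear * - hμ hx
    induction μ using Multiset.induction with
    | empty => simp
    | cons a μ ih =>
      rw [qf_cons]
      refine Even.add ?_ (ih fun c hc => hμ c (Multiset.mem_cons_of_mem hc))
      have := hμ a (Multiset.mem_cons_self a μ)
      unfold GoodParity at this hx
      simp only [Nat.even_iff, Nat.odd_iff] at *
      omega
  rw [qf_add, qf_add, add_assoc]
  exact h1.add ⟨_, rfl⟩

/-- If c = x + 1 is not good then x and x + 2 are, and modulo two the multiplicity of c is the sum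
of the values there. -/
lemma even_count_of_even_qf {s : ℤ} (hs : s = 1 ∨ s = -1) {lam : Multiset ℕ} (h0 : 0 ∉ lam)
    (h : ∀ x, GoodParity s x → Even (qf lam x)) {c : ℕ} (hc : ¬ GoodParity s c) :
    Even (lam.count c) := by
  rcases c with _ | x
  · rw [Multiset.count_eq_zero.2 h0]; exact Even.zero
  · have h1 := count_add_two_mul_qf lam x
    have h2 : Even (qf lam x) := h x (by
      unfold GoodParity at *; simp only [Nat.even_iff, Nat.odd_iff] at *; omega)
    have h3 : Even (qf lam (x + 2)) := h (x + 2) (by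
      unfold GoodParity at *; simp only [Nat.even_iff, Nat.odd_iff] at *; omega)
    simp only [Nat.even_iff] at *
    omega

lemma even_count_of_mem_partitionSet {s : ℤ} (hs : s = 1 ∨ s = -1) {N : ℕ} {lam : Multiset ℕ}
    (h : lam ∈ partitionSet s N) {c : ℕ} (hc : ¬ GoodParity s c) : Even (lam.count c) :=
  even_count_of_even_qf hs h.1 (fun _ hx => even_qf_of_mem_partitionSet h hx) hc

open scoped Classical in
lemma mem_partitionSet_of_even_qf {s : ℤ} (hs : s = 1 ∨ s = -1) {N : ℕ} {lam : Multiset ℕ}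
    (h0 : 0 ∉ lam) (hN : lam.sum = N) (h : ∀ x, GoodParity s x → Even (qf lam x)) :
    lam ∈ partitionSet s N := by
  refine ⟨h0, hN, lam.filter (GoodParity s), ∑ c ∈ lam.toFinset,
    Multiset.replicate (if GoodParity s c then 0 else lam.count c / 2) c,
    fun c hc => (Multiset.mem_filter.1 hc).2, ?_⟩
  ext a
  have e : (∑ c ∈ lam.toFinset, Multiset.replicate
      (if GoodParity s c then 0 else lam.count c / 2) c).count a =
      if GoodParity s a then 0 else lam.count a / 2 := by
    rw [Multiset.count_sum', Finset.sum_eq_single a]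
    · simp
    · intro b _ hb
      rw [Multiset.count_replicate, if_neg hb]
    · intro ha
      rw [Multiset.mem_toFinset] at ha
      rw [Multiset.count_replicate, if_pos rfl, Multiset.count_eq_zero.2 ha]
      simp
  rw [Multiset.count_add, Multiset.count_add, e, Multiset.count_filter]
  split_ifs with hg
  · rfl
  · have := even_count_of_even_qf hs h0 h hg
    rw [Nat.even_iff] at this
    omega

end PartitionSets

/-! ## The collapse -/

section Collapse

open scoped Classical in
/-- The truncated sums of the collapse of a partition. -/
def collapseQf (s : ℤ) (lam : Multiset ℕ) (x : ℕ) : ℕ :=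
  if GoodParity s x then qf lam x - qf lam x % 2
  else if 1 ≤ x ∧ qf lam (x - 1) % 2 = 1 ∧ qf lam (x + 1) % 2 = 1 ∧
    qf lam (x - 1) + qf lam (x + 1) = 2 * qf lam x then qf lam x - 1 else qf lam x

lemma two_mul_qf_le (lam : Multiset ℕ) (x : ℕ) :
    2 * qf lam (x + 1) ≤ qf lam x + qf lam (x + 2) := by
  have := count_add_two_mul_qf lam x
  omega

lemma goodParity_succ {s : ℤ} (hs : s = 1 ∨ s = -1) (x : ℕ) :
    GoodParity s (x + 1) ↔ ¬ GoodParity s x := by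
  unfold GoodParity
  simp only [Nat.even_iff, Nat.odd_iff]
  omega

lemma collapseQf_le (s : ℤ) (lam : Multiset ℕ) (x : ℕ) : collapseQf s lam x ≤ qf lam x := by
  unfold collapseQf
  split_ifs <;> omega

/-- At a bad argument, rounding down the neighbours can destroy convexity only if both are odd and
the second difference is zero: with one odd neighbour, or with two and a positive second difference,
parity leaves enough slack. In the critical case the definition lowers the middle value too. -/
lemma two_mul_collapseQf_le {s : ℤ} (hs : s = 1 ∨ s = -1) (lam : Multiset ℕ) (x : ℕ) :
    2 * collapseQf s lam (x + 1) ≤ collapseQf s lam x + collapseQf s lam (x + 2) := by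
  have h := two_mul_qf_le lam x
  by_cases hx : GoodParity s x
  · have h1 : ¬ GoodParity s (x + 1) := by rw [goodParity_succ hs]; simpa using hx
    have h2 : GoodParity s (x + 2) := by rw [goodParity_succ hs]; exact h1
    simp only [collapseQf, if_pos hx, if_neg h1, if_pos h2, Nat.add_sub_cancel]
    split_ifs with h3
    · omega
    · have : x + 1 + 1 = x + 2 := rfl
      simp only [this] at h3
      omega
  · have h1 : GoodParity s (x + 1) := by rw [goodParity_succ hs]; exact hx
    have h2 : ¬ GoodParity s (x + 2) := by rw [goodParity_succ hs]; simpa using h1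
    simp only [collapseQf, if_neg hx, if_pos h1, if_neg h2]
    have : x + 2 - 1 = x + 1 := rfl
    simp only [this]
    split_ifs with h3 h4 <;> omega

/-- Rounding down at good arguments is forced by evenness, and the extra drop between two lowered
neighbours is forced by convexity. So `collapseQf` bounds every candidate, and being convex it is
attained. -/
lemma exists_isCollapse {s : ℤ} (hs : s = 1 ∨ s = -1) {lam : Multiset ℕ}
    (hlam : s = -1 → Even lam.sum) :
    ∃ K, IsCollapse s lam K ∧ ∀ x, qf K x = collapseQf s lam x := by
  obtain ⟨K, hK0, hK⟩ := exists_qf_eq_of_convex (two_mul_collapseQf_le hs lam)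
    (B := lam.sum) (fun x hx => by
      have := collapseQf_le s lam x
      rw [qf_eq_zero_of_sum_le hx] at this
      omega)
  -- The sum is the value at 0. It is untouched for s = 1, where 0 is not good, and for s = -1 it is
  -- already even.
  have hsum : K.sum = lam.sum := by
    rw [← qf_zero, hK, ← qf_zero]
    unfold collapseQf
    split_ifs with h1 h2
    · have : s = -1 := by
        unfold GoodParity at h1; simp at h1; exact h1
      have := hlam this
      rw [← qf_zero, Nat.even_iff] at this
      omega
    · omega
    · rfl
  refine ⟨K, ⟨⟨mem_partitionSet_of_even_qf hs hK0 hsum fun x hx => ?_, ?_⟩, ?_⟩, hK⟩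
  · rw [hK, collapseQf, if_pos hx, Nat.even_iff]
    omega
  · rw [dominates_iff_qf_le]
    intro x
    rw [hK]
    exact collapseQf_le s lam x
  · intro K' hK' hd
    rw [dominates_iff_qf_le] at hd ⊢
    intro x
    rw [hK, collapseQf]
    have h0 := hd x
    split_ifs with h1 h2
    · have := even_qf_of_mem_partitionSet hK' h1
      rw [Nat.even_iff] at this
      omega
    · obtain ⟨hx, ha, hb, hc⟩ := h2
      obtain ⟨y, rfl⟩ : ∃ y, x = y + 1 := ⟨x - 1, by omega⟩
      rw [goodParity_succ hs, not_not] at h1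
      have e1 := even_qf_of_mem_partitionSet hK' h1
      have e2 := even_qf_of_mem_partitionSet hK' (x := y + 2)
        (by rw [goodParity_succ hs, goodParity_succ hs, not_not]; exact h1)
      have h3 := two_mul_qf_le K' y
      have h4 := hd y
      have h5 := hd (y + 2)
      simp only [Nat.add_sub_cancel] at ha hc
      have : y + 1 + 1 = y + 2 := rfl
      simp only [this] at hb hc
      rw [Nat.even_iff] at e1 e2
      omega
    · exact h0

/-- Two collapses of the same partition dominate each other, so the one chosen in `collapse` has the
truncated sums computed above. -/
lemma qf_collapse {s : ℤ} (hs : s = 1 ∨ s = -1) {lam : Multiset ℕ}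
    (hlam : s = -1 → Even lam.sum) (x : ℕ) :
    qf (collapse s lam) x = collapseQf s lam x := by
  obtain ⟨K, hK, hq⟩ := exists_isCollapse hs hlam
  have h : ∃ kap, IsCollapse s lam kap := ⟨K, hK⟩
  rw [collapse, dif_pos h, ← hq]
  have h1 := h.choose_spec.2 K hK.1.1 hK.1.2
  have h2 := hK.2 h.choose h.choose_spec.1.1 h.choose_spec.1.2
  rw [dominates_iff_qf_le] at h1 h2
  exact le_antisymm (h2 x) (h1 x)

lemma zero_notMem_collapse (s : ℤ) (lam : Multiset ℕ) : 0 ∉ collapse s lam := by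
  unfold collapse
  split_ifs with h
  · exact h.choose_spec.1.1.1
  · simp

end Collapse

/-! ## The transposed partition -/

section Transpose

lemma Finset.mem_iff_lt_card_of_isLowerSet {A : Finset ℕ} (h : ∀ a ∈ A, ∀ b ≤ a, b ∈ A) (k : ℕ) :
    k ∈ A ↔ k < A.card := by
  constructor
  · intro hk
    have : Finset.range (k + 1) ⊆ A := fun b hb => h k hk b (by simpa [Nat.lt_succ_iff] using hb)
    simpa using Finset.card_le_card this
  · intro hk
    by_contra hn
    have : A ⊆ Finset.range k := fun a ha => by
      rw [Finset.mem_range]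
      by_contra hka
      exact hn (h a ha k (by omega))
    have := Finset.card_le_card this
    simp at this
    omega

lemma countP_lt_antitone (lam : Multiset ℕ) {k l : ℕ} (h : k ≤ l) :
    lam.countP (l < ·) ≤ lam.countP (k < ·) := by
  induction lam using Multiset.induction with
  | empty => simp
  | cons a lam ih =>
    simp only [Multiset.countP_cons]
    split_ifs <;> omega

/-- Both sides say that a box in position (j, k) belongs to the Young diagram. -/
lemma lt_countP_transposePart (lam : Multiset ℕ) (j k : ℕ) :
    k < (transposePart lam).countP (j < ·) ↔ j < lam.countP (k < ·) := by
  have e : (transposePart lam).countP (j < ·) =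
      ((Finset.range lam.sum).filter fun k => j < lam.countP (k < ·)).card := by
    rw [transposePart, Multiset.countP_filter, Multiset.countP_map, Finset.card_def,
      Finset.filter_val, Finset.range_val]
    congr 1
    refine Multiset.filter_congr fun k _ => ?_
    simp only [and_iff_left_iff_imp]
    omega
  rw [e, ← Finset.mem_iff_lt_card_of_isLowerSet]
  · rw [Finset.mem_filter, Finset.mem_range, and_iff_right_iff_imp]
    intro h
    have hp : 0 < lam.countP (k < ·) := by omega
    obtain ⟨a, ha, hka⟩ := Multiset.countP_pos.1 hp
    exact hka.trans_le (Multiset.single_le_sum (fun _ _ => Nat.zero_le _) _ ha)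
  · intro a ha b hb
    rw [Finset.mem_filter, Finset.mem_range] at *
    have := countP_lt_antitone lam hb
    omega

lemma countP_lt_succ (lam : Multiset ℕ) (k : ℕ) :
    lam.countP (k < ·) = lam.countP (k + 1 < ·) + lam.count (k + 1) := by
  induction lam using Multiset.induction with
  | empty => simp
  | cons a lam ih =>
    simp only [Multiset.countP_cons, Multiset.count_cons]
    split_ifs <;> omega

lemma eq_of_transposePart_eq {lam mu : Multiset ℕ} (h0 : 0 ∉ lam) (h0' : 0 ∉ mu)
    (h : transposePart lam = transposePart mu) : lam = mu := by
  have key : ∀ k, lam.countP (k < ·) = mu.countP (k < ·) := by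
    intro k
    refine eq_of_forall_lt_iff fun j => ?_
    rw [← lt_countP_transposePart, h, lt_countP_transposePart]
  ext a
  rcases a with _ | k
  · rw [Multiset.count_eq_zero.2 h0, Multiset.count_eq_zero.2 h0']
  · have h1 := countP_lt_succ lam k
    have h2 := countP_lt_succ mu k
    rw [key, key] at h1
    omega

end Transpose

/-! ## Partitions with the same dual -/

section SameDual

lemma qf_incLargest {lam : Multiset ℕ} (h : lam ≠ 0) (x : ℕ) :
    qf (incLargest lam) x = qf lam x + if x ≤ lam.sup then 1 else 0 := by
  classical
  obtain ⟨a, ha⟩ := Multiset.exists_mem_of_ne_zero h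
  have hs : lam.sup ∈ lam := by
    obtain ⟨b, hb, hb'⟩ := Finset.exists_mem_eq_sup lam.toFinset ⟨a, by simpa using ha⟩ id
    have : lam.sup = lam.toFinset.sup id := by
      rw [Finset.sup_def, Multiset.map_id, Multiset.toFinset_val, Multiset.sup_dedup]
    rw [this, hb']
    simpa using hb
  have e : qf lam x = qf (lam.sup ::ₘ lam.erase lam.sup) x := by rw [Multiset.cons_erase hs]
  have e' : incLargest lam = (lam.sup + 1) ::ₘ lam.erase lam.sup := by
    unfold incLargest
    congr!
  rw [e, e', qf_cons, qf_cons]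
  split_ifs <;> omega

lemma sInf_mem_of_ne_zero {lam : Multiset ℕ} (h : lam ≠ 0) : sInf {c | c ∈ lam} ∈ lam :=
  Nat.sInf_mem (s := {c | c ∈ lam}) (Multiset.exists_mem_of_ne_zero h)

lemma qf_decSmallest {lam : Multiset ℕ} (h : lam ≠ 0) (x : ℕ) :
    qf (decSmallest lam) x + (if x < sInf {c | c ∈ lam} then 1 else 0) = qf lam x := by
  classical
  have hs := sInf_mem_of_ne_zero h
  set m := sInf {c | c ∈ lam} with hm
  have e : qf lam x = qf (m ::ₘ lam.erase m) x := by rw [Multiset.cons_erase hs]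
  have e' : decSmallest lam = ((m - 1) ::ₘ lam.erase m).filter (0 < ·) := by
    unfold decSmallest
    rw [← hm]
  rw [e, e', qf_filter_pos, qf_cons, qf_cons]
  split_ifs <;> omega

lemma zero_lt_sInf_of_ne_zero {lam : Multiset ℕ} (h : lam ≠ 0) (h0 : 0 ∉ lam) :
    0 < sInf {c | c ∈ lam} :=
  Nat.pos_of_ne_zero fun e => h0 (e ▸ sInf_mem_of_ne_zero h)

lemma ne_zero_of_sum_pos {lam : Multiset ℕ} (h : 0 < lam.sum) : lam ≠ 0 := by
  rintro rfl; simp at h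

lemma collapseQf_eq_of_bvDual_eq_of_even {lam mu : Multiset ℕ}
    (h : bvDual (-1) mu = bvDual (-1) lam) (x : ℕ) :
    collapseQf 1 (incLargest mu) x = collapseQf 1 (incLargest lam) x := by
  simp only [bvDual, if_true] at h
  rw [← qf_collapse (Or.inl rfl) (by simp), ← qf_collapse (Or.inl rfl) (by simp),
    eq_of_transposePart_eq (zero_notMem_collapse _ _) (zero_notMem_collapse _ _) h]

lemma sum_decSmallest {lam : Multiset ℕ} (h : 0 < lam.sum) (h0 : 0 ∉ lam) :
    (decSmallest lam).sum + 1 = lam.sum := by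
  have hl := ne_zero_of_sum_pos h
  have := qf_decSmallest hl 0
  rwa [if_pos (zero_lt_sInf_of_ne_zero hl h0), qf_zero, qf_zero] at this

lemma collapseQf_eq_of_bvDual_eq_of_odd {N : ℕ} (hO : Odd N) {lam mu : Multiset ℕ}
    (hl : lam.sum = N) (hm : mu.sum = N) (hl0 : 0 ∉ lam) (hm0 : 0 ∉ mu)
    (h : bvDual 1 mu = bvDual 1 lam) (x : ℕ) :
    collapseQf (-1) (decSmallest mu) x = collapseQf (-1) (decSmallest lam) x := by
  have e : ∀ {kap : Multiset ℕ}, kap.sum = N → 0 ∉ kap → Even (decSmallest kap).sum := by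
    intro kap hk hk0
    have := sum_decSmallest (by rw [hk]; exact hO.pos) hk0
    rw [Nat.odd_iff] at hO
    rw [Nat.even_iff]
    omega
  rw [bvDual, bvDual, if_neg (by decide), if_neg (by decide)] at h
  rw [← qf_collapse (Or.inr rfl) (fun _ => e hm hm0), ← qf_collapse (Or.inr rfl)
    (fun _ => e hl hl0), eq_of_transposePart_eq (zero_notMem_collapse _ _)
    (zero_notMem_collapse _ _) h]

/-- The common collapse lies below `incLargest mu`, whose truncated sums exceed those of `mu` by at
most one; it lies at most one below `incLargest lam`. At odd x the loss in the collapse is the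
parity of the value, which settles the case of equality. -/
lemma qf_le_add_one_of_even {N : ℕ} (hN : 0 < N) {lam mu : Multiset ℕ}
    (hl : lam.sum = N) (hm : mu.sum = N) (h : bvDual (-1) mu = bvDual (-1) lam) (x : ℕ) :
    qf lam x ≤ qf mu x + 1 ∧ (Odd x → qf lam x = qf mu x + 1 → Even (qf lam x)) := by
  have e := collapseQf_eq_of_bvDual_eq_of_even h x
  have h1 := collapseQf_le 1 (incLargest mu) x
  rw [e, qf_incLargest (ne_zero_of_sum_pos (hm ▸ hN))] at h1
  have h2 := qf_incLargest (ne_zero_of_sum_pos (hl ▸ hN)) x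
  by_cases hx : x ≤ lam.sup
  · rw [if_pos hx] at h2
    have h4 : (if x ≤ mu.sup then 1 else 0) ≤ 1 := by split_ifs <;> omega
    by_cases ho : Odd x
    · have h3 : GoodParity 1 x := Or.inl ⟨rfl, ho⟩
      rw [collapseQf, if_pos h3, h2] at h1
      simp only [Nat.even_iff]
      omega
    · have h3 : ¬ GoodParity 1 x := by unfold GoodParity; simpa using ho
      rw [collapseQf, if_neg h3, h2] at h1
      refine ⟨?_, fun h => absurd h ho⟩
      split_ifs at h1 <;> omega
  · have : qf lam x = 0 := qf_eq_zero fun a ha => (Multiset.le_sup ha).trans (by omega)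
    rw [this]
    simp

/-- Two units could be lost here, one in `decSmallest lam` and one in its collapse. The first is
lost only below the smallest part, where the parity of the truncated sums is known and excludes the
second. -/
lemma qf_le_add_one_of_odd {N : ℕ} (hO : Odd N) {lam mu : Multiset ℕ}
    (hl : lam.sum = N) (hm : mu.sum = N) (hl0 : 0 ∉ lam) (hm0 : 0 ∉ mu)
    (h : bvDual 1 mu = bvDual 1 lam) (x : ℕ) :
    qf lam x ≤ qf mu x + 1 ∧ (Even x → qf lam x = qf mu x + 1 → Odd (qf lam x)) := by
  have hlz := ne_zero_of_sum_pos (hl ▸ hO.pos)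
  have e := collapseQf_eq_of_bvDual_eq_of_odd hO hl hm hl0 hm0 h x
  have h1 := collapseQf_le (-1) (decSmallest mu) x
  have h5 := qf_decSmallest (ne_zero_of_sum_pos (hm ▸ hO.pos)) x
  have h2 := qf_decSmallest hlz x
  -- Up to the smallest part nothing is truncated: the value is N - y * card, with N odd.
  have hpar : ∀ y, Even y → y ≤ sInf {c | c ∈ lam} → qf lam y % 2 = 1 := by
    intro y hy hy'
    have h3 := qf_add_card_mul (lam := lam) (x := y) fun a ha => hy'.trans (Nat.sInf_le ha)
    have h4 : Even (lam.card * y) := hy.mul_left _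
    rw [hl] at h3
    rw [Nat.odd_iff] at hO
    rw [Nat.even_iff] at h4
    omega
  rw [e] at h1
  by_cases hev : Even x
  · have hg : GoodParity (-1) x := Or.inr ⟨rfl, hev⟩
    rw [collapseQf, if_pos hg] at h1
    by_cases hx : x < sInf {c | c ∈ lam}
    · have := hpar x hev hx.le
      rw [if_pos hx] at h2
      simp only [Nat.odd_iff]
      omega
    · rw [if_neg hx] at h2
      simp only [Nat.odd_iff]
      omega
  · have hg : ¬ GoodParity (-1) x := by unfold GoodParity; simpa using hev
    refine ⟨?_, fun h => absurd h hev⟩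
    rw [collapseQf, if_neg hg] at h1
    by_cases hx : x < sInf {c | c ∈ lam}
    · rw [if_pos hx] at h2
      have h6 := hpar (x - 1) (by rw [Nat.even_iff] at *; omega) (by omega)
      have h7 := qf_decSmallest hlz (x - 1)
      rw [if_pos (by omega)] at h7
      rw [if_neg (by omega)] at h1
      omega
    · rw [if_neg hx] at h2
      split_ifs at h1 <;> omega

lemma groupSign_eq (N : ℕ) : groupSign N = 1 ∨ groupSign N = -1 := by
  unfold groupSign; split_ifs <;> simp

/-- The set of `x` for which the truncated sums of `lam` and `mu` differ. -/
def defectSet (lam mu : Multiset ℕ) : Finset ℕ :=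
  (Finset.range (lam.sum + 1)).filter fun x => qf lam x = qf mu x + 1

variable {N : ℕ} {lam mu : Multiset ℕ}

lemma mem_defectSet {x : ℕ} : x ∈ defectSet lam mu ↔ qf lam x = qf mu x + 1 := by
  rw [defectSet, Finset.mem_filter, Finset.mem_range, and_iff_right_iff_imp]
  intro h
  by_contra hx
  rw [qf_eq_zero_of_sum_le (by omega)] at h
  omega

lemma qf_le_add_one_of_bvDual_eq (hN : 0 < N) (hl : lam ∈ partitionSet (groupSign N) N)
    (hm : mu ∈ partitionSet (groupSign N) N) (h : bvDual (groupSign N) mu = bvDual (groupSign N) lam)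
    (x : ℕ) : qf lam x ≤ qf mu x + 1 := by
  by_cases hE : Even N
  · rw [groupSign, if_pos hE] at h
    exact (qf_le_add_one_of_even hN hl.2.1 hm.2.1 h x).1
  · rw [groupSign, if_neg hE] at h
    exact (qf_le_add_one_of_odd (Nat.not_even_iff_odd.1 hE) hl.2.1 hm.2.1 hl.1 hm.1 h x).1

lemma qf_eq_add_defect (hN : 0 < N) (hl : lam ∈ partitionSet (groupSign N) N)
    (hm : mu ∈ partitionSet (groupSign N) N) (h : bvDual (groupSign N) mu = bvDual (groupSign N) lam)
    (hle : ∀ x, qf mu x ≤ qf lam x) (x : ℕ) :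
    qf lam x = qf mu x + if x ∈ defectSet lam mu then 1 else 0 := by
  have h1 := qf_le_add_one_of_bvDual_eq hN hl hm h x
  have h2 := hle x
  split_ifs with h3 <;> rw [mem_defectSet] at h3 <;> omega

/-- At a good argument both truncated sums are even, so they cannot differ by one. -/
lemma not_goodParity_of_mem_defectSet (hl : lam ∈ partitionSet (groupSign N) N)
    (hm : mu ∈ partitionSet (groupSign N) N) {x : ℕ} (hx : x ∈ defectSet lam mu) :
    ¬ GoodParity (groupSign N) x := by
  intro hg
  have h1 := even_qf_of_mem_partitionSet hl hg
  have h2 := even_qf_of_mem_partitionSet hm hg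
  rw [mem_defectSet] at hx
  rw [Nat.even_iff] at *
  omega

lemma parity_qf_of_mem_defectSet (hN : 0 < N) (hl : lam ∈ partitionSet (groupSign N) N)
    (hm : mu ∈ partitionSet (groupSign N) N) (h : bvDual (groupSign N) mu = bvDual (groupSign N) lam)
    {x : ℕ} (hx : x ∈ defectSet lam mu) :
    if groupSign N = 1 then Odd (qf lam x) else Even (qf lam x) := by
  have hb := not_goodParity_of_mem_defectSet hl hm hx
  rw [mem_defectSet] at hx
  by_cases hE : Even N
  · have e : groupSign N = -1 := by rw [groupSign, if_pos hE]
    rw [e] at h hb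
    rw [e, if_neg (by decide)]
    refine (qf_le_add_one_of_even hN hl.2.1 hm.2.1 h x).2 ?_ hx
    unfold GoodParity at hb
    simpa using hb
  · have e : groupSign N = 1 := by rw [groupSign, if_neg hE]
    rw [e] at h hb
    rw [e, if_pos rfl]
    refine (qf_le_add_one_of_odd (Nat.not_even_iff_odd.1 hE) hl.2.1 hm.2.1 hl.1 hm.1 h x).2 ?_ hx
    unfold GoodParity at hb
    simpa using hb

lemma pos_of_mem_defectSet (hl : lam ∈ partitionSet (groupSign N) N)
    (hm : mu ∈ partitionSet (groupSign N) N) {x : ℕ} (hx : x ∈ defectSet lam mu) : 0 < x := by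
  rw [mem_defectSet] at hx
  rcases Nat.eq_zero_or_pos x with rfl | h
  · rw [qf_zero, qf_zero, hl.2.1, hm.2.1] at hx
    omega
  · exact h

/-- Second differences of Q_lam = Q_mu + indicator: `mu` arises from `lam` when c - 1, c + 1 are
replaced by c, c for all c in the defect set. -/
lemma count_add_defect (hN : 0 < N) (hl : lam ∈ partitionSet (groupSign N) N)
    (hm : mu ∈ partitionSet (groupSign N) N) (h : bvDual (groupSign N) mu = bvDual (groupSign N) lam)
    (hle : ∀ x, qf mu x ≤ qf lam x) (x : ℕ) :
    mu.count (x + 1) + ((if x ∈ defectSet lam mu then 1 else 0) +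
      if x + 2 ∈ defectSet lam mu then 1 else 0) =
      lam.count (x + 1) + 2 * if x + 1 ∈ defectSet lam mu then 1 else 0 := by
  have h1 := count_add_two_mul_qf lam x
  have h2 := count_add_two_mul_qf mu x
  have e := qf_eq_add_defect hN hl hm h hle
  rw [e x, e (x + 1), e (x + 2)] at h1
  omega

lemma count_outerPairs (J : Finset ℕ) (hJ : ∀ c ∈ J, 0 < c) (x : ℕ) :
    (outerPairs J).count (x + 1) = (if x ∈ J then 1 else 0) + if x + 2 ∈ J then 1 else 0 := by
  rw [outerPairs, Multiset.count_filter_of_pos (p := (0 < ·)) (Nat.succ_pos x),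
    Multiset.count_sum']
  have : ∀ c ∈ J, ({c - 1, c + 1} : Multiset ℕ).count (x + 1) =
      (if x = c then 1 else 0) + if x + 2 = c then 1 else 0 := by
    intro c hc
    have := hJ c hc
    simp only [Multiset.insert_eq_cons, Multiset.count_cons, Multiset.count_singleton]
    split_ifs <;> omega
  rw [Finset.sum_congr rfl this, Finset.sum_add_distrib, Finset.sum_ite_eq, Finset.sum_ite_eq]

/-- If x or x + 2 is in the defect set then x + 1 is good and is not. The positive term on the right
of `count_add_defect` is then absent, and `lam` really contains the pairs that are to be removed. -/
lemma defect_le_count (hN : 0 < N) (hl : lam ∈ partitionSet (groupSign N) N)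
    (hm : mu ∈ partitionSet (groupSign N) N) (h : bvDual (groupSign N) mu = bvDual (groupSign N) lam)
    (hle : ∀ x, qf mu x ≤ qf lam x) (x : ℕ) :
    (if x ∈ defectSet lam mu then 1 else 0) + (if x + 2 ∈ defectSet lam mu then 1 else 0) ≤
      lam.count (x + 1) := by
  have h1 := count_add_defect hN hl hm h hle x
  by_cases hx : x ∈ defectSet lam mu ∨ x + 2 ∈ defectSet lam mu
  · have h2 : x + 1 ∉ defectSet lam mu := by
      intro hx1
      have h3 := not_goodParity_of_mem_defectSet hl hm hx1
      rw [goodParity_succ (groupSign_eq N), not_not] at h3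
      rcases hx with hx | hx
      · exact not_goodParity_of_mem_defectSet hl hm hx h3
      · refine not_goodParity_of_mem_defectSet hl hm hx ?_
        rwa [goodParity_succ (groupSign_eq N), goodParity_succ (groupSign_eq N), not_not]
    rw [if_neg h2] at h1
    omega
  · rw [not_or] at hx
    rw [if_neg hx.1, if_neg hx.2]
    omega

end SameDual

/-! ## Admissible blocks -/

section Blocks

variable {s : ℤ} {lam : Multiset ℕ}

lemma mem_goodSupp {c : ℕ} : c ∈ goodSupp s lam ↔ c ∈ lam ∧ GoodParity s c := by
  simp [goodSupp]

lemma mem_oddSupp {c : ℕ} : c ∈ oddSupp lam ↔ Odd (lam.count c) := by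
  simp only [oddSupp, Finset.mem_filter, Multiset.mem_toFinset, and_iff_right_iff_imp]
  intro h
  exact Multiset.count_pos.1 h.pos

lemma Linked.symm {a b : ℕ} (h : Linked s lam a b) : Linked s lam b a := by
  rcases h with ⟨u, hu, v, hv, h1, h2, h3, h4, h5, h6⟩ | ⟨h1, h2, v, hv, h3, h4, h5⟩ |
    ⟨h1, u, hu, h2, h3, h4⟩
  · exact Or.inl ⟨u, hu, v, hv, h1, h2, h4, h3, h6, h5⟩
  · exact Or.inr (Or.inl ⟨h1, h2, v, hv, h3, h5, h4⟩)
  · exact Or.inr (Or.inr ⟨h1, u, hu, h2, h4, h3⟩)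

/-- The intervals that define the blocks are convex. -/
lemma Linked.mid {a b c d : ℕ} (h : Linked s lam a b) (hc : a ≤ c) (hc' : c ≤ b) (hd : a ≤ d)
    (hd' : d ≤ b) : Linked s lam c d := by
  rcases h with ⟨u, hu, v, hv, h1, h2, h3, h4, h5, h6⟩ | ⟨h1, h2, v, hv, h3, h4, h5⟩ |
    ⟨h1, u, hu, h2, h3, h4⟩
  · exact Or.inl ⟨u, hu, v, hv, h1, h2, h3.trans hc, h3.trans hd, hc'.trans h6, hd'.trans h6⟩
  · exact Or.inr (Or.inl ⟨h1, h2, v, hv, h3, hc'.trans h5, hd'.trans h5⟩)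
  · exact Or.inr (Or.inr ⟨h1, u, hu, h2, h3.trans hc, h3.trans hd⟩)

/-- The number of parts of odd multiplicity above `c`, when `c` separates two linked integers. -/
lemma Linked.oddRank_parity {a b c : ℕ} (h : Linked s lam a b) (ha : a ≤ c) (hb : c < b) :
    (s = -1 → Odd (oddRank lam c)) ∧ (s = 1 → Even (oddRank lam c)) := by
  rcases h with ⟨u, hu, v, hv, h1, h2, h3, h4, h5, h6⟩ | ⟨h1, h2, v, hv, h3, h4, h5⟩ |
    ⟨h1, u, hu, h2, h3, h4⟩
  -- u and v are consecutive parts of odd multiplicity with u ≤ c < v, so those above c are v and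
  -- the ones above v.
  · have e : oddRank lam c = oddRank lam v + 1 := by
      refine le_antisymm ?_ ?_
      · rw [← h1]
        exact Finset.card_le_card fun x hx => by
          rw [Finset.mem_filter] at *
          exact ⟨hx.1, by omega⟩
      · rw [oddRank, oddRank, ← Finset.card_insert_of_notMem (a := v) (by simp)]
        exact Finset.card_le_card fun x hx => by
          rw [Finset.mem_insert, Finset.mem_filter] at hx
          rw [Finset.mem_filter]
          rcases hx with rfl | hx
          · exact ⟨hv, by omega⟩
          · exact ⟨hx.1, by omega⟩
    rw [e]
    rcases h2 with ⟨rfl, h2⟩ | ⟨rfl, h2⟩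
    · exact ⟨fun _ => h2.add_one, fun h => absurd h (by decide)⟩
    · exact ⟨fun h => absurd h (by decide), fun _ => h2.add_one⟩
  · subst h1
    refine ⟨fun _ => ?_, fun h => absurd h (by decide)⟩
    have e : oddRank lam c = (oddSupp lam).card := by
      refine le_antisymm (Finset.card_le_card (Finset.filter_subset _ _)) ?_
      rw [← h3, oddRank, oddRank, ← Finset.card_insert_of_notMem (a := v) (by simp)]
      exact Finset.card_le_card fun x hx => by
        rw [Finset.mem_insert, Finset.mem_filter] at hx
        rw [Finset.mem_filter]
        rcases hx with rfl | hx
        · exact ⟨hv, by omega⟩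
        · exact ⟨hx.1, by omega⟩
    rw [e]
    exact h2
  · subst h1
    refine ⟨fun h => absurd h (by decide), fun _ => ?_⟩
    have e : oddRank lam c = 0 := by
      refine Nat.le_zero.1 ?_
      rw [← h2]
      exact Finset.card_le_card fun x hx => by
        rw [Finset.mem_filter] at *
        exact ⟨hx.1, by omega⟩
    rw [e]
    exact Even.zero

lemma blockMin_blockOf {a : ℕ} (ha : a ∈ goodSupp s lam)
    (h : ∀ b ∈ goodSupp s lam, b < a → ¬ Linked s lam a b) : blockMin (blockOf s lam a) = a := by
  refine le_antisymm (Nat.sInf_le (by simp [blockOf, ha])) ?_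
  refine le_csInf ⟨a, by simp [blockOf, ha]⟩ fun b hb => ?_
  simp only [blockOf, Finset.coe_filter, Set.mem_ofPred_eq] at hb
  obtain ⟨hb, rfl | hb'⟩ := hb
  · exact le_rfl
  · by_contra hab
    exact h b hb (not_le.1 hab) hb'

lemma blockMax_blockOf {a : ℕ} (ha : a ∈ goodSupp s lam)
    (h : ∀ b ∈ goodSupp s lam, a < b → ¬ Linked s lam a b) : blockMax (blockOf s lam a) = a := by
  refine le_antisymm (Finset.sup_le fun b hb => ?_)
    (Finset.le_sup (f := id) (by simp [blockOf, ha]))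
  simp only [blockOf, Finset.mem_filter] at hb
  obtain ⟨hb, rfl | hb'⟩ := hb
  · exact le_rfl
  · by_contra hab
    exact h b hb (not_le.1 hab) hb'

lemma blockOf_mem_blocks {a : ℕ} (ha : a ∈ goodSupp s lam) : blockOf s lam a ∈ blocks s lam :=
  Finset.mem_image_of_mem _ ha

/-- Modulo two only parts of odd multiplicity matter. They are good, so each one above the bad
integer c contributes an odd difference. The proof descends in steps of two by second differences.
-/
lemma qf_mod_two (hs : s = 1 ∨ s = -1) {N : ℕ} (hl : lam ∈ partitionSet s N) {c : ℕ}
    (hc : ¬ GoodParity s c) : qf lam c % 2 = oddRank lam c % 2 := by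
  have h1 : ∀ B, ∀ c, ¬ GoodParity s c → lam.sum ≤ c + 2 * B →
      qf lam c % 2 = oddRank lam c % 2 := by
    intro B
    induction B with
    | zero =>
      intro c hc hB
      rw [qf_eq_zero_of_sum_le (by simpa using hB)]
      have : oddRank lam c = 0 := by
        rw [oddRank, Finset.card_eq_zero, Finset.filter_eq_empty_iff]
        intro x hx
        have := Multiset.count_pos.1 (mem_oddSupp.1 hx).pos
        have := Multiset.single_le_sum (fun _ _ => Nat.zero_le _) _ this
        omega
      rw [this]
    | succ B ih =>
      intro c hc hB
      have hc1 : GoodParity s (c + 1) := by rwa [goodParity_succ hs]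
      have hc2 : ¬ GoodParity s (c + 2) := by rwa [goodParity_succ hs, not_not]
      have h2 := ih (c + 2) hc2 (by omega)
      have h3 := count_add_two_mul_qf lam c
      have h4 : oddRank lam c = oddRank lam (c + 2) + lam.count (c + 1) % 2 := by
        have hn : c + 2 ∉ oddSupp lam := by
          rw [mem_oddSupp, Nat.not_odd_iff_even]
          exact even_count_of_mem_partitionSet hs hl hc2
        by_cases ho : c + 1 ∈ oddSupp lam
        · have e : (oddSupp lam).filter (c < ·) =
              insert (c + 1) ((oddSupp lam).filter (c + 2 < ·)) := by
            ext x
            simp only [Finset.mem_filter, Finset.mem_insert]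
            constructor
            · rintro ⟨hx, hx'⟩
              rcases eq_or_ne x (c + 1) with rfl | h
              · exact Or.inl rfl
              · have : x ≠ c + 2 := fun e => hn (e ▸ hx)
                exact Or.inr ⟨hx, by omega⟩
            · rintro (rfl | ⟨hx, hx'⟩)
              · exact ⟨ho, by omega⟩
              · exact ⟨hx, by omega⟩
          rw [oddRank, oddRank, e, Finset.card_insert_of_notMem (by simp),
            Nat.odd_iff.1 (mem_oddSupp.1 ho)]
        · have e : (oddSupp lam).filter (c < ·) = (oddSupp lam).filter (c + 2 < ·) := by
            refine Finset.filter_congr fun x hx => ?_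
            have : x ≠ c + 2 := fun e => hn (e ▸ hx)
            have : x ≠ c + 1 := fun e => ho (e ▸ hx)
            omega
          rw [mem_oddSupp, Nat.not_odd_iff_even, Nat.even_iff] at ho
          rw [oddRank, oddRank, e, ho, add_zero]
      omega
  exact h1 lam.sum c hc (by omega)

/-- By `qf_mod_two` the hypothesis on Q(c) is the opposite of the parity that
`Linked.oddRank_parity` forces when an interval crosses c. So c + 1 starts its block and c - 1, if c
> 1, ends its own. The case c = 1 accounts for the two exceptional kinds of admissible blocks. -/
lemma mem_JSet_of_gap (hs : s = 1 ∨ s = -1) {N : ℕ} (hl : lam ∈ partitionSet s N) {c : ℕ}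
    (hc0 : 0 < c) (hc : ¬ GoodParity s c) (hp : if s = 1 then Odd (qf lam c) else Even (qf lam c))
    (h1 : c + 1 ∈ lam) (h2 : c = 1 ∨ c - 1 ∈ lam) : c ∈ JSet s lam := by
  have hr := qf_mod_two hs hl hc
  have hsep : ∀ a b, a ≤ c → c < b → ¬ Linked s lam a b := by
    intro a b ha hb h
    have := h.oddRank_parity ha hb
    rcases hs with rfl | rfl
    · rw [if_pos rfl, Nat.odd_iff] at hp
      have := this.2 rfl
      rw [Nat.even_iff] at this
      omega
    · rw [if_neg (by decide), Nat.even_iff] at hp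
      have := this.1 rfl
      rw [Nat.odd_iff] at this
      omega
  have hg : c + 1 ∈ goodSupp s lam := mem_goodSupp.2 ⟨h1, by rwa [goodParity_succ hs]⟩
  have hmin : blockMin (blockOf s lam (c + 1)) = c + 1 :=
    blockMin_blockOf hg fun b _ hb h => hsep b (c + 1) (by omega) (by omega) h.symm
  classical
  refine Finset.mem_image.2 ⟨blockOf s lam (c + 1), Finset.mem_filter.2
    ⟨blockOf_mem_blocks hg, ?_⟩, by rw [hmin]; rfl⟩
  rcases eq_or_ne c 1 with rfl | hc1
  · have hs1 : s = -1 := by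
      unfold GoodParity at hc
      simp at hc
      tauto
    subst hs1
    rw [if_neg (by decide), Nat.even_iff] at hp
    have hcard : oddRank lam 1 = (oddSupp lam).card := by
      rw [oddRank, Finset.filter_true_of_mem]
      intro x hx
      by_contra h
      have hx1 : x = 0 ∨ x = 1 := by omega
      have ho := mem_oddSupp.1 hx
      rcases hx1 with rfl | rfl
      · exact hl.1 (Multiset.count_pos.1 ho.pos)
      · exact Nat.not_even_iff_odd.2 ho (even_count_of_mem_partitionSet (Or.inr rfl) hl hc)
    have hev : (oddSupp lam).card % 2 = 0 := by omega
    -- The number of parts of odd multiplicity is even. If 2 is one of them it is ν₁, and it is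
    -- linked with ν₂ > 2; otherwise an interval through 2 would cross 1 in rank, and 2 is a block
    -- by itself.
    by_cases h2' : 2 ∈ oddSupp lam
    · refine Or.inr (Or.inr ⟨?_, hmin, h2'⟩)
      have hne : ((oddSupp lam).erase 2).Nonempty := by
        rw [← Finset.card_pos, Finset.card_erase_of_mem h2']
        have := Finset.card_pos.2 ⟨2, h2'⟩
        omega
      have hr1 : ∀ x ∈ oddSupp lam, 2 ≤ x := by
        intro x hx
        have : (oddSupp lam).filter (1 < ·) = oddSupp lam := by
          apply Finset.eq_of_subset_of_card_le (Finset.filter_subset _ _)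
          rw [← hcard]; rfl
        rw [← this, Finset.mem_filter] at hx
        omega
      set v := ((oddSupp lam).erase 2).min' hne with hv
      have hvm : v ∈ (oddSupp lam).erase 2 := Finset.min'_mem _ _
      have hv1 : v ∈ oddSupp lam := Finset.mem_of_mem_erase hvm
      have hv2 : v ≠ 2 := Finset.ne_of_mem_erase hvm
      have hv3 := hr1 v hv1
      have e2 : oddRank lam 2 + 1 = (oddSupp lam).card := by
        rw [oddRank, ← Finset.card_insert_of_notMem (a := 2) (by simp)]
        congr 1
        ext x
        simp only [Finset.mem_insert, Finset.mem_filter]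
        constructor
        · rintro (rfl | hx)
          · exact h2'
          · exact hx.1
        · intro hx
          have := hr1 x hx
          rcases eq_or_ne x 2 with rfl | hx2
          · exact Or.inl rfl
          · exact Or.inr ⟨hx, by omega⟩
      have ev : oddRank lam 2 = oddRank lam v + 1 := by
        rw [oddRank, oddRank, ← Finset.card_insert_of_notMem (a := v) (by simp)]
        congr 1
        ext x
        simp only [Finset.mem_insert, Finset.mem_filter]
        constructor
        · rintro ⟨hx, hx2⟩
          have : v ≤ x := Finset.min'_le _ _ (Finset.mem_erase.2 ⟨by omega, hx⟩)
          rcases eq_or_ne x v with rfl | hxv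
          · exact Or.inl rfl
          · exact Or.inr ⟨hx, by omega⟩
        · rintro (rfl | ⟨hx, hx2⟩)
          · exact ⟨hv1, by omega⟩
          · exact ⟨hx, by omega⟩
      have hL : Linked (-1) lam 2 v := Or.inl ⟨2, h2', v, hv1, ev,
        Or.inl ⟨rfl, by rw [Nat.even_iff]; omega⟩, le_rfl, hv3, hv3, le_rfl⟩
      have hvg : v ∈ goodSupp (-1) lam := by
        refine mem_goodSupp.2 ⟨Multiset.count_pos.1 (mem_oddSupp.1 hv1).pos, ?_⟩
        by_contra hb
        exact Nat.not_even_iff_odd.2 (mem_oddSupp.1 hv1)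
          (even_count_of_mem_partitionSet (Or.inr rfl) hl hb)
      refine lt_of_lt_of_le (show 2 < v by omega) (Finset.le_sup (f := id) (b := v) ?_)
      simp only [blockOf, Finset.mem_filter]
      exact ⟨hvg, Or.inr hL⟩
    · refine Or.inr (Or.inl ⟨?_, hmin, h2'⟩)
      refine blockMax_blockOf hg fun b hb hb2 h => ?_
      have h3 := (h.oddRank_parity le_rfl hb2).1 rfl
      have : oddRank lam 2 = oddRank lam 1 := by
        rw [oddRank, oddRank]
        congr 1
        refine Finset.filter_congr fun x hx => ?_
        have : x ≠ 2 := fun e => h2' (e ▸ hx)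
        omega
      simp only [Nat.reduceAdd] at h3
      rw [this, Nat.odd_iff] at h3
      omega
  · have h2 := h2.resolve_left hc1
    have hg' : c - 1 ∈ goodSupp s lam := by
      refine mem_goodSupp.2 ⟨h2, ?_⟩
      obtain ⟨d, rfl⟩ : ∃ d, c = d + 1 := ⟨c - 1, by omega⟩
      rwa [goodParity_succ hs, not_not] at hc
    refine Or.inl ⟨blockOf s lam (c - 1), blockOf_mem_blocks hg', ?_⟩
    rw [hmin, blockMax_blockOf hg' ?_]
    · omega
    · intro b hb hb' h
      have hbc : b ≠ c := by
        rintro rfl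
        exact hc (mem_goodSupp.1 hb).2
      exact hsep _ _ (by omega) (by omega) h

lemma defectSet_subset_JSet {N : ℕ} {mu : Multiset ℕ} (hN : 0 < N)
    (hl : lam ∈ partitionSet (groupSign N) N)
    (hm : mu ∈ partitionSet (groupSign N) N) (h : bvDual (groupSign N) mu = bvDual (groupSign N) lam)
    (hle : ∀ x, qf mu x ≤ qf lam x) : defectSet lam mu ⊆ JSet (groupSign N) lam := by
  intro c hc
  have hc0 := pos_of_mem_defectSet hl hm hc
  refine mem_JSet_of_gap (groupSign_eq N) hl hc0 (not_goodParity_of_mem_defectSet hl hm hc)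
    (parity_qf_of_mem_defectSet hN hl hm h hc) ?_ ?_
  · have := defect_le_count hN hl hm h hle c
    rw [if_pos hc] at this
    exact Multiset.count_pos.1 (by omega)
  · rcases Nat.lt_or_ge c 2 with h2 | h2
    · exact Or.inl (by omega)
    · right
      obtain ⟨d, rfl⟩ : ∃ d, c = d + 2 := ⟨c - 2, by omega⟩
      have := defect_le_count hN hl hm h hle d
      rw [if_pos hc] at this
      exact Multiset.count_pos.1 (show 0 < lam.count (d + 1) by omega)

end Blocks

/-! ## Multisegments -/

section Segments

/-- `e` is one of the exponents `m + k - 1 - 2 * j`, `0 ≤ j < k`, of the segment `(m, k)`. -/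
def InSeg (p : ℤ × ℕ) (e : ℤ) : Prop :=
  p.1 - p.2 + 1 ≤ e ∧ e ≤ p.1 + p.2 - 1 ∧ (p.1 + p.2 - 1 - e) % 2 = 0

instance (p : ℤ × ℕ) : DecidablePred (InSeg p) := fun e => by unfold InSeg; infer_instance

/-- The number of segments that contain both `e` and `f`. -/
def segRank (S : Multiset (ℤ × ℕ)) (e f : ℤ) : ℕ := S.countP fun p => InSeg p e ∧ InSeg p f

/-- The multisegment of the centred segments with lengths in `lam`. -/
def centred (lam : Multiset ℕ) : Multiset (ℤ × ℕ) := lam.map fun k => (0, k)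

lemma segRank_cons (p : ℤ × ℕ) (S : Multiset (ℤ × ℕ)) (e f : ℤ) :
    segRank (p ::ₘ S) e f = segRank S e f + if InSeg p e ∧ InSeg p f then 1 else 0 :=
  Multiset.countP_cons _ _ _

lemma segRank_comm (S : Multiset (ℤ × ℕ)) (e f : ℤ) : segRank S e f = segRank S f e :=
  Multiset.countP_congr rfl fun p _ => by simp [and_comm]

lemma segRank_le_left (S : Multiset (ℤ × ℕ)) (e f : ℤ) : segRank S e f ≤ segRank S e e := by
  unfold segRank
  rw [Multiset.countP_eq_card_filter, Multiset.countP_eq_card_filter]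
  exact Multiset.card_le_card (Multiset.monotone_filter_right _ fun p h => ⟨h.1, h.1⟩)

/-- A centred segment that contains f contains all e of the same parity with |e| ≤ |f|. -/
lemma segRank_centred {lam : Multiset ℕ} {e f : ℤ} (h : |e| ≤ |f|) (hp : (f - e) % 2 = 0) :
    segRank (centred lam) e f = segRank (centred lam) f f := by
  refine Multiset.countP_congr rfl fun p hpm => ?_
  obtain ⟨k, -, rfl⟩ := Multiset.mem_map.1 hpm
  simp only [eq_iff_iff, InSeg]
  rcases abs_cases e with ⟨h1, h2⟩ | ⟨h1, h2⟩ <;> rcases abs_cases f with ⟨h3, h4⟩ | ⟨h3, h4⟩ <;>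
    omega

/-- Every rank is bounded by both diagonal ranks, and a centred multisegment attains the bound at
the exponent of larger absolute value. -/
lemma segRank_le_centred {S : Multiset (ℤ × ℕ)} {lam : Multiset ℕ}
    (h : ∀ e, segRank S e e = segRank (centred lam) e e) {e f : ℤ} (hp : (f - e) % 2 = 0) :
    segRank S e f ≤ segRank (centred lam) e f := by
  rcases le_total |e| |f| with hef | hef
  · rw [segRank_centred hef hp, ← h, segRank_comm]
    exact segRank_le_left _ _ _
  · rw [segRank_comm (centred lam), segRank_centred hef (by omega), ← h]
    exact segRank_le_left _ _ _

lemma segRank_neg {S : Multiset (ℤ × ℕ)} (h : S.map (fun p => (-p.1, p.2)) = S) (e f : ℤ) :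
    segRank S (-e) (-f) = segRank S e f := by
  conv_rhs => rw [← h]
  rw [segRank, segRank, Multiset.countP_map, Multiset.countP_eq_card_filter]
  congr 1
  refine Multiset.filter_congr fun p _ => ?_
  simp only [InSeg]
  omega

lemma segRank_eq_zero {S : Multiset (ℤ × ℕ)} {B : ℤ} (hB : ∀ p ∈ S, |p.1| + p.2 ≤ B) {e : ℤ}
    (he : e ∉ Finset.Icc (-B) B) (f : ℤ) : segRank S e f = 0 := by
  rw [segRank, Multiset.countP_eq_zero]
  rintro p hp ⟨h1, -⟩
  have := hB p hp
  rw [Finset.mem_Icc] at he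
  unfold InSeg at h1
  rcases abs_cases p.1 with ⟨h3, h4⟩ | ⟨h3, h4⟩ <;> omega

/-- A segment of length k contains k - x pairs (e, e + 2x) when x ≤ k, and none otherwise. This
turns inequalities of ranks into inequalities of truncated sums of the lengths. -/
lemma sum_segRank {S : Multiset (ℤ × ℕ)} {B : ℤ} (hB : ∀ p ∈ S, |p.1| + p.2 ≤ B) (x : ℕ) :
    ∑ e ∈ Finset.Icc (-B) B, segRank S e (e + 2 * x) = qf (S.map Prod.snd) x := by
  induction S using Multiset.induction with
  | empty => simp [segRank]
  | cons p S ih =>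
    simp only [segRank_cons]
    rw [Finset.sum_add_distrib, ih fun q hq => hB q (Multiset.mem_cons_of_mem hq),
      Multiset.map_cons, qf_cons, add_comm]
    congr 1
    have hp := hB p (Multiset.mem_cons_self p S)
    rw [← Finset.card_filter]
    have : (Finset.Icc (-B) B).filter (fun e => InSeg p e ∧ InSeg p (e + 2 * x)) =
        (Finset.range (p.2 - x)).image fun j : ℕ => p.1 - p.2 + 1 + 2 * (j : ℤ) := by
      ext e
      rw [Finset.mem_filter, Finset.mem_Icc, Finset.mem_image]
      constructor
      · rintro ⟨-, h1, h2⟩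
        unfold InSeg at h1 h2
        simp only [Finset.mem_range]
        exact ⟨((e - (p.1 - p.2 + 1)) / 2).toNat, by omega, by omega⟩
      · rintro ⟨j, hj, rfl⟩
        rw [Finset.mem_range] at hj
        unfold InSeg
        rcases abs_cases p.1 with ⟨h3, h4⟩ | ⟨h3, h4⟩ <;> omega
    rw [this, Finset.card_image_of_injective _ (fun a b hab => by simpa using hab),
      Finset.card_range]

lemma exists_seg_bound (S : Multiset (ℤ × ℕ)) : ∃ B : ℤ, ∀ p ∈ S, |p.1| + p.2 ≤ B := by
  refine ⟨(S.map fun p : ℤ × ℕ => |p.1| + (p.2 : ℤ)).sum, fun p hp => ?_⟩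
  refine Multiset.single_le_sum (fun y hy => ?_) _
    (Multiset.mem_map_of_mem (fun p : ℤ × ℕ => |p.1| + (p.2 : ℤ)) hp)
  obtain ⟨q, -, rfl⟩ := Multiset.mem_map.1 hy
  positivity

lemma exists_common_seg_bound (S S' : Multiset (ℤ × ℕ)) :
    ∃ B : ℤ, (∀ p ∈ S, |p.1| + p.2 ≤ B) ∧ ∀ p ∈ S', |p.1| + p.2 ≤ B := by
  obtain ⟨B, hB⟩ := exists_seg_bound (S + S')
  exact ⟨B, fun p hp => hB p (Multiset.mem_add.2 (Or.inl hp)),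
    fun p hp => hB p (Multiset.mem_add.2 (Or.inr hp))⟩

lemma map_snd_centred (lam : Multiset ℕ) : (centred lam).map Prod.snd = lam := by
  simp [centred]

lemma qf_map_snd_le {S : Multiset (ℤ × ℕ)} {lam : Multiset ℕ}
    (h : ∀ e, segRank S e e = segRank (centred lam) e e) (x : ℕ) :
    qf (S.map Prod.snd) x ≤ qf lam x := by
  obtain ⟨B, hB, hB'⟩ := exists_common_seg_bound S (centred lam)
  conv_rhs => rw [← map_snd_centred lam]
  rw [← sum_segRank hB, ← sum_segRank hB']
  exact Finset.sum_le_sum fun e _ => segRank_le_centred h (by omega)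

/-- For fixed x the rank deficits are nonnegative with sum 0 or 1, and they are invariant under e ↦
-e - 2x. A deficit away from the fixed point e = -x would occur twice. -/
lemma segRank_centred_eq {S : Multiset (ℤ × ℕ)} {lam : Multiset ℕ} {J : Finset ℕ}
    (h : ∀ e, segRank S e e = segRank (centred lam) e e)
    (hsymm : S.map (fun p => (-p.1, p.2)) = S)
    (hJ : ∀ x, qf lam x = qf (S.map Prod.snd) x + if x ∈ J then 1 else 0) (e : ℤ) (x : ℕ) :
    segRank (centred lam) e (e + 2 * x) =
      segRank S e (e + 2 * x) + if e = -x ∧ x ∈ J then 1 else 0 := by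
  obtain ⟨B, hB, hB'⟩ := exists_common_seg_bound S (centred lam)
  have hle : ∀ e, segRank S e (e + 2 * x) ≤ segRank (centred lam) e (e + 2 * x) :=
    fun e => segRank_le_centred h (by omega)
  have hsymm' : (centred lam).map (fun p => (-p.1, p.2)) = centred lam := by
    simp [centred]
  set δ : ℤ → ℕ := fun e => segRank (centred lam) e (e + 2 * x) - segRank S e (e + 2 * x) with hδ
  have hsum : ∑ e ∈ Finset.Icc (-B) B, δ e = if x ∈ J then 1 else 0 := by
    have h1 := hJ x
    conv_lhs at h1 => rw [← map_snd_centred lam]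
    rw [← sum_segRank hB, ← sum_segRank hB'] at h1
    have h2 : ∑ e ∈ Finset.Icc (-B) B, segRank (centred lam) e (e + 2 * x) =
        ∑ e ∈ Finset.Icc (-B) B, δ e + ∑ e ∈ Finset.Icc (-B) B, segRank S e (e + 2 * x) := by
      rw [← Finset.sum_add_distrib]
      refine Finset.sum_congr rfl fun e _ => ?_
      have := hle e
      simp only [hδ]
      omega
    omega
  have hout : ∀ e : ℤ, e ∉ Finset.Icc (-B) B → δ e = 0 := by
    intro e he
    simp only [hδ, segRank_eq_zero hB' he, Nat.zero_sub]
  have hneg : ∀ e : ℤ, δ (-e - 2 * x) = δ e := by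
    intro e
    have e1 : -e - 2 * (x : ℤ) = -(e + 2 * x) := by ring
    have e2 : -(e + 2 * (x : ℤ)) + 2 * x = -e := by ring
    simp only [hδ, e1, e2, segRank_neg hsymm, segRank_neg hsymm', segRank_comm _ (e + 2 * x) e]
  have hsingle : ∀ e : ℤ, e ≠ -x → δ e = 0 := by
    intro e he
    by_contra hne
    have m1 : e ∈ Finset.Icc (-B) B := by
      by_contra hm; exact hne (hout e hm)
    have m2 : -e - 2 * x ∈ Finset.Icc (-B) B := by
      by_contra hm; exact hne (hneg e ▸ hout _ hm)
    have h3 : δ e + δ (-e - 2 * x) ≤ ∑ e ∈ Finset.Icc (-B) B, δ e := by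
      rw [← Finset.sum_pair (show e ≠ -e - 2 * x by omega)]
      refine Finset.sum_le_sum_of_subset fun a ha => ?_
      rw [Finset.mem_insert, Finset.mem_singleton] at ha
      rcases ha with rfl | rfl
      · exact m1
      · exact m2
    rw [hneg, hsum] at h3
    split_ifs at h3 <;> omega
  have hδe : δ e = if e = -x ∧ x ∈ J then 1 else 0 := by
    by_cases he : e = -x
    · subst he
      -- The point -x is inserted because it may lie outside the range of summation, where the
      -- deficit vanishes.
      rw [← Finset.sum_eq_single_of_mem (s := insert (-(x : ℤ)) (Finset.Icc (-B) B)) (f := δ) _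
        (Finset.mem_insert_self _ _) (fun b _ hb => hsingle b hb)]
      by_cases hm : -(x : ℤ) ∈ Finset.Icc (-B) B
      · rw [Finset.insert_eq_of_mem hm, hsum]; simp
      · rw [Finset.sum_insert hm, hout _ hm, hsum]; simp
    · rw [hsingle e he]; simp [he]
  have := hle e
  simp only [hδ] at hδe
  omega

/-- Inclusion-exclusion: among the segments through both ends of (m, k), this one is characterised
by missing the next exponents m - k - 1 and m + k + 1. -/
lemma count_add_segRank {S : Multiset (ℤ × ℕ)} (hS : ∀ p ∈ S, 1 ≤ p.2) {m : ℤ} {k : ℕ}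
    (hk : 1 ≤ k) :
    S.count (m, k) + segRank S (m - k - 1) (m + k - 1) + segRank S (m - k + 1) (m + k + 1) =
      segRank S (m - k + 1) (m + k - 1) + segRank S (m - k - 1) (m + k + 1) := by
  induction S using Multiset.induction with
  | empty => simp [segRank]
  | cons p S ih =>
    have := ih fun q hq => hS q (Multiset.mem_cons_of_mem hq)
    have hp := hS p (Multiset.mem_cons_self p S)
    obtain ⟨a, b⟩ := p
    have key : ((if m = a ∧ k = b then 1 else 0) +
        (if InSeg (a, b) (m - k - 1) ∧ InSeg (a, b) (m + k - 1) then 1 else 0) +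
        if InSeg (a, b) (m - k + 1) ∧ InSeg (a, b) (m + k + 1) then 1 else 0) =
        (if InSeg (a, b) (m - k + 1) ∧ InSeg (a, b) (m + k - 1) then 1 else 0) +
        if InSeg (a, b) (m - k - 1) ∧ InSeg (a, b) (m + k + 1) then 1 else 0 := by
      clear * - hp hk
      split_ifs <;> unfold InSeg at * <;> dsimp only at * <;> omega
    simp only [segRank_cons, Multiset.count_cons, Prod.mk.injEq]
    omega

lemma count_map_pair (M : Multiset ℕ) (a m : ℤ) (k : ℕ) :
    (M.map fun k => (a, k)).count (m, k) = if m = a then M.count k else 0 := by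
  split_ifs with h
  · subst h
    exact Multiset.count_map_eq_count' (fun k : ℕ => (m, k)) _ (fun x y h => by simpa using h) k
  · rw [Multiset.count_eq_zero]
    intro hm
    obtain ⟨y, -, hy⟩ := Multiset.mem_map.1 hm
    exact h (congrArg Prod.fst hy).symm

/-- A symmetric multisegment with the same exponents as a centred one, whose ranks differ from those
of the centred one by at most one. -/
lemma eq_of_segRank_eq {S : Multiset (ℤ × ℕ)} (hS : ∀ p ∈ S, 1 ≤ p.2) {lam : Multiset ℕ}
    (h0 : 0 ∉ lam) {J : Finset ℕ} (hJ0 : ∀ c ∈ J, 0 < c)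
    (h : ∀ e, segRank S e e = segRank (centred lam) e e)
    (hsymm : S.map (fun p => (-p.1, p.2)) = S)
    (hJ : ∀ x, qf lam x = qf (S.map Prod.snd) x + if x ∈ J then 1 else 0) :
    S = centred (lam - outerPairs J) + (J.val.map fun c => (1, c)) +
      J.val.map fun c => (-1, c) := by
  have hlam1 : ∀ p ∈ centred lam, 1 ≤ p.2 := by
    intro p hp
    obtain ⟨k, hk, rfl⟩ := Multiset.mem_map.1 hp
    exact Nat.pos_of_ne_zero fun e => h0 (e ▸ hk)
  have key := segRank_centred_eq h hsymm hJ
  ext ⟨m, k⟩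
  rw [Multiset.count_add, Multiset.count_add, count_map_pair, count_map_pair, centred,
    count_map_pair, Multiset.count_sub]
  have hJc : J.val.count k = if k ∈ J then 1 else 0 := by
    rw [Multiset.count_eq_of_nodup J.nodup]; rfl
  rw [hJc]
  rcases k with _ | k
  · have hz : (0 : ℕ) ∉ J := fun hz => absurd (hJ0 0 hz) (by omega)
    rw [if_neg hz, Multiset.count_eq_zero.2 h0, Multiset.count_eq_zero.2]
    · simp
    · intro hm
      have := hS _ hm
      simp at this
  · rw [count_outerPairs J hJ0]
    have h1 := count_add_segRank hS (m := m) (k := k + 1) (by omega)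
    have h2 := count_add_segRank hlam1 (m := m) (k := k + 1) (by omega)
    have e1 := key (m - (k + 1 : ℕ) + 1) k
    have e2 := key (m - (k + 1 : ℕ) - 1) (k + 1)
    have e3 := key (m - (k + 1 : ℕ) + 1) (k + 1)
    have e4 := key (m - (k + 1 : ℕ) - 1) (k + 2)
    rw [show m - (k + 1 : ℕ) + 1 + 2 * (k : ℤ) = m + (k + 1 : ℕ) - 1 by push_cast; ring] at e1
    rw [show m - (k + 1 : ℕ) - 1 + 2 * ((k + 1 : ℕ) : ℤ) = m + (k + 1 : ℕ) - 1 by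
      push_cast; ring] at e2
    rw [show m - (k + 1 : ℕ) + 1 + 2 * ((k + 1 : ℕ) : ℤ) = m + (k + 1 : ℕ) + 1 by
      push_cast; ring] at e3
    rw [show m - (k + 1 : ℕ) - 1 + 2 * ((k + 2 : ℕ) : ℤ) = m + (k + 1 : ℕ) + 1 by
      push_cast; ring] at e4
    rw [e1, e2, e3, e4, centred, count_map_pair] at h2
    -- Of the four pairs of exponents around a segment of length k + 1, those at half-distance k and
    -- k + 2 are symmetric about 0 for m = 0, and the two at half-distance k + 1 for m = 1 and m =
    -- -1. Only there can a deficit occur.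
    have f1 : (m - ((k + 1 : ℕ) : ℤ) + 1 = -(k : ℤ) ∧ k ∈ J) ↔ (m = 0 ∧ k ∈ J) :=
      and_congr_left fun _ => by omega
    have f2 : (m - ((k + 1 : ℕ) : ℤ) - 1 = -((k + 1 : ℕ) : ℤ) ∧ k + 1 ∈ J) ↔
        (m = 1 ∧ k + 1 ∈ J) := and_congr_left fun _ => by omega
    have f3 : (m - ((k + 1 : ℕ) : ℤ) + 1 = -((k + 1 : ℕ) : ℤ) ∧ k + 1 ∈ J) ↔
        (m = -1 ∧ k + 1 ∈ J) := and_congr_left fun _ => by omega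
    have f4 : (m - ((k + 1 : ℕ) : ℤ) - 1 = -((k + 2 : ℕ) : ℤ) ∧ k + 2 ∈ J) ↔
        (m = 0 ∧ k + 2 ∈ J) := and_congr_left fun _ => by omega
    simp only [f1, f2, f3, f4] at h2
    by_cases g1 : k ∈ J <;> by_cases g2 : k + 1 ∈ J <;> by_cases g3 : k + 2 ∈ J <;>
      simp only [g1, g2, g3, and_true, and_false, if_true, if_false] at h2 ⊢ <;>
      split_ifs at h2 ⊢ <;> omega

end Segments

/-! ## Polynomial families of vectors -/

section PolynomialFamilies

variable {V : Type*} [AddCommGroup V] [Module ℂ V]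

/-- A functional that kills W but not u j would give a nonzero polynomial with infinitely many
roots. This takes the place of Zariski density and of the Lie algebra in what follows. -/
lemma mem_of_sum_pow_smul_mem {W : Submodule ℂ V} {M : ℕ} {u : ℕ → V} {T : Set ℂ}
    (hT : T.Infinite) (h : ∀ t ∈ T, ∑ j ∈ Finset.range M, t ^ j • u j ∈ W) {j : ℕ} (hj : j < M) :
    u j ∈ W := by
  by_contra hu
  obtain ⟨f, hf, hW⟩ := Submodule.exists_le_ker_of_notMem hu
  let P : Polynomial ℂ := ∑ j ∈ Finset.range M, Polynomial.monomial j (f (u j))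
  have hP : P = 0 := by
    refine Polynomial.eq_zero_of_infinite_isRoot P (hT.mono fun t ht => ?_)
    have := LinearMap.mem_ker.1 (hW (h t ht))
    simp only [map_sum, map_smul, smul_eq_mul] at this
    simp only [Set.mem_ofPred_eq, Polynomial.IsRoot, P, Polynomial.eval_finsetSum,
      Polynomial.eval_monomial]
    rw [← this]
    exact Finset.sum_congr rfl fun i _ => mul_comm _ _
  have hc : P.coeff j = f (u j) := by
    simp only [P, Polynomial.finsetSum_coeff, Polynomial.coeff_monomial]
    rw [Finset.sum_ite_eq' (Finset.range M) j, if_pos (Finset.mem_range.2 hj)]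
  rw [hP, Polynomial.coeff_zero] at hc
  exact hf hc.symm

lemma eq_zero_of_sum_pow_smul_eq_zero {M : ℕ} {u : ℕ → V} {T : Set ℂ}
    (hT : T.Infinite) (h : ∀ t ∈ T, ∑ j ∈ Finset.range M, t ^ j • u j = 0) {j : ℕ} (hj : j < M) :
    u j = 0 :=
  (Submodule.mem_bot ℂ).1 (mem_of_sum_pow_smul_mem hT (fun t ht => (Submodule.mem_bot ℂ).2 (h t ht))
    hj)

lemma infinite_ne_zero : {t : ℂ | t ≠ 0}.Infinite := (Set.finite_singleton (0 : ℂ)).infinite_compl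

/-- A vector-valued function whose coordinates are polynomial. -/
lemma exists_eq_sum_pow_smul [FiniteDimensional ℂ V] {T : Set ℂ} {F : ℂ → V}
    (h : ∀ ℓ : Module.Dual ℂ V, ∃ Q : Polynomial ℂ, ∀ t ∈ T, ℓ (F t) = Q.eval t) :
    ∃ (M : ℕ) (u : ℕ → V), 0 < M ∧ ∀ t ∈ T, F t = ∑ j ∈ Finset.range M, t ^ j • u j := by
  let b := Module.finBasis ℂ V
  choose Q hQ using fun i => h (b.coord i)
  refine ⟨Finset.univ.sup (fun i => (Q i).natDegree) + 1,
    fun j => ∑ i, (Q i).coeff j • b i, Nat.succ_pos _, fun t ht => ?_⟩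
  rw [← b.sum_repr (F t)]
  simp only [Finset.smul_sum]
  rw [Finset.sum_comm]
  refine Finset.sum_congr rfl fun i _ => ?_
  have h1 : b.repr (F t) i = (Q i).eval t := hQ i t ht
  rw [h1, Polynomial.eval_eq_sum_range' (Nat.lt_succ_of_le (Finset.le_sup
    (f := fun i => (Q i).natDegree) (Finset.mem_univ i))), Finset.sum_smul]
  exact Finset.sum_congr rfl fun j _ => by rw [smul_smul, mul_comm]

end PolynomialFamilies

/-! ## Binary forms -/

section Forms

/-- Binary forms of degree `n`. -/
abbrev Forms (n : ℕ) : Submodule ℂ (MvPolynomial (Fin 2) ℂ) :=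
  MvPolynomial.homogeneousSubmodule (Fin 2) ℂ n

/-- The upper triangular unipotent elements of `SL₂`. -/
def upperSL2 (b : ℂ) : SL2 := ⟨!![1, b; 0, 1], by simp [Matrix.det_fin_two]⟩

/-- The lower triangular unipotent elements of `SL₂`. -/
def lowerSL2 (c : ℂ) : SL2 := ⟨!![1, 0; c, 1], by simp [Matrix.det_fin_two]⟩

/-- The representative of the non-trivial Weyl group element of `SL₂`. -/
def weylSL2 : SL2 := ⟨!![0, 1; -1, 0], by simp [Matrix.det_fin_two]⟩

lemma unipSL2_eq : unipSL2 = upperSL2 1 := rfl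

lemma SL2.ext' {g h : SL2} (h00 : g 0 0 = h 0 0) (h01 : g 0 1 = h 0 1) (h10 : g 1 0 = h 1 0)
    (h11 : g 1 1 = h 1 1) : g = h := by
  ext i j
  fin_cases i <;> fin_cases j <;> assumption

lemma SL2.mul_apply (g h : SL2) (i j : Fin 2) : (g * h) i j = g i 0 * h 0 j + g i 1 * h 1 j := by
  rw [Matrix.SpecialLinearGroup.coe_mul, Matrix.mul_apply, Fin.sum_univ_two]

lemma SL2.det_eq (g : SL2) : g 0 0 * g 1 1 - g 0 1 * g 1 0 = 1 := by
  rw [← Matrix.det_fin_two, g.det_coe]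

@[simp] lemma upperSL2_00 (b : ℂ) : upperSL2 b 0 0 = 1 := rfl
@[simp] lemma upperSL2_01 (b : ℂ) : upperSL2 b 0 1 = b := rfl
@[simp] lemma upperSL2_10 (b : ℂ) : upperSL2 b 1 0 = 0 := rfl
@[simp] lemma upperSL2_11 (b : ℂ) : upperSL2 b 1 1 = 1 := rfl
@[simp] lemma lowerSL2_00 (b : ℂ) : lowerSL2 b 0 0 = 1 := rfl
@[simp] lemma lowerSL2_01 (b : ℂ) : lowerSL2 b 0 1 = 0 := rfl
@[simp] lemma lowerSL2_10 (b : ℂ) : lowerSL2 b 1 0 = b := rfl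
@[simp] lemma lowerSL2_11 (b : ℂ) : lowerSL2 b 1 1 = 1 := rfl
@[simp] lemma weylSL2_00 : weylSL2 0 0 = 0 := rfl
@[simp] lemma weylSL2_01 : weylSL2 0 1 = 1 := rfl
@[simp] lemma weylSL2_10 : weylSL2 1 0 = -1 := rfl
@[simp] lemma weylSL2_11 : weylSL2 1 1 = 0 := rfl
@[simp] lemma diagSL2_00 (t : ℂˣ) : diagSL2 t 0 0 = t := rfl
@[simp] lemma diagSL2_01 (t : ℂˣ) : diagSL2 t 0 1 = 0 := rfl
@[simp] lemma diagSL2_10 (t : ℂˣ) : diagSL2 t 1 0 = 0 := rfl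
@[simp] lemma diagSL2_11 (t : ℂˣ) : diagSL2 t 1 1 = ((t⁻¹ : ℂˣ) : ℂ) := rfl

lemma SL2.bigCell (g : SL2) (t : ℂˣ) (ht : (t : ℂ) = g 0 0) :
    g = lowerSL2 (g 1 0 / t) * diagSL2 t * upperSL2 (g 0 1 / t) := by
  have hd := SL2.det_eq g
  have h0 := t.ne_zero
  refine SL2.ext' ?_ ?_ ?_ ?_ <;> simp [SL2.mul_apply, ← ht] <;> field_simp
  rw [← ht] at hd
  linear_combination hd

variable {n : ℕ}

/-- A form is a function of row vectors, on which g acts by multiplication from the right. -/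
lemma eval_polyRep (g : SL2) (p : MvPolynomial (Fin 2) ℂ) (a b : ℂ) :
    MvPolynomial.eval ![a, b] (polyRep g p) =
      MvPolynomial.eval ![a * g 0 0 + b * g 1 0, a * g 0 1 + b * g 1 1] p := by
  have : polyRep g p = MvPolynomial.aeval (fun j : Fin 2 =>
    ∑ i : Fin 2, g i j • (MvPolynomial.X i : MvPolynomial (Fin 2) ℂ)) p := rfl
  rw [this]
  clear this
  induction p using MvPolynomial.induction_on with
  | C c => simp
  | add p q hp hq => rw [map_add, map_add, map_add, hp, hq]
  | mul_X p i hp =>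
    rw [map_mul, map_mul, map_mul, hp]
    congr 1
    fin_cases i <;> simp [Fin.sum_univ_two, MvPolynomial.smul_eval, mul_comm]

lemma eval_nuRep (k : ℕ) (g : SL2) (p : Forms (k - 1)) (a b : ℂ) :
    MvPolynomial.eval ![a, b] (nuRep k g p : MvPolynomial (Fin 2) ℂ) =
      MvPolynomial.eval ![a * g 0 0 + b * g 1 0, a * g 0 1 + b * g 1 1]
        (p : MvPolynomial (Fin 2) ℂ) :=
  eval_polyRep g p a b

variable (n) in
/-- The monomial `X₀ ^ (n - i) X₁ ^ i`. -/
def formMonomial (i : Fin (n + 1)) : Forms n :=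
  ⟨MvPolynomial.X 0 ^ (n - (i : ℕ)) * MvPolynomial.X 1 ^ (i : ℕ), by
    have h := ((MvPolynomial.isHomogeneous_X ℂ (0 : Fin 2)).pow (n - i)).mul
      ((MvPolynomial.isHomogeneous_X ℂ (1 : Fin 2)).pow i)
    have e : 1 * (n - (i : ℕ)) + 1 * (i : ℕ) = n := by omega
    rw [e] at h
    exact (MvPolynomial.mem_homogeneousSubmodule _ _).2 h⟩

@[simp] lemma eval_formMonomial (i : Fin (n + 1)) (a b : ℂ) :
    MvPolynomial.eval ![a, b] (formMonomial n i : MvPolynomial (Fin 2) ℂ) =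
      a ^ (n - (i : ℕ)) * b ^ (i : ℕ) := by
  simp [formMonomial]

lemma span_formMonomial : ⊤ ≤ Submodule.span ℂ (Set.range (formMonomial n)) := by
  rintro ⟨p, hp⟩ -
  rw [MvPolynomial.mem_homogeneousSubmodule] at hp
  have e : (⟨p, (MvPolynomial.mem_homogeneousSubmodule _ _).2 hp⟩ : Forms n) =
      ∑ i : Fin (n + 1), p.coeff (Finsupp.single 0 (n - (i : ℕ)) + Finsupp.single 1 (i : ℕ)) •
        formMonomial n i := by
    refine Subtype.ext ?_
    ext d
    simp only [AddSubmonoidClass.coe_finsetSum, Submodule.coe_smul, MvPolynomial.coeff_sum,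
      MvPolynomial.coeff_smul, smul_eq_mul]
    have hm : ∀ i : Fin (n + 1), (formMonomial n i : MvPolynomial (Fin 2) ℂ) =
        MvPolynomial.monomial (Finsupp.single 0 (n - (i : ℕ)) + Finsupp.single 1 (i : ℕ)) 1 := by
      intro i
      change MvPolynomial.X 0 ^ (n - (i : ℕ)) * MvPolynomial.X 1 ^ (i : ℕ) = _
      rw [MvPolynomial.X_pow_eq_monomial, MvPolynomial.X_pow_eq_monomial,
        MvPolynomial.monomial_mul, one_mul]
    simp only [hm, MvPolynomial.coeff_monomial]
    by_cases hd : d.degree = n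
    · have hd' : d 0 + d 1 = n := by
        rw [← hd, Finsupp.degree_eq_sum, Fin.sum_univ_two]
      have hdi : Finsupp.single 0 (n - d 1) + Finsupp.single 1 (d 1) = d := by
        ext j
        fin_cases j
        · simp; omega
        · simp
      rw [Finset.sum_eq_single (⟨d 1, by omega⟩ : Fin (n + 1))]
      · simp only [hdi, if_true, mul_one]
      · intro i _ hi
        rw [if_neg, mul_zero]
        intro h
        apply hi
        have := DFunLike.congr_fun h 1
        simp at this
        exact Fin.ext this
      · simp
    · rw [hp.coeff_eq_zero hd]
      symm
      refine Finset.sum_eq_zero fun i _ => ?_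
      rw [if_neg, mul_zero]
      rintro rfl
      apply hd
      rw [Finsupp.degree_eq_sum, Fin.sum_univ_two]
      simp
      omega
  rw [e]
  exact Submodule.sum_mem _ fun i _ => Submodule.smul_mem _ _
    (Submodule.subset_span ⟨i, rfl⟩)

lemma eval_sum_formMonomial (c : Fin (n + 1) → ℂ) (a b : ℂ) :
    MvPolynomial.eval ![a, b] ((∑ i, c i • formMonomial n i : Forms n) :
      MvPolynomial (Fin 2) ℂ) = ∑ i, c i * (a ^ (n - (i : ℕ)) * b ^ (i : ℕ)) := by
  simp [MvPolynomial.smul_eval]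

lemma coeff_eq_zero_of_eval_eq_zero {c : Fin (n + 1) → ℂ} {T : Set ℂ} (hT : T.Infinite)
    (h : ∀ y ∈ T, MvPolynomial.eval ![1, y] ((∑ i, c i • formMonomial n i : Forms n) :
      MvPolynomial (Fin 2) ℂ) = 0) (i : Fin (n + 1)) : c i = 0 := by
  have := eq_zero_of_sum_pow_smul_eq_zero (M := n + 1)
    (u := fun j => if hj : j < n + 1 then c ⟨j, hj⟩ else 0) hT (fun y hy => by
      have := h y hy
      rw [eval_sum_formMonomial] at this
      rw [← this, Finset.sum_range]
      exact Finset.sum_congr rfl fun i _ => by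
        rw [dif_pos i.2, one_pow, one_mul, smul_eq_mul, mul_comm]) i.2
  rwa [dif_pos i.2] at this

lemma linearIndependent_formMonomial : LinearIndependent ℂ (formMonomial n) := by
  rw [Fintype.linearIndependent_iff]
  intro c hc
  exact coeff_eq_zero_of_eval_eq_zero Set.infinite_univ fun y _ => by rw [hc]; simp

variable (n) in
/-- The basis of monomials of the space of binary forms. -/
def formBasis : Module.Basis (Fin (n + 1)) ℂ (Forms n) :=
  Module.Basis.mk linearIndependent_formMonomial span_formMonomial

@[simp] lemma formBasis_apply (i : Fin (n + 1)) : formBasis n i = formMonomial n i :=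
  Module.Basis.mk_apply _ _ _

instance : FiniteDimensional ℂ (Forms n) := (formBasis n).finiteDimensional_of_finite

lemma finrank_forms : Module.finrank ℂ (Forms n) = n + 1 := by
  rw [Module.finrank_eq_card_basis (formBasis n), Fintype.card_fin]

lemma Forms.ext_of_infinite {p q : Forms n} {T : Set ℂ} (hT : T.Infinite)
    (h : ∀ y ∈ T, MvPolynomial.eval ![1, y] (p : MvPolynomial (Fin 2) ℂ) =
      MvPolynomial.eval ![1, y] (q : MvPolynomial (Fin 2) ℂ)) : p = q := by
  rw [← sub_eq_zero]
  have e := (formBasis n).sum_repr (p - q)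
  simp only [formBasis_apply] at e
  have hc := coeff_eq_zero_of_eval_eq_zero (c := fun i => (formBasis n).repr (p - q) i) hT
    (fun y hy => by
      rw [e, Submodule.coe_sub, map_sub, h y hy, sub_self])
  rw [← e]
  exact Finset.sum_eq_zero fun i _ => by rw [hc i, zero_smul]

lemma Forms.ext {p q : Forms n} (h : ∀ y, MvPolynomial.eval ![1, y] (p : MvPolynomial (Fin 2) ℂ) =
      MvPolynomial.eval ![1, y] (q : MvPolynomial (Fin 2) ℂ)) : p = q :=
  Forms.ext_of_infinite Set.infinite_univ fun y _ => h y

lemma nuRep_diag_formMonomial (t : ℂˣ) (i : Fin (n + 1)) :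
    nuRep (n + 1) (diagSL2 t) (formMonomial n i) = ((t : ℂ) ^ ((n : ℤ) - 2 * i)) •
      formMonomial n i := by
  refine Forms.ext fun y => ?_
  have ht := t.ne_zero
  have hi : (i : ℕ) ≤ n := by omega
  rw [eval_nuRep, Submodule.coe_smul, MvPolynomial.smul_eval]
  erw [eval_formMonomial]
  rw [eval_formMonomial]
  have : ((n : ℤ) - 2 * i) = ((n - i : ℕ) : ℤ) - (i : ℕ) := by omega
  rw [this, zpow_sub₀ ht, zpow_natCast, zpow_natCast]
  simp only [diagSL2_00, diagSL2_01, diagSL2_10, diagSL2_11, mul_zero, add_zero, one_mul, zero_add,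
    one_pow, mul_pow, Units.val_inv_eq_inv_val, inv_pow]
  field_simp

lemma nuRep_lower_formMonomial_zero (c : ℂ) :
    nuRep (n + 1) (lowerSL2 c) (formMonomial n 0) =
      ∑ i : Fin (n + 1), (c ^ (i : ℕ) * (n.choose i : ℂ)) • formMonomial n i := by
  refine Forms.ext fun y => ?_
  rw [eval_nuRep]
  erw [eval_formMonomial, eval_sum_formMonomial]
  simp only [Fin.val_zero, pow_zero, mul_one, Nat.sub_zero, lowerSL2_00, lowerSL2_10, one_pow]
  rw [add_comm, add_pow, Finset.sum_range]
  refine Finset.sum_congr rfl fun i _ => ?_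
  rw [one_pow, mul_pow]
  ring

lemma nuRep_upper_formMonomial (i : Fin (n + 1)) :
    nuRep (n + 1) (upperSL2 1) (formMonomial n i) =
      ∑ j : Fin (n + 1), ((i : ℕ).choose j : ℂ) • formMonomial n j := by
  refine Forms.ext fun y => ?_
  rw [eval_nuRep]
  erw [eval_formMonomial, eval_sum_formMonomial]
  simp only [upperSL2_00, upperSL2_10, upperSL2_01, upperSL2_11, one_mul, mul_one, mul_zero,
    add_zero, one_pow]
  have h1 : ∑ j : Fin (n + 1), ((i : ℕ).choose j : ℂ) * y ^ (j : ℕ) =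
      ∑ j ∈ Finset.range (n + 1), ((i : ℕ).choose j : ℂ) * y ^ j := by
    rw [Finset.sum_range]
  rw [h1, add_comm, add_pow]
  refine (Finset.sum_subset (Finset.range_mono (Nat.succ_le_succ (Nat.lt_succ_iff.1 i.2)))
    fun j _ hj => ?_).trans (Finset.sum_congr rfl fun j _ => by ring)
  rw [Finset.mem_range, not_lt] at hj
  rw [Nat.choose_eq_zero_of_lt (by omega)]
  simp

/-- The monomial `X₀ ^ n` generates the space of binary forms. -/
lemma eq_top_of_formMonomial_zero_mem {W : Submodule ℂ (Forms n)}
    (hW : ∀ (c : ℂ), nuRep (n + 1) (lowerSL2 c) (formMonomial n 0) ∈ W) : W = ⊤ := by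
  rw [eq_top_iff]
  refine span_formMonomial.trans (Submodule.span_le.2 ?_)
  rintro _ ⟨i, rfl⟩
  -- W contains (X₀ + c X₁)^n for all c, hence the coefficients of the powers of c, which are
  -- nonzero multiples of the monomials.
  have := mem_of_sum_pow_smul_mem (M := n + 1) (W := W) (T := Set.univ)
    (u := fun j => if hj : j < n + 1 then (n.choose j : ℂ) • formMonomial n ⟨j, hj⟩ else 0)
    Set.infinite_univ (fun c _ => by
      have h := hW c
      rw [nuRep_lower_formMonomial_zero] at h
      have h' : (∑ i : Fin (n + 1), (c ^ (i : ℕ) * (n.choose i : ℂ)) • formMonomial n i) ∈ W := h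
      rw [Finset.sum_range]
      convert h' using 1
      exact Finset.sum_congr rfl fun j _ => by rw [dif_pos j.2, smul_smul]) i.2
  rw [dif_pos i.2] at this
  refine (Submodule.smul_mem_iff _ ?_).1 this
  exact_mod_cast (Nat.choose_pos (Nat.lt_succ_iff.1 i.2)).ne'

end Forms

/-! ## Algebraic representations of `SL₂` -/

section AlgebraicRep

variable {V : Type*} [AddCommGroup V] [Module ℂ V]

/-- A representation of `SL₂` whose matrix coefficients are polynomial. -/
def IsAlgebraicRep (ρ : Representation ℂ SL2 V) : Prop :=
  ∀ (ℓ : Module.Dual ℂ V) (v : V), ∃ P : MvPolynomial (Fin 2 × Fin 2) ℂ,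
    ∀ g : SL2, ℓ (ρ g v) = MvPolynomial.eval (fun p => g p.1 p.2) P

/-- The weight spaces of the diagonal torus. -/
def weightSpace (ρ : Representation ℂ SL2 V) (m : ℤ) : Submodule ℂ V where
  carrier := {v | ∀ t : ℂˣ, ρ (diagSL2 t) v = (t : ℂ) ^ m • v}
  add_mem' := fun ha hb t => by rw [map_add, ha t, hb t, smul_add]
  zero_mem' := fun t => by simp
  smul_mem' := fun c a ha t => by rw [map_smul, ha t, smul_comm]

lemma eval_aeval_mvPolynomial {σ : Type*} (P : MvPolynomial σ ℂ) (f : σ → Polynomial ℂ) (c : ℂ) :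
    (MvPolynomial.aeval f P).eval c = MvPolynomial.eval (fun i => (f i).eval c) P := by
  induction P using MvPolynomial.induction_on with
  | C a => simp
  | add p q hp hq => simp [hp, hq]
  | mul_X p i hp => simp [hp]

/-- Negative powers of t come only from the entry t⁻¹, so a large power of t clears them; the
clearing exponent can be enlarged, as is needed for a common choice. -/
lemma exists_pow_mul_eval_diag (P : MvPolynomial (Fin 2 × Fin 2) ℂ) :
    ∃ B₀ : ℕ, ∀ B ≥ B₀, ∃ Q : Polynomial ℂ, ∀ t : ℂˣ,
      (t : ℂ) ^ B * MvPolynomial.eval (fun p => diagSL2 t p.1 p.2) P = Q.eval (t : ℂ) := by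
  induction P using MvPolynomial.induction_on with
  | C a => exact ⟨0, fun B _ => ⟨Polynomial.X ^ B * Polynomial.C a, fun t => by simp; ring⟩⟩
  | add p q hp hq =>
    obtain ⟨B₁, h₁⟩ := hp
    obtain ⟨B₂, h₂⟩ := hq
    refine ⟨max B₁ B₂, fun B hB => ?_⟩
    obtain ⟨Q₁, hQ₁⟩ := h₁ B (le_of_max_le_left hB)
    obtain ⟨Q₂, hQ₂⟩ := h₂ B (le_of_max_le_right hB)
    exact ⟨Q₁ + Q₂, fun t => by simp [mul_add, hQ₁, hQ₂]⟩
  | mul_X p i hp =>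
    obtain ⟨B₁, h₁⟩ := hp
    refine ⟨B₁ + 1, fun B hB => ?_⟩
    obtain ⟨C, rfl⟩ : ∃ C, B = C + 1 := ⟨B - 1, by omega⟩
    obtain ⟨Q, hQ⟩ := h₁ C (by omega)
    obtain ⟨R, hR⟩ : ∃ R : Polynomial ℂ, ∀ t : ℂˣ, (t : ℂ) * diagSL2 t i.1 i.2 = R.eval (t : ℂ) := by
      obtain ⟨a, b⟩ := i
      fin_cases a <;> fin_cases b
      · exact ⟨Polynomial.X ^ 2, fun t => by simp [sq]⟩
      · exact ⟨0, fun t => by simp⟩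
      · exact ⟨0, fun t => by simp⟩
      · exact ⟨1, fun t => by simp⟩
    refine ⟨Q * R, fun t => ?_⟩
    rw [Polynomial.eval_mul, ← hQ, ← hR, map_mul, MvPolynomial.eval_X]
    ring

variable {ρ : Representation ℂ SL2 V}

/-- The coefficient u j plays the role of a divided power of the lowering operator applied to w. -/
lemma IsAlgebraicRep.exists_lower [FiniteDimensional ℂ V] (hρ : IsAlgebraicRep ρ) (w : V) :
    ∃ (M : ℕ) (u : ℕ → V), 0 < M ∧ u 0 = w ∧
      ∀ c, ρ (lowerSL2 c) w = ∑ j ∈ Finset.range M, c ^ j • u j := by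
  obtain ⟨M, u, hM, hu⟩ := exists_eq_sum_pow_smul (T := Set.univ)
    (F := fun c => ρ (lowerSL2 c) w) (fun ℓ => by
      obtain ⟨P, hP⟩ := hρ ℓ w
      refine ⟨MvPolynomial.aeval (fun p : Fin 2 × Fin 2 =>
        !![1, 0; Polynomial.X, 1] p.1 p.2) P, fun c _ => ?_⟩
      rw [hP, eval_aeval_mvPolynomial]
      congr 2
      funext ⟨a, b⟩
      fin_cases a <;> fin_cases b <;> simp)
  refine ⟨M, u, hM, ?_, fun c => hu c (Set.mem_univ c)⟩
  have h0 := hu 0 (Set.mem_univ _)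
  have e : lowerSL2 0 = 1 := by refine SL2.ext' ?_ ?_ ?_ ?_ <;> simp
  rw [e, map_one, Module.End.one_apply, Finset.sum_eq_single_of_mem 0 (Finset.mem_range.2 hM)] at h0
  · rw [h0]; simp
  · intro j _ hj
    rw [zero_pow hj, zero_smul]

lemma IsAlgebraicRep.exists_upper [FiniteDimensional ℂ V] (hρ : IsAlgebraicRep ρ) (w : V) :
    ∃ (M : ℕ) (u : ℕ → V), 0 < M ∧ u 0 = w ∧
      ∀ c, ρ (upperSL2 c) w = ∑ j ∈ Finset.range M, c ^ j • u j := by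
  obtain ⟨M, u, hM, hu⟩ := exists_eq_sum_pow_smul (T := Set.univ)
    (F := fun c => ρ (upperSL2 c) w) (fun ℓ => by
      obtain ⟨P, hP⟩ := hρ ℓ w
      refine ⟨MvPolynomial.aeval (fun p : Fin 2 × Fin 2 =>
        !![1, Polynomial.X; 0, 1] p.1 p.2) P, fun c _ => ?_⟩
      rw [hP, eval_aeval_mvPolynomial]
      congr 2
      funext ⟨a, b⟩
      fin_cases a <;> fin_cases b <;> simp)
  refine ⟨M, u, hM, ?_, fun c => hu c (Set.mem_univ c)⟩
  have h0 := hu 0 (Set.mem_univ _)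
  have e : upperSL2 0 = 1 := by refine SL2.ext' ?_ ?_ ?_ ?_ <;> simp
  rw [e, map_one, Module.End.one_apply, Finset.sum_eq_single_of_mem 0 (Finset.mem_range.2 hM)] at h0
  · rw [h0]; simp
  · intro j _ hj
    rw [zero_pow hj, zero_smul]

/-- Conjugation by diag(t, t⁻¹) replaces c by c t⁻²; the coefficients of c^j are compared. -/
lemma lower_component_mem_weightSpace {m : ℤ} {w : V} (hw : w ∈ weightSpace ρ m) {M : ℕ}
    {u : ℕ → V} (hu : ∀ c, ρ (lowerSL2 c) w = ∑ j ∈ Finset.range M, c ^ j • u j) {j : ℕ}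
    (hj : j < M) : u j ∈ weightSpace ρ (m - 2 * j) := by
  intro t
  have ht := t.ne_zero
  rw [← sub_eq_zero]
  refine eq_zero_of_sum_pow_smul_eq_zero (T := Set.univ) (M := M)
    (u := fun j => ρ (diagSL2 t) (u j) - (t : ℂ) ^ (m - 2 * (j : ℤ)) • u j)
    Set.infinite_univ (fun c _ => ?_) hj
  have e : diagSL2 t * lowerSL2 c = lowerSL2 (c * ((t : ℂ) ^ 2)⁻¹) * diagSL2 t := by
    refine SL2.ext' ?_ ?_ ?_ ?_ <;> simp [SL2.mul_apply]
    field_simp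
  have h1 := congrArg (fun g => ρ g w) e
  simp only [map_mul, Module.End.mul_apply, hw t, map_smul, hu, map_sum, Finset.smul_sum,
    smul_smul] at h1
  simp only [smul_sub, Finset.sum_sub_distrib, sub_eq_zero, h1, smul_smul]
  refine Finset.sum_congr rfl fun j _ => ?_
  congr 1
  rw [zpow_sub₀ ht, mul_pow, zpow_mul, inv_pow, ← pow_mul]
  norm_cast
  rw [← pow_mul]
  push_cast
  rw [div_eq_mul_inv]
  ring

lemma upper_component_mem_weightSpace {m : ℤ} {w : V} (hw : w ∈ weightSpace ρ m) {M : ℕ}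
    {u : ℕ → V} (hu : ∀ c, ρ (upperSL2 c) w = ∑ j ∈ Finset.range M, c ^ j • u j) {j : ℕ}
    (hj : j < M) : u j ∈ weightSpace ρ (m + 2 * j) := by
  intro t
  have ht := t.ne_zero
  rw [← sub_eq_zero]
  refine eq_zero_of_sum_pow_smul_eq_zero (T := Set.univ) (M := M)
    (u := fun j => ρ (diagSL2 t) (u j) - (t : ℂ) ^ (m + 2 * (j : ℤ)) • u j)
    Set.infinite_univ (fun c _ => ?_) hj
  have e : diagSL2 t * upperSL2 c = upperSL2 (c * (t : ℂ) ^ 2) * diagSL2 t := by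
    refine SL2.ext' ?_ ?_ ?_ ?_ <;> simp [SL2.mul_apply]
    field_simp
  have h1 := congrArg (fun g => ρ g w) e
  simp only [map_mul, Module.End.mul_apply, hw t, map_smul, hu, map_sum, Finset.smul_sum,
    smul_smul] at h1
  simp only [smul_sub, Finset.sum_sub_distrib, sub_eq_zero, h1, smul_smul]
  refine Finset.sum_congr rfl fun j _ => ?_
  congr 1
  rw [zpow_add₀ ht, mul_pow, zpow_mul, ← pow_mul]
  norm_cast
  rw [← pow_mul]
  push_cast
  ring

lemma weyl_mem_weightSpace {m : ℤ} {w : V} (hw : w ∈ weightSpace ρ m) :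
    ρ weylSL2 w ∈ weightSpace ρ (-m) := by
  intro t
  have e : diagSL2 t * weylSL2 = weylSL2 * diagSL2 t⁻¹ := by
    refine SL2.ext' ?_ ?_ ?_ ?_ <;> simp [SL2.mul_apply, -map_inv]
  have h1 := congrArg (fun g => ρ g w) e
  simp only [map_mul, Module.End.mul_apply, hw t⁻¹, map_smul] at h1
  rw [h1, Units.val_inv_eq_inv_val, inv_zpow, zpow_neg]

lemma infinite_units : (Set.range ((↑) : ℂˣ → ℂ)).Infinite := by
  refine infinite_ne_zero.mono fun t ht => ⟨Units.mk0 t ht, rfl⟩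

/-- After multiplication by t^B the torus orbit of v is polynomial in t. Multiplicativity makes its
coefficients weight vectors, and at t = 1 they add up to v. -/
lemma IsAlgebraicRep.iSup_weightSpace [FiniteDimensional ℂ V] (hρ : IsAlgebraicRep ρ) :
    ⨆ m, weightSpace ρ m = ⊤ := by
  rw [eq_top_iff]
  intro v _
  let b := Module.finBasis ℂ V
  choose P hP using fun i => hρ (b.coord i) v
  choose B₀ hB₀ using fun i => exists_pow_mul_eval_diag (P i)
  let B := Finset.univ.sup B₀
  choose Q hQ using fun i => hB₀ i B (Finset.le_sup (Finset.mem_univ i))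
  let F : ℂ → V := fun t => if ht : t = 0 then 0 else t ^ B • ρ (diagSL2 (Units.mk0 t ht)) v
  have hF : ∀ t : ℂˣ, F t = (t : ℂ) ^ B • ρ (diagSL2 t) v := by
    intro t
    simp [F]
  obtain ⟨M, u, -, hu⟩ := exists_eq_sum_pow_smul (F := F) (T := Set.range ((↑) : ℂˣ → ℂ)) (by
    intro ℓ
    refine ⟨∑ i, Polynomial.C (ℓ (b i)) * Q i, ?_⟩
    rintro _ ⟨t, rfl⟩
    rw [hF, ← b.sum_repr (ρ (diagSL2 t) v)]
    simp only [map_smul, map_sum, smul_eq_mul, Finset.mul_sum, Polynomial.eval_finsetSum,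
      Polynomial.eval_mul, Polynomial.eval_C]
    refine Finset.sum_congr rfl fun i _ => ?_
    have : b.repr (ρ (diagSL2 t) v) i = MvPolynomial.eval (fun p => diagSL2 t p.1 p.2) (P i) :=
      hP i _
    rw [← hQ, this]
    ring)
  have hu' : ∀ t : ℂˣ, (t : ℂ) ^ B • ρ (diagSL2 t) v = ∑ j ∈ Finset.range M, (t : ℂ) ^ j • u j :=
    fun t => by rw [← hF]; exact hu t ⟨t, rfl⟩
  have hmem : ∀ j < M, u j ∈ weightSpace ρ (j - B) := by
    intro j hj s
    have hs := s.ne_zero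
    rw [← sub_eq_zero]
    refine eq_zero_of_sum_pow_smul_eq_zero (M := M)
      (u := fun j => ρ (diagSL2 s) (u j) - (s : ℂ) ^ ((j : ℤ) - B) • u j) infinite_units ?_ hj
    rintro _ ⟨t, rfl⟩
    have h1 := congrArg (ρ (diagSL2 s)) (hu' t)
    rw [map_smul, ← Module.End.mul_apply, ← map_mul, ← map_mul, map_sum] at h1
    have h2 := hu' (s * t)
    simp only [smul_sub, Finset.sum_sub_distrib, sub_eq_zero]
    simp only [map_smul] at h1
    rw [← h1]
    have h3 : ρ (diagSL2 (s * t)) v =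
        (((s * t : ℂˣ) : ℂ) ^ B)⁻¹ • ∑ j ∈ Finset.range M, ((s * t : ℂˣ) : ℂ) ^ j • u j := by
      rw [← h2, smul_smul, inv_mul_cancel₀ (pow_ne_zero _ (s * t).ne_zero), one_smul]
    rw [h3, Finset.smul_sum, Finset.smul_sum]
    refine Finset.sum_congr rfl fun j _ => ?_
    simp only [smul_smul]
    congr 1
    rw [zpow_sub₀ hs, zpow_natCast, zpow_natCast, Units.val_mul, mul_pow, mul_pow]
    have ht := t.ne_zero
    field_simp
  have h1 := hu' 1
  simp only [Units.val_one, one_pow, one_smul, map_one, Module.End.one_apply] at h1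
  rw [h1]
  exact Submodule.sum_mem _ fun j hj =>
    Submodule.mem_iSup_of_mem ((j : ℤ) - B) (hmem j (Finset.mem_range.1 hj))

lemma weightSpace_le_eigenspace (m : ℤ) :
    weightSpace ρ m ≤ Module.End.eigenspace (ρ (diagSL2 (Units.mk0 2 two_ne_zero)))
      ((2 : ℂ) ^ m) := by
  intro v hv
  rw [Module.End.mem_eigenspace_iff]
  exact hv _

lemma two_zpow_injective : Function.Injective fun m : ℤ => (2 : ℂ) ^ m := by
  intro m n h
  have h1 : (2 : ℝ) ^ m = 2 ^ n := by
    apply Complex.ofReal_injective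
    push_cast
    exact h
  exact zpow_right_injective₀ (by norm_num) (by norm_num) h1

/-- Distinct weights m give distinct eigenvalues 2^m of the single element diag(2, 1/2). -/
lemma iSupIndep_weightSpace : iSupIndep (weightSpace ρ) :=
  ((Module.End.eigenspaces_iSupIndep _).comp two_zpow_injective).mono weightSpace_le_eigenspace

lemma IsAlgebraicRep.exists_maximal_weight [FiniteDimensional ℂ V] [Nontrivial V] (hρ : IsAlgebraicRep ρ) :
    ∃ n : ℕ, weightSpace ρ n ≠ ⊥ ∧ ∀ m, weightSpace ρ m ≠ ⊥ → -(n : ℤ) ≤ m ∧ m ≤ n := by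
  set S : Set ℤ := {m | weightSpace ρ m ≠ ⊥} with hS
  have hfin : S.Finite := by
    refine Set.Finite.of_finite_image
      (f := fun m : ℤ => (2 : ℂ) ^ m) (Set.Finite.subset (Module.End.finite_hasEigenvalue
        (ρ (diagSL2 (Units.mk0 2 two_ne_zero)))) ?_) two_zpow_injective.injOn
    rintro _ ⟨m, hm, rfl⟩
    exact fun h => hm (le_bot_iff.1 (h ▸ weightSpace_le_eigenspace m))
  have hne : S.Nonempty := by
    by_contra h
    have : ∀ m, weightSpace ρ m = ⊥ := fun m => by
      by_contra hm
      exact h ⟨m, hm⟩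
    have h1 := hρ.iSup_weightSpace
    simp only [this, iSup_bot] at h1
    exact bot_ne_top h1
  have hneg : ∀ m ∈ S, -m ∈ S := by
    intro m hm h
    apply hm
    rw [eq_bot_iff]
    intro v hv
    have h1 := weyl_mem_weightSpace hv
    rw [h, Submodule.mem_bot] at h1
    have h2 := congrArg (ρ weylSL2⁻¹) h1
    rw [map_zero, ← Module.End.mul_apply, ← map_mul, inv_mul_cancel, map_one] at h2
    exact h2
  obtain ⟨n, hn, hmax⟩ := hfin.exists_maximalFor id S hne
  have hle : ∀ m ∈ S, m ≤ n := fun m hm => by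
    rcases le_total m n with h | h
    · exact h
    · exact hmax hm h
  have h0 := hle _ (hneg n hn)
  obtain ⟨k, rfl⟩ := Int.eq_ofNat_of_zero_le (show 0 ≤ n by omega)
  refine ⟨k, hn, fun m hm => ⟨?_, hle m hm⟩⟩
  have := hle _ (hneg m hm)
  omega

/-- A vector and a functional of maximal weight that pair to one. -/
lemma exists_dual_of_weight {n : ℤ} (hn : weightSpace ρ n ≠ ⊥) :
    ∃ v ∈ weightSpace ρ n, ∃ ℓ : Module.Dual ℂ V, ℓ v = 1 ∧
      ∀ m ≠ n, ∀ w ∈ weightSpace ρ m, ℓ w = 0 := by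
  obtain ⟨v, hv, hv0⟩ := Submodule.exists_mem_ne_zero_of_ne_bot hn
  have hd := (iSupIndep_weightSpace (ρ := ρ)) n
  have hv' : v ∉ ⨆ (m) (_ : m ≠ n), weightSpace ρ m :=
    fun h => hv0 (Submodule.disjoint_def.1 hd v hv h)
  obtain ⟨f, hf, hW⟩ := Submodule.exists_le_ker_of_notMem hv'
  refine ⟨v, hv, (f v)⁻¹ • f, by simp [hf], fun m hm w hw => ?_⟩
  have : f w = 0 := LinearMap.mem_ker.1 (hW (Submodule.mem_iSup_of_mem m
    (Submodule.mem_iSup_of_mem hm hw)))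
  simp [this]

end AlgebraicRep

/-! ## Complete reducibility -/

section CompleteReducibility

universe u
variable {V : Type u} [AddCommGroup V] [Module ℂ V] [FiniteDimensional ℂ V]
  {ρ : Representation ℂ SL2 V}

lemma upperSL2_fix {n : ℕ} (hρ : IsAlgebraicRep ρ)
    (hn : ∀ m, weightSpace ρ m ≠ ⊥ → -(n : ℤ) ≤ m ∧ m ≤ n) {v : V} (hv : v ∈ weightSpace ρ n)
    (b : ℂ) : ρ (upperSL2 b) v = v := by
  obtain ⟨M, u, hM, hu0, hu⟩ := hρ.exists_upper v
  rw [hu, Finset.sum_eq_single_of_mem 0 (Finset.mem_range.2 hM), hu0, pow_zero, one_smul]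
  intro j hj hj0
  have h1 := upper_component_mem_weightSpace hv hu (Finset.mem_range.1 hj)
  have h2 : weightSpace ρ (n + 2 * j) = ⊥ := by
    by_contra h
    have := (hn _ h).2
    omega
  rw [h2, Submodule.mem_bot] at h1
  rw [h1, smul_zero]

/-- A lower unipotent element adds only components of smaller weight, while ℓ sees only the maximal
weight n. -/
lemma dual_lower {n : ℕ} (hρ : IsAlgebraicRep ρ)
    (hn : ∀ m, weightSpace ρ m ≠ ⊥ → -(n : ℤ) ≤ m ∧ m ≤ n) {ℓ : Module.Dual ℂ V}
    (hℓ : ∀ m ≠ (n : ℤ), ∀ w ∈ weightSpace ρ m, ℓ w = 0) (c : ℂ) (w : V) :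
    ℓ (ρ (lowerSL2 c) w) = ℓ w := by
  have hw : w ∈ ⨆ m, weightSpace ρ m := hρ.iSup_weightSpace ▸ Submodule.mem_top
  induction hw using Submodule.iSup_induction' with
  | mem m w hw =>
    obtain ⟨M, u, hM, hu0, hu⟩ := hρ.exists_lower w
    rw [hu, map_sum, Finset.sum_eq_single_of_mem 0 (Finset.mem_range.2 hM), hu0, pow_zero, one_smul]
    intro j hj hj0
    have h1 := lower_component_mem_weightSpace hw hu (Finset.mem_range.1 hj)
    -- With j > 0 this would make m exceed the maximal weight, so that w = 0.
    by_cases h2 : m - 2 * j = n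
    · have h3 : weightSpace ρ m = ⊥ := by
        by_contra h
        have := (hn _ h).2
        omega
      rw [h3, Submodule.mem_bot] at hw
      have h4 : ∀ j < M, u j = 0 := fun j hj =>
        eq_zero_of_sum_pow_smul_eq_zero (M := M) (u := u) (T := Set.univ) Set.infinite_univ
          (fun c _ => by rw [← hu, hw, map_zero]) hj
      rw [h4 j (Finset.mem_range.1 hj), smul_zero, map_zero]
    · rw [map_smul, hℓ _ h2 _ h1, smul_zero]
  | zero => simp
  | add x y _ _ hx hy => rw [map_add, map_add, map_add, hx, hy]

lemma dual_diag {n : ℕ} (hρ : IsAlgebraicRep ρ) {ℓ : Module.Dual ℂ V}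
    (hℓ : ∀ m ≠ (n : ℤ), ∀ w ∈ weightSpace ρ m, ℓ w = 0) (t : ℂˣ) (w : V) :
    ℓ (ρ (diagSL2 t) w) = (t : ℂ) ^ n * ℓ w := by
  have hw : w ∈ ⨆ m, weightSpace ρ m := hρ.iSup_weightSpace ▸ Submodule.mem_top
  induction hw using Submodule.iSup_induction' with
  | mem m w hw =>
    rw [hw t, map_smul, smul_eq_mul]
    by_cases h : m = n
    · rw [h, zpow_natCast]
    · rw [hℓ m h w hw, mul_zero, mul_zero]
  | zero => simp
  | add x y _ _ hx hy => rw [map_add, map_add, map_add, hx, hy, mul_add]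

/-- The function g ↦ ℓ (ρ g w) is invariant under lower unipotent elements on the left and scales by
t^n under the torus. On the big cell it depends only on the first row of g, homogeneously of degree
n, as in the Borel-Weil construction. A vector of weight m contributes the single monomial of index
j with m + 2j = n. -/
lemma exists_form_of_dual {n : ℕ} (hρ : IsAlgebraicRep ρ)
    (hn : ∀ m, weightSpace ρ m ≠ ⊥ → -(n : ℤ) ≤ m ∧ m ≤ n) {ℓ : Module.Dual ℂ V}
    (hℓ : ∀ m ≠ (n : ℤ), ∀ w ∈ weightSpace ρ m, ℓ w = 0) (w : V) :
    ∃ p : Forms n, ∀ g : SL2, g 0 0 ≠ 0 →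
      ℓ (ρ g w) = MvPolynomial.eval ![g 0 0, g 0 1] (p : MvPolynomial (Fin 2) ℂ) := by
  have hcell : ∀ (g : SL2), g 0 0 ≠ 0 → ∀ w,
      ℓ (ρ g w) = g 0 0 ^ n * ℓ (ρ (upperSL2 (g 0 1 / g 0 0)) w) := by
    intro g hg w
    rw [SL2.bigCell g (Units.mk0 _ hg) rfl, map_mul, map_mul, Module.End.mul_apply,
      Module.End.mul_apply, dual_lower hρ hn hℓ, dual_diag hρ hℓ, ← SL2.bigCell g _ rfl]
    rfl
  have hw : w ∈ ⨆ m, weightSpace ρ m := hρ.iSup_weightSpace ▸ Submodule.mem_top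
  induction hw using Submodule.iSup_induction' with
  | mem m w hw =>
    obtain ⟨M, u, hM, hu0, hu⟩ := hρ.exists_upper w
    by_cases hm : ∃ j < M, m + 2 * (j : ℤ) = n
    · obtain ⟨j, hj, hmj⟩ := hm
      by_cases hbot : weightSpace ρ m = ⊥
      · rw [hbot, Submodule.mem_bot] at hw
        exact ⟨0, fun g _ => by simp [hw]⟩
      -- The bound m ≥ -n on the weights prevents negative powers of `g 0 0`.
      have hjn : j < n + 1 := by
        have := (hn m hbot).1
        omega
      refine ⟨ℓ (u j) • formMonomial n ⟨j, hjn⟩, fun g hg => ?_⟩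
      rw [hcell g hg, hu, map_sum, Finset.sum_eq_single_of_mem j (Finset.mem_range.2 hj),
        Submodule.coe_smul, MvPolynomial.smul_eval, eval_formMonomial, map_smul, smul_eq_mul]
      · rw [div_pow, pow_sub₀ _ hg (Nat.lt_succ_iff.1 hjn)]
        field_simp
      · intro i hi hij
        rw [map_smul, hℓ _ _ _ (upper_component_mem_weightSpace hw hu (Finset.mem_range.1 hi)),
          smul_zero]
        omega
    · refine ⟨0, fun g hg => ?_⟩
      rw [hcell g hg, hu, map_sum, Finset.sum_eq_zero]
      · simp
      · intro i hi
        rw [map_smul, hℓ _ _ _ (upper_component_mem_weightSpace hw hu (Finset.mem_range.1 hi)),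
          smul_zero]
        exact fun h => hm ⟨i, Finset.mem_range.1 hi, h⟩
  | zero => exact ⟨0, fun g _ => by simp⟩
  | add x y _ _ hx hy =>
    obtain ⟨p, hp⟩ := hx
    obtain ⟨q, hq⟩ := hy
    exact ⟨p + q, fun g hg => by simp [hp g hg, hq g hg]⟩

lemma infinite_affine_ne_zero {a c : ℂ} (h : a ≠ 0 ∨ c ≠ 0) : {y : ℂ | a + y * c ≠ 0}.Infinite := by
  have : {y : ℂ | a + y * c = 0}.Finite := by
    refine Set.Subsingleton.finite fun x hx y hy => ?_
    simp only [Set.mem_ofPred_eq] at hx hy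
    by_cases hc : c = 0
    · subst hc
      simp at hx h
      exact absurd hx h
    · exact mul_right_cancel₀ hc (by linear_combination hx - hy)
  exact this.infinite_compl

lemma SL2.row_ne_zero (g : SL2) : g 0 0 ≠ 0 ∨ g 1 0 ≠ 0 := by
  by_contra! h
  have := SL2.det_eq g
  rw [h.1, h.2] at this
  simp at this

/-- The equivariant map to binary forms that is attached to a functional of maximal weight. -/
lemma exists_formMap {n : ℕ} (hρ : IsAlgebraicRep ρ)
    (hn : ∀ m, weightSpace ρ m ≠ ⊥ → -(n : ℤ) ≤ m ∧ m ≤ n) {ℓ : Module.Dual ℂ V}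
    (hℓ : ∀ m ≠ (n : ℤ), ∀ w ∈ weightSpace ρ m, ℓ w = 0) :
    ∃ Φ : V →ₗ[ℂ] Forms n, (∀ g w, Φ (ρ g w) = nuRep (n + 1) g (Φ w)) ∧
      ∀ w (g : SL2), g 0 0 ≠ 0 →
        ℓ (ρ g w) = MvPolynomial.eval ![g 0 0, g 0 1] (Φ w : MvPolynomial (Fin 2) ℂ) := by
  choose Φ hΦ using exists_form_of_dual hρ hn hℓ
  have hup : ∀ w y, ℓ (ρ (upperSL2 y) w) =
      MvPolynomial.eval ![1, y] (Φ w : MvPolynomial (Fin 2) ℂ) := by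
    intro w y
    simpa using hΦ w (upperSL2 y) (by simp)
  refine ⟨{ toFun := Φ, map_add' := fun x y => ?_, map_smul' := fun c x => ?_ }, fun g w => ?_, hΦ⟩
  · refine Forms.ext fun z => ?_
    simp only [Submodule.coe_add, map_add, ← hup]
  · refine Forms.ext fun z => ?_
    rw [← hup, RingHom.id_apply, Submodule.coe_smul, MvPolynomial.smul_eval, ← hup, map_smul,
      map_smul, smul_eq_mul]
  -- The formula for Φ holds on the big cell only, so the two forms are compared at the infinitely
  -- many y for which `upperSL2 y * g` lies there.
  · refine Forms.ext_of_infinite (infinite_affine_ne_zero (SL2.row_ne_zero g)) fun y hy => ?_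
    change MvPolynomial.eval ![1, y] (Φ (ρ g w) : MvPolynomial (Fin 2) ℂ) = _
    rw [← hup, ← Module.End.mul_apply, ← map_mul, hΦ]
    · have := eval_nuRep (n + 1) g (Φ w) 1 y
      refine Eq.trans ?_ this.symm
      simp [SL2.mul_apply]
    · simpa [SL2.mul_apply] using hy

/-- The span of the orbit of a vector of maximal weight. -/
lemma finrank_orbit_le {n : ℕ} (hρ : IsAlgebraicRep ρ)
    (hn : ∀ m, weightSpace ρ m ≠ ⊥ → -(n : ℤ) ≤ m ∧ m ≤ n) {v : V} (hv : v ∈ weightSpace ρ n) :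
    Module.finrank ℂ (Submodule.span ℂ (Set.range fun g : SL2 => ρ g v)) ≤ n + 1 := by
  obtain ⟨M, u, hM, hu0, hu⟩ := hρ.exists_lower v
  let b : Fin (n + 1) → V := fun j => if (j : ℕ) < M then u j else 0
  set S := Submodule.span ℂ (Set.range b) with hS
  have hlow : ∀ c, ρ (lowerSL2 c) v ∈ S := by
    intro c
    rw [hu]
    refine Submodule.sum_mem _ fun j hj => Submodule.smul_mem _ _ ?_
    have hj := Finset.mem_range.1 hj
    by_cases hjn : j < n + 1
    · exact Submodule.subset_span ⟨⟨j, hjn⟩, by simp [b, hj]⟩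
    · have h1 := lower_component_mem_weightSpace hv hu hj
      have h2 : weightSpace ρ (n - 2 * j) = ⊥ := by
        by_contra h
        have := (hn _ h).1
        omega
      rw [h2, Submodule.mem_bot] at h1
      rw [h1]
      exact Submodule.zero_mem _
  have hcell : ∀ g : SL2, g 0 0 ≠ 0 → ρ g v ∈ S := by
    intro g hg
    rw [SL2.bigCell g (Units.mk0 _ hg) rfl, map_mul, map_mul, Module.End.mul_apply,
      Module.End.mul_apply, upperSL2_fix hρ hn hv, hv, map_smul]
    exact Submodule.smul_mem _ _ (hlow _)
  have hall : ∀ g : SL2, ρ g v ∈ S := by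
    intro g
    -- The vector ρ g v is the constant term of y ↦ ρ (upperSL2 y * g) v, whose values lie in S
    -- whenever the product is in the big cell.
    obtain ⟨M', u', hM', hu0', hu'⟩ := hρ.exists_upper (ρ g v)
    rw [← hu0']
    refine mem_of_sum_pow_smul_mem (infinite_affine_ne_zero (SL2.row_ne_zero g)) (M := M')
      (u := u') (fun y hy => ?_) hM'
    rw [← hu', ← Module.End.mul_apply, ← map_mul]
    refine hcell _ ?_
    simpa [SL2.mul_apply] using hy
  have hle : Submodule.span ℂ (Set.range fun g : SL2 => ρ g v) ≤ S := by
    rw [Submodule.span_le]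
    rintro _ ⟨g, rfl⟩
    exact hall g
  refine (Submodule.finrank_mono hle).trans ?_
  refine (finrank_range_le_card b).trans ?_
  simp

/-- A nonzero algebraic representation of `SL₂` has a direct summand of the form `ν_{n + 1}`. -/
lemma IsAlgebraicRep.exists_summand [Nontrivial V] (hρ : IsAlgebraicRep ρ) :
    ∃ (n : ℕ) (Φ : V →ₗ[ℂ] Forms n) (f : Forms n →ₗ[ℂ] V),
      (∀ g w, Φ (ρ g w) = nuRep (n + 1) g (Φ w)) ∧ (∀ g p, f (nuRep (n + 1) g p) = ρ g (f p)) ∧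
      ∀ p, Φ (f p) = p := by
  obtain ⟨n, hnb, hn⟩ := hρ.exists_maximal_weight
  obtain ⟨v, hv, ℓ, hℓv, hℓ⟩ := exists_dual_of_weight hnb
  obtain ⟨Φ, hΦ, hΦe⟩ := exists_formMap hρ hn hℓ
  have hΦv : Φ v = formMonomial n 0 := by
    refine Forms.ext fun y => ?_
    have := hΦe v (upperSL2 y) (by simp)
    rw [upperSL2_fix hρ hn hv, hℓv] at this
    rw [eval_formMonomial]
    simpa using this.symm
  set S := Submodule.span ℂ (Set.range fun g : SL2 => ρ g v) with hS
  have hSg : ∀ g, ∀ w ∈ S, ρ g w ∈ S := by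
    intro g w hw
    have : S ≤ S.comap (ρ g) := by
      rw [hS, Submodule.span_le]
      rintro _ ⟨h, rfl⟩
      refine Submodule.subset_span ⟨g * h, ?_⟩
      simp
    exact this hw
  have htop : S.map Φ = ⊤ := by
    refine eq_top_of_formMonomial_zero_mem fun c => ?_
    rw [← hΦv, ← hΦ]
    exact Submodule.mem_map_of_mem (Submodule.subset_span ⟨_, rfl⟩)
  have hsurj : Function.Surjective (Φ.domRestrict S) := by
    rw [← LinearMap.range_eq_top, LinearMap.range_domRestrict, htop]
  -- The orbit span S has dimension at most n + 1 and maps onto a space of that dimension. So Φ is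
  -- an isomorphism on S, and its inverse is an equivariant section.
  have hfin : Module.finrank ℂ S = Module.finrank ℂ (Forms n) := by
    refine le_antisymm ?_ (by
      rw [← finrank_top ℂ (Forms n), ← LinearMap.range_eq_top.2 hsurj]
      exact LinearMap.finrank_range_le _)
    rw [finrank_forms]
    exact finrank_orbit_le hρ hn hv
  have hinj : Function.Injective (Φ.domRestrict S) :=
    (LinearMap.injective_iff_surjective_of_finrank_eq_finrank hfin).2 hsurj
  let e := LinearEquiv.ofBijective (Φ.domRestrict S) ⟨hinj, hsurj⟩
  have he : ∀ s : S, e s = Φ s := fun s => rfl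
  refine ⟨n, Φ, S.subtype ∘ₗ e.symm.toLinearMap, hΦ, fun g p => ?_, fun p => ?_⟩
  · obtain ⟨s, rfl⟩ := e.surjective p
    have h1 : nuRep (n + 1) g (e s) = e ⟨ρ g s, hSg g s s.2⟩ := by
      rw [he, he]
      exact (hΦ g s).symm
    simp only [LinearMap.comp_apply, LinearEquiv.coe_coe, Submodule.coe_subtype,
      LinearEquiv.symm_apply_apply]
    erw [h1]
    rw [LinearEquiv.symm_apply_apply]
  · obtain ⟨s, rfl⟩ := e.surjective p
    change Φ (e.symm (e s) : V) = e s
    rw [LinearEquiv.symm_apply_apply, he]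

/-- A family of equivariant maps `ν_{k i} → V` that exhibits `V` as a direct sum. -/
structure FormDecomposition (ρ : Representation ℂ SL2 V) (ι : Type) [Fintype ι] where
  /-- The dimensions of the summands. -/
  dim : ι → ℕ
  one_le_dim : ∀ i, 1 ≤ dim i
  /-- The inclusions of the summands. -/
  map : ∀ i, Forms (dim i - 1) →ₗ[ℂ] V
  equivariant : ∀ i g p, map i (nuRep (dim i) g p) = ρ g (map i p)
  iSup_range : ⨆ i, LinearMap.range (map i) = ⊤
  sum_dim : ∑ i, dim i = Module.finrank ℂ V

/-- Induction on the dimension: the kernel of the equivariant retraction onto a summand is an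
invariant complement. -/
lemma IsAlgebraicRep.exists_formDecomposition (hρ : IsAlgebraicRep ρ) :
    ∃ (ι : Type) (_ : Fintype ι), Nonempty (FormDecomposition ρ ι) := by
  have key : ∀ d : ℕ, ∀ (V : Type u) [AddCommGroup V] [Module ℂ V] [FiniteDimensional ℂ V]
      (ρ : Representation ℂ SL2 V), IsAlgebraicRep ρ → Module.finrank ℂ V = d →
      ∃ (ι : Type) (_ : Fintype ι), Nonempty (FormDecomposition ρ ι) := by
    intro d
    induction d using Nat.strong_induction_on with
    | _ d ih =>
      intro V _ _ _ ρ hρ hd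
      rcases subsingleton_or_nontrivial V with hV | hV
      · exact ⟨Empty, inferInstance, ⟨⟨Empty.elim, fun i => i.elim, fun i => i.elim,
          fun i => i.elim, Subsingleton.elim _ _, by simp [Module.finrank_zero_of_subsingleton]⟩⟩⟩
      · obtain ⟨n, Φ, f, hΦ, hf, hfΦ⟩ := hρ.exists_summand
        have hsurj : Function.Surjective Φ := fun p => ⟨f p, hfΦ p⟩
        have hrank := LinearMap.finrank_range_add_finrank_ker Φ
        rw [LinearMap.range_eq_top.2 hsurj, finrank_top, finrank_forms] at hrank
        let σ : Representation ℂ SL2 (LinearMap.ker Φ) := ρ.subrepresentation _ fun g w hw => by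
          rw [LinearMap.mem_ker] at hw
          rw [Submodule.mem_comap, LinearMap.mem_ker, hΦ, hw]
          exact map_zero _
        have hσ : ∀ g w, ((σ g w : LinearMap.ker Φ) : V) = ρ g w := fun g w => rfl
        have hσa : IsAlgebraicRep σ := by
          intro ℓ w
          obtain ⟨ℓ', hℓ'⟩ := LinearMap.exists_extend ℓ
          obtain ⟨P, hP⟩ := hρ ℓ' w
          refine ⟨P, fun g => ?_⟩
          rw [← hP, ← hσ, ← hℓ']
          rfl
        obtain ⟨ι, _, ⟨D⟩⟩ := ih _ (by omega) (LinearMap.ker Φ) σ hσa rfl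
        refine ⟨Option ι, inferInstance, ⟨⟨fun i => i.elim (n + 1) D.dim, ?_, fun i => ?_, ?_, ?_,
          ?_⟩⟩⟩
        · rintro (_ | i)
          · simp
          · exact D.one_le_dim i
        · exact match i with
            | none => f
            | some i => (LinearMap.ker Φ).subtype ∘ₗ D.map i
        · rintro (_ | i) g p
          · exact hf g p
          · exact congrArg Subtype.val (D.equivariant i g p)
        · rw [iSup_option, eq_top_iff]
          intro w _
          have h1 : w - f (Φ w) ∈ LinearMap.ker Φ := by
            rw [LinearMap.mem_ker, map_sub, hfΦ, sub_self]
          have h2 : ∀ x : LinearMap.ker Φ, x ∈ ⨆ i, LinearMap.range (D.map i) := fun x => by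
            rw [D.iSup_range]; trivial
          have h3 := Submodule.mem_map_of_mem (f := (LinearMap.ker Φ).subtype) (h2 ⟨_, h1⟩)
          rw [Submodule.map_iSup] at h3
          simp only [← LinearMap.range_comp] at h3
          have h4 : w = f (Φ w) + (w - f (Φ w)) := by abel
          rw [h4]
          exact Submodule.add_mem_sup ⟨_, rfl⟩ h3
        · rw [Fintype.sum_option]
          simp only [Option.elim]
          rw [D.sum_dim]
          omega
  exact key _ V ρ hρ rfl

end CompleteReducibility

/-! ## Ranks and eigenvalues on direct sums -/

section DirectSums

variable {V : Type*} [AddCommGroup V] [Module ℂ V]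
variable {ι : Type*} {W : ι → Type*} [∀ i, AddCommGroup (W i)] [∀ i, Module ℂ (W i)]

lemma exists_piEquiv [FiniteDimensional ℂ V] [Fintype ι] [∀ i, FiniteDimensional ℂ (W i)]
    (f : ∀ i, W i →ₗ[ℂ] V) (htop : ⨆ i, LinearMap.range (f i) = ⊤)
    (hdim : ∑ i, Module.finrank ℂ (W i) = Module.finrank ℂ V) :
    ∃ Θ : (∀ i, W i) ≃ₗ[ℂ] V, ∀ w, Θ w = ∑ i, f i (w i) := by
  let F : (∀ i, W i) →ₗ[ℂ] V := ∑ i, f i ∘ₗ LinearMap.proj i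
  have hF : ∀ w, F w = ∑ i, f i (w i) := fun w => by simp [F]
  have hsurj : Function.Surjective F := by
    classical
    rw [← LinearMap.range_eq_top, eq_top_iff, ← htop]
    refine iSup_le fun i => ?_
    rintro _ ⟨x, rfl⟩
    refine ⟨Pi.single i x, ?_⟩
    rw [hF, Finset.sum_eq_single_of_mem i (Finset.mem_univ i), Pi.single_eq_same]
    intro j _ hj
    rw [Pi.single_eq_of_ne hj, map_zero]
  have hfin : Module.finrank ℂ (∀ i, W i) = Module.finrank ℂ V := by
    rw [Module.finrank_pi_fintype, hdim]
  exact ⟨LinearEquiv.ofBijective F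
    ⟨(LinearMap.injective_iff_surjective_of_finrank_eq_finrank hfin).2 hsurj, hsurj⟩, hF⟩

lemma finrank_range_eq_sum [Fintype ι] [∀ i, FiniteDimensional ℂ (W i)]
    (Θ : (∀ i, W i) ≃ₗ[ℂ] V) {A : Module.End ℂ V}
    {B : ∀ i, Module.End ℂ (W i)} (h : ∀ w, A (Θ w) = Θ fun i => B i (w i)) :
    Module.finrank ℂ (LinearMap.range A) = ∑ i, Module.finrank ℂ (LinearMap.range (B i)) := by
  let g : (∀ i, LinearMap.range (B i)) →ₗ[ℂ] V :=
    Θ.toLinearMap ∘ₗ LinearMap.pi fun i => (LinearMap.range (B i)).subtype ∘ₗ LinearMap.proj i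
  have hg : ∀ w, g w = Θ fun i => (w i : W i) := fun w => rfl
  have hinj : Function.Injective g := by
    intro v w hvw
    rw [hg, hg] at hvw
    have := Θ.injective hvw
    funext i
    exact Subtype.ext (congrFun this i)
  have hrange : LinearMap.range g = LinearMap.range A := by
    ext v
    constructor
    · rintro ⟨w, rfl⟩
      choose u hu using fun i => (w i).2
      exact ⟨Θ u, by rw [h, hg]; simp only [hu]⟩
    · rintro ⟨v, rfl⟩
      obtain ⟨w, rfl⟩ := Θ.surjective v
      exact ⟨fun i => ⟨B i (w i), w i, rfl⟩, by rw [h, hg]⟩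
  rw [← hrange, LinearMap.finrank_range_of_inj hinj, Module.finrank_pi_fintype]

lemma pow_apply_pi (Θ : (∀ i, W i) ≃ₗ[ℂ] V) {A : Module.End ℂ V}
    {B : ∀ i, Module.End ℂ (W i)} (h : ∀ w, A (Θ w) = Θ fun i => B i (w i)) (x : ℕ) (w : ∀ i, W i) :
    (A ^ x) (Θ w) = Θ fun i => (B i ^ x) (w i) := by
  induction x generalizing w with
  | zero => rfl
  | succ x ih => simp only [pow_succ, Module.End.mul_apply, h, ih]

/-- The ranks of the powers of a regular nilpotent endomorphism. -/
lemma finrank_range_pow_of_nilpotent [FiniteDimensional ℂ V] {A : Module.End ℂ V} {k : ℕ} (hk : Module.finrank ℂ V = k)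
    (hA : A ^ k = 0) (hker : Module.finrank ℂ (LinearMap.ker A) ≤ 1) (x : ℕ) :
    Module.finrank ℂ (LinearMap.range (A ^ x)) = k - x := by
  -- Each further factor A loses at most dim ker A ≤ 1. The rank falls from k to 0 in k steps, so
  -- every step loses exactly one.
  have hstep : ∀ x, Module.finrank ℂ (LinearMap.range (A ^ x)) ≤
      Module.finrank ℂ (LinearMap.range (A ^ (x + 1))) + 1 := by
    intro x
    have h1 := LinearMap.finrank_range_add_finrank_ker (A.domRestrict (LinearMap.range (A ^ x)))
    have h2 : LinearMap.range (A.domRestrict (LinearMap.range (A ^ x))) =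
        LinearMap.range (A ^ (x + 1)) := by
      rw [LinearMap.range_domRestrict, ← LinearMap.range_comp, pow_succ']
      rfl
    have h3 : Module.finrank ℂ (LinearMap.ker (A.domRestrict (LinearMap.range (A ^ x)))) ≤
        Module.finrank ℂ (LinearMap.ker A) := by
      let φ : LinearMap.ker (A.domRestrict (LinearMap.range (A ^ x))) →ₗ[ℂ] LinearMap.ker A :=
        LinearMap.codRestrict _ ((LinearMap.range (A ^ x)).subtype ∘ₗ Submodule.subtype _)
          fun v => v.2
      exact LinearMap.finrank_le_finrank_of_injective (f := φ) fun v w hvw => by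
        have := congrArg Subtype.val hvw
        exact Subtype.ext (Subtype.ext this)
    rw [h2] at h1
    omega
  have hlow : ∀ x, k ≤ Module.finrank ℂ (LinearMap.range (A ^ x)) + x := by
    intro x
    induction x with
    | zero => rw [pow_zero, Module.End.one_eq_id, LinearMap.range_id, finrank_top, hk]; rfl
    | succ x ih => have := hstep x; omega
  have hzero : ∀ x, k ≤ x → Module.finrank ℂ (LinearMap.range (A ^ x)) = 0 := by
    intro x hx
    rw [pow_eq_zero_of_le hx hA, LinearMap.range_zero, finrank_bot]
  have hup : ∀ j x, x + j = k → Module.finrank ℂ (LinearMap.range (A ^ x)) ≤ j := by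
    intro j
    induction j with
    | zero => intro x hx; rw [hzero x (by omega)]
    | succ j ih =>
      intro x hx
      have h1 := hstep x
      have h2 := ih (x + 1) (by omega)
      omega
  rcases le_total k x with h | h
  · rw [hzero x h]; omega
  · have h1 := hup (k - x) x (by omega)
    have h2 := hlow x
    omega

lemma charpoly_roots_of_basis [FiniteDimensional ℂ V] {κ : Type*} [Fintype κ] [DecidableEq κ] (b : Module.Basis κ ℂ V)
    {A : Module.End ℂ V} {c : κ → ℂ} (h : ∀ j, A (b j) = c j • b j) :
    A.charpoly.roots = (Finset.univ : Finset κ).val.map c := by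
  have hm : LinearMap.toMatrix b b A = Matrix.diagonal c := by
    ext i j
    rw [LinearMap.toMatrix_apply, h, map_smul, Module.Basis.repr_self, Finsupp.smul_single,
      smul_eq_mul, mul_one, Matrix.diagonal_apply, Finsupp.single_apply]
    by_cases hij : i = j
    · subst hij; simp
    · rw [if_neg hij, if_neg fun e => hij e.symm]
  rw [← LinearMap.charpoly_toMatrix A b, hm, Matrix.charpoly_diagonal]
  exact Polynomial.roots_multiset_prod_X_sub_C (Finset.univ.val.map c) ▸ by
    rw [Multiset.map_map]; rfl

end DirectSums

/-! ## The regular unipotent element on binary forms and on Jordan blocks -/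

section RegularUnipotent

/-- The representation of `SL₂` on binary forms of degree `n`. -/
abbrev formRep (n : ℕ) : Representation ℂ SL2 (Forms n) := nuRep (n + 1)

/-- The unipotent element sends X₁ to X₀ + X₁, so subtracting 1 lowers the degree in X₁. -/
lemma nuRep_upper_sub_one_pow (n d : ℕ) (i : Fin (n + 1)) (hi : (i : ℕ) < d) :
    ((formRep n unipSL2 - 1 : Module.End ℂ (Forms n)) ^ d) (formMonomial n i) = 0 := by
  induction d generalizing i with
  | zero => omega
  | succ d ih =>
    have h : (formRep n unipSL2 - 1 : Module.End ℂ (Forms n)) (formMonomial n i) =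
        ∑ j ∈ Finset.univ.erase i, ((i : ℕ).choose j : ℂ) • formMonomial n j := by
      rw [LinearMap.sub_apply, Module.End.one_apply, sub_eq_iff_eq_add]
      refine (nuRep_upper_formMonomial i).trans ?_
      rw [← Finset.sum_erase_add _ _ (Finset.mem_univ i), Nat.choose_self, Nat.cast_one, one_smul]
    rw [pow_succ, Module.End.mul_apply, h, map_sum]
    refine Finset.sum_eq_zero fun j hj => ?_
    have hji : (j : ℕ) ≠ i := fun e => (Finset.mem_erase.1 hj).1 (Fin.ext e)
    rw [map_smul]
    rcases lt_or_gt_of_ne hji with h | h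
    · rw [ih j (by omega), smul_zero]
    · rw [Nat.choose_eq_zero_of_lt h, Nat.cast_zero, zero_smul]

lemma finrank_range_nuRep_pow {k : ℕ} (hk : 1 ≤ k) (x : ℕ) :
    Module.finrank ℂ (LinearMap.range ((nuRep k unipSL2 - 1) ^ x)) = k - x := by
  obtain ⟨n, rfl⟩ : ∃ n, k = n + 1 := ⟨k - 1, by omega⟩
  refine finrank_range_pow_of_nilpotent (V := Forms n) finrank_forms ?_ ?_ x
  · refine (formBasis n).ext fun i => ?_
    rw [formBasis_apply]
    exact nuRep_upper_sub_one_pow n (n + 1) i i.2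
  · have hle : LinearMap.ker (formRep n unipSL2 - 1 : Module.End ℂ (Forms n)) ≤
        Submodule.span ℂ {formMonomial n 0} := by
      intro p hp
      have hp' : nuRep (n + 1) unipSL2 p = p := by
        rw [LinearMap.mem_ker, LinearMap.sub_apply, sub_eq_zero] at hp
        exact hp
      -- A fixed form is periodic on the line (1, y), hence constant there, hence a multiple of
      -- X₀^n.
      have hstep : ∀ y : ℂ, MvPolynomial.eval ![1, y + 1] (p : MvPolynomial (Fin 2) ℂ) =
          MvPolynomial.eval ![1, y] (p : MvPolynomial (Fin 2) ℂ) := by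
        intro y
        have := eval_nuRep (n + 1) unipSL2 p 1 y
        rw [hp'] at this
        rw [this, unipSL2_eq]
        simp [add_comm]
      have hnat : ∀ m : ℕ, MvPolynomial.eval ![1, (m : ℂ)] (p : MvPolynomial (Fin 2) ℂ) =
          MvPolynomial.eval ![1, 0] (p : MvPolynomial (Fin 2) ℂ) := by
        intro m
        induction m with
        | zero => simp
        | succ m ih => rw [Nat.cast_succ, hstep, ih]
      refine Submodule.mem_span_singleton.2
        ⟨MvPolynomial.eval ![1, 0] (p : MvPolynomial (Fin 2) ℂ), ?_⟩
      refine Forms.ext_of_infinite (Set.infinite_range_of_injective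
        (Nat.cast_injective (R := ℂ))) ?_
      rintro _ ⟨m, rfl⟩
      rw [hnat, Submodule.coe_smul, MvPolynomial.smul_eval, eval_formMonomial]
      simp
    refine (Submodule.finrank_mono hle).trans ?_
    exact (finrank_span_le_card _).trans (by simp)

lemma toLin'_jordan_sub_one_pow (k d : ℕ) (v : Fin k → ℂ) (i : Fin k) :
    ((Matrix.toLin' (unipJordanBlock k) - 1 : Module.End ℂ (Fin k → ℂ)) ^ d) v i =
      if h : (i : ℕ) + d < k then v ⟨i + d, h⟩ else 0 := by
  have hone : ∀ (v : Fin k → ℂ) (i : Fin k),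
      (Matrix.toLin' (unipJordanBlock k) - 1 : Module.End ℂ (Fin k → ℂ)) v i =
        if h : (i : ℕ) + 1 < k then v ⟨i + 1, h⟩ else 0 := by
    intro v i
    rw [LinearMap.sub_apply, Module.End.one_apply, Pi.sub_apply, Matrix.toLin'_apply,
      Matrix.mulVec, dotProduct, ← Finset.add_sum_erase _ _ (Finset.mem_univ i)]
    simp only [unipJordanBlock, Matrix.of_apply, if_true, one_mul, add_sub_cancel_left]
    split_ifs with h
    · rw [Finset.sum_eq_single_of_mem (⟨i + 1, h⟩ : Fin k)]
      · simp
      · rw [Finset.mem_erase]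
        exact ⟨fun e => by simpa using congrArg Fin.val e, Finset.mem_univ _⟩
      · intro j hj hj'
        rw [if_neg (Finset.mem_erase.1 hj).1, if_neg, zero_mul]
        exact fun e => hj' (Fin.ext e)
    · refine Finset.sum_eq_zero fun j hj => ?_
      rw [if_neg (Finset.mem_erase.1 hj).1, if_neg, zero_mul]
      omega
  induction d generalizing i with
  | zero => simp
  | succ d ih =>
    rw [pow_succ', Module.End.mul_apply, hone]
    simp only [ih]
    split_ifs with h1 h2 h3 <;> first | omega | rfl | skip
    congr 2
    omega

lemma finrank_range_jordan_pow (k x : ℕ) :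
    Module.finrank ℂ (LinearMap.range
      ((Matrix.toLin' (unipJordanBlock k) - 1 : Module.End ℂ (Fin k → ℂ)) ^ x)) = k - x := by
  refine finrank_range_pow_of_nilpotent (by simp) ?_ ?_ x
  · refine LinearMap.ext fun v => funext fun i => ?_
    rw [toLin'_jordan_sub_one_pow, dif_neg (by omega)]
    rfl
  · rcases k with _ | k
    · rw [Module.finrank_zero_of_subsingleton]; omega
    · have hle : LinearMap.ker (Matrix.toLin' (unipJordanBlock (k + 1)) - 1 :
          Module.End ℂ (Fin (k + 1) → ℂ)) ≤ Submodule.span ℂ {Pi.single 0 1} := by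
        intro v hv
        refine Submodule.mem_span_singleton.2 ⟨v 0, ?_⟩
        funext i
        rcases Fin.eq_zero_or_eq_succ i with rfl | ⟨j, rfl⟩
        · simp
        · have h1 := toLin'_jordan_sub_one_pow (k + 1) 1 v j.castSucc
          have h2 : (j.castSucc : ℕ) + 1 < k + 1 := by simp
          rw [pow_one, LinearMap.mem_ker.1 hv, dif_pos h2] at h1
          have : (⟨(j.castSucc : ℕ) + 1, h2⟩ : Fin (k + 1)) = j.succ := rfl
          rw [this] at h1
          rw [← h1]
          simp
      refine (Submodule.finrank_mono hle).trans ?_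
      exact (finrank_span_le_card _).trans (by simp)

lemma sum_toType (lam : Multiset ℕ) (x : ℕ) : ∑ i : lam, ((i : ℕ) - x) = qf lam x := by
  rw [qf]
  conv_rhs => rw [← Multiset.map_univ_coe lam]
  rw [Multiset.map_map]
  rfl

/-- After conjugation and reindexing the operator is a direct sum of nilpotent blocks, and a block
of size k has x-th power of rank max(k - x, 0). -/
lemma finrank_range_of_mem_unipotentClass {N : ℕ} {lam : Multiset ℕ} {u : DualGroup N}
    (hu : u ∈ unipotentClass N lam) (x : ℕ) :
    Module.finrank ℂ (LinearMap.range
      ((Matrix.toLin' (matOf u) - 1 : Module.End ℂ (Fin N → ℂ)) ^ x)) = qf lam x := by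
  classical
  obtain ⟨-, e, g, hg⟩ := hu
  let M : Matrix (Σ i : lam, Fin (i : ℕ)) (Σ i : lam, Fin (i : ℕ)) ℂ :=
    Matrix.blockDiagonal' fun i : lam => unipJordanBlock (i : ℕ)
  have hM : ∀ (w : ∀ i : lam, Fin (i : ℕ) → ℂ),
      M.mulVec (fun p => w p.1 p.2) = fun p => (unipJordanBlock p.1).mulVec (w p.1) p.2 := by
    intro w
    funext ⟨i, a⟩
    simp only [M, Matrix.mulVec, dotProduct, Fintype.sum_sigma]
    rw [Finset.sum_eq_single_of_mem i (Finset.mem_univ i)]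
    · simp [Matrix.blockDiagonal'_apply_eq]
    · intro j _ hj
      refine Finset.sum_eq_zero fun b _ => ?_
      rw [Matrix.blockDiagonal'_apply_ne _ _ _ hj.symm, zero_mul]
  let Θ₁ : (∀ i : lam, Fin (i : ℕ) → ℂ) ≃ₗ[ℂ] (Fin N → ℂ) :=
    { toFun := fun w k => w (e.symm k).1 (e.symm k).2
      map_add' := fun _ _ => rfl
      map_smul' := fun _ _ => rfl
      invFun := fun v i a => v (e ⟨i, a⟩)
      left_inv := fun w => by
        funext i a
        exact congr_arg (fun p : Σ i : lam, Fin (i : ℕ) => w p.1 p.2) (e.symm_apply_apply ⟨i, a⟩)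
      right_inv := fun v => by
        funext k
        simp }
  let Θ₂ : (Fin N → ℂ) ≃ₗ[ℂ] (Fin N → ℂ) :=
    { toFun := fun v => ((g⁻¹ : GL (Fin N) ℂ) : Matrix (Fin N) (Fin N) ℂ).mulVec v
      map_add' := fun _ _ => Matrix.mulVec_add _ _ _
      map_smul' := fun _ _ => Matrix.mulVec_smul _ _ _
      invFun := fun v => (g : Matrix (Fin N) (Fin N) ℂ).mulVec v
      left_inv := fun v => by simp only [Matrix.mulVec_mulVec, ← Units.val_mul, mul_inv_cancel,
        Units.val_one, Matrix.one_mulVec]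
      right_inv := fun v => by simp only [Matrix.mulVec_mulVec, ← Units.val_mul, inv_mul_cancel,
        Units.val_one, Matrix.one_mulVec] }
  have hΘ : ∀ w, (Matrix.toLin' (matOf u)) ((Θ₁.trans Θ₂) w) =
      (Θ₁.trans Θ₂) fun i => Matrix.toLin' (unipJordanBlock (i : ℕ)) (w i) := by
    intro w
    have h1 : matOf u * ((g⁻¹ : GL (Fin N) ℂ) : Matrix (Fin N) (Fin N) ℂ) =
        ((g⁻¹ : GL (Fin N) ℂ) : Matrix (Fin N) (Fin N) ℂ) * Matrix.reindex e e M := by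
      have : ((g⁻¹ : GL (Fin N) ℂ) : Matrix (Fin N) (Fin N) ℂ) * (g : Matrix (Fin N) (Fin N) ℂ) =
          1 := by rw [← Units.val_mul, inv_mul_cancel]; rfl
      rw [← hg, ← Matrix.mul_assoc, ← Matrix.mul_assoc, this, Matrix.one_mul]
    change (matOf u).mulVec (((g⁻¹ : GL (Fin N) ℂ) : Matrix (Fin N) (Fin N) ℂ).mulVec (Θ₁ w)) =
      ((g⁻¹ : GL (Fin N) ℂ) : Matrix (Fin N) (Fin N) ℂ).mulVec
        (Θ₁ fun i => Matrix.toLin' (unipJordanBlock (i : ℕ)) (w i))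
    rw [Matrix.mulVec_mulVec, h1, ← Matrix.mulVec_mulVec]
    congr 1
    have h2 := hM w
    have h3 : Θ₁ w = (fun p : Σ i : lam, Fin (i : ℕ) => w p.1 p.2) ∘ e.symm := rfl
    rw [h3, Matrix.reindex_apply, Matrix.submatrix_mulVec_equiv]
    simp only [Equiv.symm_symm]
    rw [Function.comp_assoc, Equiv.symm_comp_self, Function.comp_id, h2]
    rfl
  have hΘ' : ∀ w, (Matrix.toLin' (matOf u) - 1 : Module.End ℂ (Fin N → ℂ)) ((Θ₁.trans Θ₂) w) =
      (Θ₁.trans Θ₂) fun i => (Matrix.toLin' (unipJordanBlock (i : ℕ)) - 1 :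
        Module.End ℂ (Fin (i : ℕ) → ℂ)) (w i) := by
    intro w
    rw [LinearMap.sub_apply, hΘ, Module.End.one_apply, ← map_sub]
    rfl
  rw [finrank_range_eq_sum (Θ₁.trans Θ₂) (pow_apply_pi _ hΘ' x)]
  simp only [finrank_range_jordan_pow]
  exact sum_toType lam x

end RegularUnipotent

/-! ## Invariant forms -/

section InvariantForms

variable {n n' : ℕ}

lemma span_lower_formMonomial_zero (n : ℕ) :
    Submodule.span ℂ (Set.range fun c : ℂ =>
      (nuRep (n + 1) (lowerSL2 c) (formMonomial n 0) : Forms n)) = ⊤ :=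
  eq_top_of_formMonomial_zero_mem fun c => Submodule.subset_span ⟨c, rfl⟩

/-- The torus leaves only the index j with n + n' = 2j. If j < n', invariance under the unipotent
element, applied to X₀^n and the monomial of index j + 1, leaves (j + 1) times the value at j equal
to zero. -/
lemma invariant_apply_zero {β : Forms n →ₗ[ℂ] Forms n' →ₗ[ℂ] ℂ}
    (hβ : ∀ (g : SL2) p q, β (nuRep (n + 1) g p) (nuRep (n' + 1) g q) = β p q)
    (j : Fin (n' + 1)) (hj : β (formMonomial n 0) (formMonomial n' j) ≠ 0) :
    n = n' ∧ (j : ℕ) = n' := by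
  have htorus : ∀ j : Fin (n' + 1), β (formMonomial n 0) (formMonomial n' j) ≠ 0 →
      (n : ℤ) + n' - 2 * j = 0 := by
    intro j hj
    have h1 := hβ (diagSL2 (Units.mk0 2 two_ne_zero)) (formMonomial n 0) (formMonomial n' j)
    rw [nuRep_diag_formMonomial, nuRep_diag_formMonomial] at h1
    erw [map_smul (β _), map_smul β, LinearMap.smul_apply] at h1
    rw [smul_smul, smul_eq_mul, Units.val_mk0, ← zpow_add₀ (two_ne_zero)] at h1
    have h2 := mul_right_cancel₀ hj (h1.trans (one_mul _).symm)
    have h3 := two_zpow_injective (h2.trans (zpow_zero (2 : ℂ)).symm)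
    simp only [Fin.val_zero, Nat.cast_zero] at h3
    omega
  have h0 := htorus j hj
  have hjn : (j : ℕ) = n' := by
    by_contra hne
    have hlt : (j : ℕ) + 1 < n' + 1 := by omega
    have h1 := hβ unipSL2 (formMonomial n 0) (formMonomial n' ⟨j + 1, hlt⟩)
    have e1 : nuRep (n + 1) unipSL2 (formMonomial n 0) = formMonomial n 0 := by
      refine (nuRep_upper_formMonomial 0).trans ?_
      rw [Finset.sum_eq_single_of_mem 0 (Finset.mem_univ _)]
      · simp
      · intro i _ hi
        rw [Nat.choose_eq_zero_of_lt]
        · simp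
        · exact Nat.pos_of_ne_zero fun e => hi (Fin.ext e)
    have e2 : β (formMonomial n 0) (formMonomial n' ⟨j + 1, hlt⟩) = 0 := by
      by_contra h
      have := htorus _ h
      push_cast at this
      omega
    have e3 := nuRep_upper_formMonomial (⟨j + 1, hlt⟩ : Fin (n' + 1))
    rw [← unipSL2_eq] at e3
    rw [e1, e2] at h1
    erw [e3, map_sum] at h1
    rw [Finset.sum_eq_single_of_mem j (Finset.mem_univ _)] at h1
    · rw [map_smul, smul_eq_mul] at h1
      rcases mul_eq_zero.1 h1 with h | h
      · have : 0 < ((j : ℕ) + 1).choose j := Nat.choose_pos (by omega)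
        exact absurd h (by exact_mod_cast this.ne')
      · exact hj h
    · intro i _ hi
      rw [map_smul, smul_eq_mul]
      by_contra h
      have := htorus i (right_ne_zero_of_mul h)
      exact hi (Fin.ext (by omega))
  exact ⟨by omega, hjn⟩

lemma invariant_lower {β : Forms n →ₗ[ℂ] Forms n' →ₗ[ℂ] ℂ}
    (hβ : ∀ (g : SL2) p q, β (nuRep (n + 1) g p) (nuRep (n' + 1) g q) = β p q) (c c' : ℂ) :
    β (nuRep (n + 1) (lowerSL2 c) (formMonomial n 0))
      (nuRep (n' + 1) (lowerSL2 c') (formMonomial n' 0)) =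
      β (formMonomial n 0) (nuRep (n' + 1) (lowerSL2 (c' - c)) (formMonomial n' 0)) := by
  have e : lowerSL2 c' = lowerSL2 c * lowerSL2 (c' - c) := by
    refine SL2.ext' ?_ ?_ ?_ ?_ <;> simp [SL2.mul_apply]
  rw [e, map_mul]
  exact hβ _ _ _

/-- By invariance a form is determined by its pairing with X₀^n, since the translates of X₀^n span;
for n ≠ n' this pairing vanishes. -/
lemma invariant_eq_zero (hn : n ≠ n') {β : Forms n →ₗ[ℂ] Forms n' →ₗ[ℂ] ℂ}
    (hβ : ∀ (g : SL2) p q, β (nuRep (n + 1) g p) (nuRep (n' + 1) g q) = β p q) : β = 0 := by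
  have h0 : β (formMonomial n 0) = 0 := by
    refine (formBasis n').ext fun j => ?_
    rw [formBasis_apply]
    by_contra h
    exact hn (invariant_apply_zero hβ j h).1
  refine LinearMap.ext_on_range (span_lower_formMonomial_zero n) fun c => ?_
  refine LinearMap.ext_on_range (span_lower_formMonomial_zero n') fun c' => ?_
  refine (invariant_lower hβ c c').trans ?_
  rw [h0]
  simp

/-- On translates of X₀^n by lower unipotent elements the form is a constant times (c' - c)^n, which
acquires the sign when c and c' are exchanged. -/
lemma invariant_symm {β : Forms n →ₗ[ℂ] Forms n →ₗ[ℂ] ℂ}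
    (hβ : ∀ (g : SL2) p q, β (nuRep (n + 1) g p) (nuRep (n + 1) g q) = β p q) (p q : Forms n) :
    β p q = (-1) ^ n * β q p := by
  have hc : ∀ c, β (formMonomial n 0) (nuRep (n + 1) (lowerSL2 c) (formMonomial n 0)) =
      c ^ n * β (formMonomial n 0) (formMonomial n (Fin.last n)) := by
    intro c
    rw [nuRep_lower_formMonomial_zero]
    erw [map_sum]
    rw [Finset.sum_eq_single_of_mem (Fin.last n) (Finset.mem_univ _)]
    · simp
    · intro i _ hi
      rw [map_smul, smul_eq_mul]
      by_contra h
      exact hi (Fin.ext (invariant_apply_zero hβ i (right_ne_zero_of_mul h)).2)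
  have key : β = ((-1) ^ n : ℂ) • β.flip := by
    refine LinearMap.ext_on_range (span_lower_formMonomial_zero n) fun c => ?_
    refine LinearMap.ext_on_range (span_lower_formMonomial_zero n) fun c' => ?_
    refine (invariant_lower hβ c c').trans ?_
    rw [hc]
    change _ = (-1) ^ n * β (nuRep (n + 1) (lowerSL2 c') (formMonomial n 0))
      (nuRep (n + 1) (lowerSL2 c) (formMonomial n 0))
    rw [invariant_lower hβ, hc, ← mul_assoc, ← mul_pow]
    ring
  conv_lhs => rw [key]
  rfl

end InvariantForms

/-! ## Representations of `SL₂` with a commuting semisimple endomorphism -/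

section Commuting

variable {V : Type*} [AddCommGroup V] [Module ℂ V] {ρ : Representation ℂ SL2 V}

/-- The eigenspaces of s are subrepresentations and can be decomposed one by one. -/
lemma IsAlgebraicRep.exists_formDecomposition_of_commute [FiniteDimensional ℂ V]
    (hρ : IsAlgebraicRep ρ)
    {s : Module.End ℂ V} (hs : s.IsSemisimple) (hc : ∀ g, Commute s (ρ g)) :
    ∃ (ι : Type) (_ : Fintype ι) (D : FormDecomposition ρ ι) (y : ι → ℂ),
      ∀ i p, s (D.map i p) = y i • D.map i p := by
  classical
  let T : Type := {μ : ℂ // s.eigenspace μ ≠ ⊥}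
  have hind : iSupIndep fun μ : T => s.eigenspace μ.1 :=
    s.eigenspaces_iSupIndep.comp Subtype.val_injective
  have hsup : ⨆ μ : T, s.eigenspace μ.1 = ⊤ := by
    rw [← hs.iSup_eigenspace_eq_top]
    exact iSup_ne_bot_subtype (s.eigenspace)
  have : Finite T := WellFoundedGT.finite_ne_bot_of_iSupIndep s.eigenspaces_iSupIndep
  have : Fintype T := Fintype.ofFinite T
  have hint : DirectSum.IsInternal fun μ : T => s.eigenspace μ.1 :=
    DirectSum.isInternal_submodule_of_iSupIndep_of_iSup_eq_top hind hsup
  have hdim : ∑ μ : T, Module.finrank ℂ (s.eigenspace μ.1) = Module.finrank ℂ V := by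
    rw [← Module.finrank_directSum]
    exact (LinearEquiv.ofBijective (DirectSum.coeLinearMap fun μ : T => s.eigenspace μ.1)
      hint).finrank_eq
  have hinv : ∀ (μ : ℂ) g, s.eigenspace μ ≤ (s.eigenspace μ).comap (ρ g) := by
    intro μ g v hv
    rw [Submodule.mem_comap, Module.End.mem_eigenspace_iff] at *
    rw [← Module.End.mul_apply, (hc g).eq, Module.End.mul_apply, hv, map_smul]
  let σ : ∀ μ : T, Representation ℂ SL2 (s.eigenspace μ.1) := fun μ =>
    ρ.subrepresentation _ (hinv μ.1)
  have hσa : ∀ μ, IsAlgebraicRep (σ μ) := by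
    intro μ ℓ w
    obtain ⟨ℓ', hℓ'⟩ := LinearMap.exists_extend ℓ
    obtain ⟨P, hP⟩ := hρ ℓ' w
    refine ⟨P, fun g => ?_⟩
    rw [← hP, ← hℓ']
    rfl
  choose ι' hι' hD using fun μ => (hσa μ).exists_formDecomposition
  let D := fun μ => (hD μ).some
  refine ⟨Σ μ : T, ι' μ, inferInstance, ⟨fun i => (D i.1).dim i.2, fun i => (D i.1).one_le_dim i.2,
    fun i => (s.eigenspace i.1.1).subtype ∘ₗ (D i.1).map i.2,
    fun i g p => congrArg Subtype.val ((D i.1).equivariant i.2 g p), ?_, ?_⟩,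
    fun i => i.1.1, fun i p => ?_⟩
  · rw [iSup_sigma, ← hsup]
    refine iSup_congr fun μ => ?_
    simp only [LinearMap.range_comp]
    rw [← Submodule.map_iSup, (D μ).iSup_range, Submodule.map_top, Submodule.range_subtype]
  · rw [Fintype.sum_sigma, ← hdim]
    exact Finset.sum_congr rfl fun μ _ => (D μ).sum_dim
  · exact Module.End.mem_eigenspace_iff.1 ((D i.1).map i.2 p).2

lemma isUnit_smul_sub_smul {A : Module.End ℂ V} (hA : IsNilpotent (A - 1)) {y a : ℂ} (h : y ≠ a) :
    IsUnit (y • A - a • 1) := by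
  have hu : IsUnit ((y - a) • (1 : Module.End ℂ V)) := by
    rw [← Algebra.algebraMap_eq_smul_one]
    exact (IsUnit.mk0 _ (sub_ne_zero.2 h)).map _
  have hsum : y • A - a • 1 = (y - a) • 1 + y • (A - 1) := by
    rw [smul_sub, sub_smul]
    abel
  rw [hsum]
  exact (hA.smul y).isUnit_add_left_of_commute hu ((Commute.one_right _).smul_right _)

lemma range_smul_sub_smul_pow (A : Module.End ℂ V) {a : ℂ} (ha : a ≠ 0) (x : ℕ) :
    LinearMap.range ((a • A - a • 1) ^ x) = LinearMap.range ((A - 1) ^ x) := by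
  rw [← smul_sub, smul_pow, LinearMap.range_smul _ _ (pow_ne_zero x ha)]

/-! ### Ranks and eigenvalues read off from a decomposition -/

namespace FormDecomposition

variable [FiniteDimensional ℂ V] {ι : Type} [Fintype ι] (D : FormDecomposition ρ ι)

lemma exists_equiv : ∃ Θ : (∀ i, Forms (D.dim i - 1)) ≃ₗ[ℂ] V, ∀ w, Θ w = ∑ i, D.map i (w i) := by
  refine exists_piEquiv D.map D.iSup_range ?_
  rw [← D.sum_dim]
  refine Finset.sum_congr rfl fun i _ => ?_
  rw [finrank_forms, Nat.sub_add_cancel (D.one_le_dim i)]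

/-- Where s acts by a, the operator is a multiple of u - 1, with one Jordan block; elsewhere it is a
nonzero scalar plus a nilpotent operator, hence invertible. -/
lemma finrank_range_smul_sub_pow {s : Module.End ℂ V} {y : ι → ℂ}
    (hy : ∀ i p, s (D.map i p) = y i • D.map i p) {a : ℂ} (ha : a ≠ 0) (x : ℕ) :
    Module.finrank ℂ (LinearMap.range ((s * ρ unipSL2 - a • 1) ^ x)) =
      ∑ i, if y i = a then D.dim i - x else D.dim i := by
  obtain ⟨Θ, hΘ⟩ := D.exists_equiv
  have h : ∀ w, (s * ρ unipSL2 - a • 1 : Module.End ℂ V) (Θ w) =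
      Θ fun i => (y i • nuRep (D.dim i) unipSL2 - a • 1 : Module.End ℂ (Forms (D.dim i - 1)))
        (w i) := by
    intro w
    simp only [hΘ, map_sum]
    refine Finset.sum_congr rfl fun i _ => ?_
    simp only [LinearMap.sub_apply, LinearMap.smul_apply, Module.End.one_apply,
      Module.End.mul_apply, map_sub, map_smul, ← D.equivariant, hy]
  rw [finrank_range_eq_sum Θ (pow_apply_pi Θ h x)]
  refine Finset.sum_congr rfl fun i _ => ?_
  obtain ⟨n, hn⟩ : ∃ n, D.dim i = n + 1 := ⟨D.dim i - 1, by have := D.one_le_dim i; omega⟩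
  rw [hn]
  change Module.finrank ℂ (LinearMap.range
    ((y i • formRep n unipSL2 - a • 1 : Module.End ℂ (Forms n)) ^ x)) = _
  split_ifs with hya
  · rw [hya, range_smul_sub_smul_pow (V := Forms n) (formRep n unipSL2) ha]
    exact finrank_range_nuRep_pow (k := n + 1) (by omega) x
  · have hunit : IsUnit (y i • formRep n unipSL2 - a • 1 : Module.End ℂ (Forms n)) := by
      refine isUnit_smul_sub_smul (V := Forms n) ⟨n + 1, ?_⟩ hya
      refine (formBasis n).ext fun j => ?_
      rw [formBasis_apply]
      exact nuRep_upper_sub_one_pow n (n + 1) j j.2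
    rw [LinearMap.range_eq_top.2 ((Module.End.isUnit_iff _).1 (hunit.pow x)).2, finrank_top]
    exact finrank_forms

lemma finrank_range_sub_one_pow (x : ℕ) :
    Module.finrank ℂ (LinearMap.range ((ρ unipSL2 - 1) ^ x)) =
      qf (Finset.univ.val.map D.dim) x := by
  have h := D.finrank_range_smul_sub_pow (s := 1) (y := fun _ => 1) (fun i p => by simp)
    one_ne_zero x
  rw [one_mul, one_smul] at h
  rw [h, qf, Multiset.map_map]
  simp only [if_true]
  rfl

lemma charpoly_roots {s : Module.End ℂ V} {y : ι → ℂ}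
    (hy : ∀ i p, s (D.map i p) = y i • D.map i p) (t : ℂˣ) :
    (s * ρ (diagSL2 t)).charpoly.roots =
      (Finset.univ : Finset (Σ i, Fin (D.dim i - 1 + 1))).val.map fun p =>
        y p.1 * (t : ℂ) ^ ((D.dim p.1 : ℤ) - 1 - 2 * (p.2 : ℕ)) := by
  classical
  obtain ⟨Θ, hΘ⟩ := D.exists_equiv
  refine charpoly_roots_of_basis ((Pi.basis fun i => formBasis (D.dim i - 1)).map Θ) ?_
  rintro ⟨i, j⟩
  have hb : ((Pi.basis fun i => formBasis (D.dim i - 1)).map Θ) ⟨i, j⟩ =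
      D.map i (formMonomial _ j) := by
    rw [Module.Basis.map_apply, Pi.basis_apply, hΘ, Finset.sum_eq_single_of_mem i
      (Finset.mem_univ i), Pi.single_eq_same, formBasis_apply]
    intro k _ hk
    rw [Pi.single_eq_of_ne hk, map_zero]
  have hdiag : nuRep (D.dim i) (diagSL2 t) (formMonomial _ j) =
      (t : ℂ) ^ ((D.dim i : ℤ) - 1 - 2 * (j : ℕ)) • formMonomial _ j := by
    have h1 : ∀ k (hk : 1 ≤ k) (j : Fin (k - 1 + 1)), nuRep k (diagSL2 t) (formMonomial _ j) =
        (t : ℂ) ^ ((k : ℤ) - 1 - 2 * (j : ℕ)) • formMonomial _ j := by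
      intro k hk j
      obtain ⟨n, rfl⟩ : ∃ n, k = n + 1 := ⟨k - 1, by omega⟩
      have h2 := nuRep_diag_formMonomial t (n := n) j
      push_cast
      rw [add_sub_cancel_right]
      exact h2
    exact h1 _ (D.one_le_dim i) j
  rw [hb, Module.End.mul_apply, ← D.equivariant, hdiag, map_smul, map_smul, hy, smul_smul, mul_comm]

/-- On the i-th summand the eigenvalues are t^e, once for each exponent e of the segment (m i, dim
i). -/
lemma count_charpoly_roots {s : Module.End ℂ V} {m : ι → ℤ} {t : ℂˣ}
    (ht : Function.Injective fun n : ℤ => (t : ℂ) ^ n)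
    (hy : ∀ i p, s (D.map i p) = (t : ℂ) ^ m i • D.map i p) (e : ℤ) :
    (s * ρ (diagSL2 t)).charpoly.roots.count ((t : ℂ) ^ e) =
      segRank (Finset.univ.val.map fun i => (m i, D.dim i)) e e := by
  classical
  rw [D.charpoly_roots hy t]
  simp only [← zpow_add₀ t.ne_zero]
  rw [Multiset.count_map, segRank, Multiset.countP_map, ← Finset.filter_val, ← Finset.filter_val,
    Finset.card_val, Finset.card_val]
  refine Finset.card_bij (fun p _ => p.1) ?_ ?_ ?_
  · rintro ⟨i, j⟩ hp
    have h1 := ht (Finset.mem_filter.1 hp).2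
    have h2 := j.2
    have h3 := D.one_le_dim i
    refine Finset.mem_filter.2 ⟨Finset.mem_univ _, ?_⟩
    simp only [InSeg] at *
    omega
  · rintro ⟨i, j⟩ hp ⟨i', j'⟩ hp' (rfl : i = i')
    have h1 := ht (Finset.mem_filter.1 hp).2
    have h2 := ht (Finset.mem_filter.1 hp').2
    have : j = j' := Fin.ext (by simp only at h1 h2; omega)
    rw [this]
  · intro i hi
    have h1 := (Finset.mem_filter.1 hi).2
    simp only [InSeg] at h1
    refine ⟨⟨i, ⟨((m i + D.dim i - 1 - e) / 2).toNat, by omega⟩⟩,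
      Finset.mem_filter.2 ⟨Finset.mem_univ _, ?_⟩, rfl⟩
    congr 1
    simp only
    omega

/-- If the ranks of the powers of `s * ρ u - a` are invariant under `a ↦ a⁻¹`, for the regular
unipotent `u`, then so is the multisegment of the decomposition. -/
lemma map_neg_eq {s : Module.End ℂ V} {m : ι → ℤ} {t : ℂˣ}
    (ht : Function.Injective fun n : ℤ => (t : ℂ) ^ n)
    (hy : ∀ i p, s (D.map i p) = (t : ℂ) ^ m i • D.map i p)
    (hr : ∀ (a : ℂ) (x : ℕ), a ≠ 0 →
      Module.finrank ℂ (LinearMap.range ((s * ρ unipSL2 - a • 1) ^ x)) =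
        Module.finrank ℂ (LinearMap.range ((s * ρ unipSL2 - a⁻¹ • 1) ^ x))) :
    (Finset.univ.val.map fun i => (m i, D.dim i)).map (fun p => (-p.1, p.2)) =
      Finset.univ.val.map fun i => (m i, D.dim i) := by
  classical
  let κ : ℤ → Multiset ℕ := fun n => (Finset.univ.filter fun i => m i = n).val.map D.dim
  have hqf : ∀ n x, qf (κ n) x = ∑ i, if m i = n then D.dim i - x else 0 := by
    intro n x
    rw [qf, Multiset.map_map, ← Finset.sum_filter]
    rfl
  -- Only summands with m i = n lose rank. Their total dimension `qf (κ n) 0` is eliminated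
  -- afterwards by a value of x so large that `qf (κ n) x` vanishes.
  have hrank : ∀ n x, Module.finrank ℂ (LinearMap.range
      ((s * ρ unipSL2 - ((t : ℂ) ^ n) • 1) ^ x)) + qf (κ n) 0 = ∑ i, D.dim i + qf (κ n) x := by
    intro n x
    rw [D.finrank_range_smul_sub_pow hy (zpow_ne_zero n t.ne_zero), hqf, hqf,
      ← Finset.sum_add_distrib, ← Finset.sum_add_distrib]
    refine Finset.sum_congr rfl fun i _ => ?_
    have : (t : ℂ) ^ m i = (t : ℂ) ^ n ↔ m i = n := ht.eq_iff
    simp only [this]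
    split_ifs <;> omega
  have hzero : ∀ n, qf (κ n) (∑ i, D.dim i) = 0 := by
    intro n
    rw [hqf]
    refine Finset.sum_eq_zero fun i _ => ?_
    have := Finset.single_le_sum (f := D.dim) (fun _ _ => Nat.zero_le _) (Finset.mem_univ i)
    split_ifs <;> omega
  have hκ0 : ∀ n, 0 ∉ κ n := by
    intro n h
    obtain ⟨i, -, hi⟩ := Multiset.mem_map.1 h
    have := D.one_le_dim i
    omega
  have hκ : ∀ n, κ (-n) = κ n := by
    intro n
    have hr' := fun x => hr ((t : ℂ) ^ n) x (zpow_ne_zero n t.ne_zero)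
    rw [← zpow_neg] at hr'
    refine eq_of_qf_eq (hκ0 _) (hκ0 _) fun x => ?_
    have h1 := hrank n x
    have h2 := hrank (-n) x
    have h3 := hrank n (∑ i, D.dim i)
    have h4 := hrank (-n) (∑ i, D.dim i)
    rw [hzero] at h3 h4
    rw [hr'] at h1 h3
    omega
  have hcount : ∀ n k, (Finset.univ.val.map fun i => (m i, D.dim i)).count (n, k) =
      (κ n).count k := by
    intro n k
    rw [Multiset.count_map, Multiset.count_map, Finset.filter_val, Multiset.filter_filter]
    congr 1
    refine Multiset.filter_congr fun i _ => ?_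
    rw [Prod.mk.injEq, and_comm, eq_comm (a := n)]
  ext ⟨n, k⟩
  have hinj : Function.Injective fun p : ℤ × ℕ => (-p.1, p.2) := fun p q h => by
    simpa [Prod.ext_iff] using h
  have h1 := Multiset.count_map_eq_count' (fun p : ℤ × ℕ => (-p.1, p.2))
    (Finset.univ.val.map fun i => (m i, D.dim i)) hinj (-n, k)
  rw [show (-(-n, k).1, (-n, k).2) = (n, k) from Prod.ext (neg_neg n) rfl] at h1
  rw [h1, hcount, hcount, hκ]

end FormDecomposition

end Commuting

/-! ## Bilinear forms and ranks -/

section Ranks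

/-- Restricted to a complement of the kernel the form is nondegenerate and still alternating, and a
skew matrix of odd size has determinant zero. -/
lemma even_rank_of_transpose_eq_neg {n : Type*} [Fintype n] [DecidableEq n] {K : Matrix n n ℂ}
    (hK : K.transpose = -K) : Even K.rank := by
  obtain ⟨W, hW⟩ := Submodule.exists_isCompl (LinearMap.ker (Matrix.toLin' K))
  let b := Module.finBasis ℂ W
  let A : Matrix (Fin (Module.finrank ℂ W)) (Fin (Module.finrank ℂ W)) ℂ :=
    Matrix.of fun i j => (b i : n → ℂ) ⬝ᵥ K.mulVec (b j)
  have hswap : ∀ v w : n → ℂ, v ⬝ᵥ K.mulVec w = -(w ⬝ᵥ K.mulVec v) := by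
    intro v w
    rw [Matrix.dotProduct_mulVec, ← Matrix.mulVec_transpose, hK, Matrix.neg_mulVec,
      neg_dotProduct, dotProduct_comm]
  have hA : A.transpose = -A := by
    ext i j
    exact hswap _ _
  have hrank : K.rank = Module.finrank ℂ W := by
    have h1 := LinearMap.finrank_range_add_finrank_ker (Matrix.toLin' K)
    have h2 := Submodule.finrank_add_eq_of_isCompl hW
    have h3 : K.rank = Module.finrank ℂ (LinearMap.range (Matrix.toLin' K)) := rfl
    omega
  have hinj : ∀ c : Fin (Module.finrank ℂ W) → ℂ, A.mulVec c = 0 → c = 0 := by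
    intro c hc
    set v : W := ∑ j, c j • b j with hv
    have hvK : ∀ w ∈ W, w ⬝ᵥ K.mulVec v = 0 := by
      intro w hw
      have h1 : (⟨w, hw⟩ : W) = ∑ i, b.repr ⟨w, hw⟩ i • b i := (b.sum_repr _).symm
      have h2 : w = ∑ i, b.repr ⟨w, hw⟩ i • (b i : n → ℂ) := by
        have h3 := congrArg W.subtype h1
        simpa only [map_sum, map_smul, Submodule.subtype_apply] using h3
      rw [h2, sum_dotProduct]
      refine Finset.sum_eq_zero fun i _ => ?_
      rw [smul_dotProduct]
      have h3 := congrFun hc i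
      have h4 : (v : n → ℂ) = ∑ j, c j • (b j : n → ℂ) := by simp [hv]
      have h5 : (b i : n → ℂ) ⬝ᵥ K.mulVec v = A.mulVec c i := by
        rw [h4, Matrix.mulVec_sum, dotProduct_sum, Matrix.mulVec, dotProduct]
        refine Finset.sum_congr rfl fun j _ => ?_
        rw [Matrix.mulVec_smul, dotProduct_smul, smul_eq_mul, mul_comm]
        rfl
      rw [h5, h3]
      simp
    have hall : K.mulVec (v : n → ℂ) = 0 := by
      refine dotProduct_eq_zero _ fun w => ?_
      rw [dotProduct_comm]
      have hw : w ∈ LinearMap.ker (Matrix.toLin' K) ⊔ W := by rw [hW.sup_eq_top]; trivial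
      obtain ⟨w₁, hw₁, w₂, hw₂, rfl⟩ := Submodule.mem_sup.1 hw
      rw [add_dotProduct, hvK w₂ hw₂, add_zero, hswap]
      have : K.mulVec w₁ = 0 := hw₁
      rw [this, dotProduct_zero, neg_zero]
    have hv0 : (v : n → ℂ) = 0 := by
      have : (v : n → ℂ) ∈ LinearMap.ker (Matrix.toLin' K) ⊓ W := ⟨hall, v.2⟩
      rwa [hW.inf_eq_bot] at this
    have hv0' : ∑ j, c j • b j = 0 := Subtype.ext hv0
    funext j
    exact Fintype.linearIndependent_iff.1 b.linearIndependent c hv0' j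
  have hdet : A.det ≠ 0 := by
    intro h
    obtain ⟨v, hv, hv'⟩ := Matrix.exists_mulVec_eq_zero_iff.2 h
    exact hv (hinj v hv')
  have h1 := congrArg Matrix.det hA
  rw [Matrix.det_transpose, Matrix.det_neg, Fintype.card_fin] at h1
  rw [hrank]
  by_contra hodd
  rw [Nat.not_even_iff_odd] at hodd
  rw [hodd.neg_one_pow] at h1
  exact hdet (by linear_combination h1 / 2)

lemma dualForm_apply {N : ℕ} (i j : Fin N) : dualForm N i j =
    if (i : ℕ) + j + 1 = N then (if i ≤ j then 1 else (groupSign N : ℂ)) else 0 := rfl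

lemma groupSign_mul_self (N : ℕ) : groupSign N * groupSign N = 1 := by
  unfold groupSign
  split_ifs <;> rfl

lemma transpose_dualForm (N : ℕ) :
    (dualForm N).transpose = ((groupSign N : ℤ) : ℂ) • dualForm N := by
  have hs : ((groupSign N : ℤ) : ℂ) * groupSign N = 1 := by
    exact_mod_cast groupSign_mul_self N
  ext i j
  rw [Matrix.transpose_apply, Matrix.smul_apply, dualForm_apply, dualForm_apply, smul_eq_mul,
    add_comm (j : ℕ)]
  split_ifs with h h1 h2 h2
  · have hij : i = j := le_antisymm h2 h1
    subst hij
    have : Odd N := ⟨i, by omega⟩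
    rw [groupSign, if_neg (Nat.not_even_iff_odd.2 this)]
    simp
  · exact hs.symm
  · rw [mul_one]
  · omega
  · rw [mul_zero]

lemma dualForm_mul_transpose (N : ℕ) : dualForm N * (dualForm N).transpose = 1 := by
  have hs : ((groupSign N : ℤ) : ℂ) * groupSign N = 1 := by
    exact_mod_cast groupSign_mul_self N
  ext i j
  rw [Matrix.mul_apply, Finset.sum_eq_single_of_mem i.rev (Finset.mem_univ _)]
  · rw [Matrix.transpose_apply, dualForm_apply, dualForm_apply, Matrix.one_apply]
    have h1 : (i : ℕ) + i.rev + 1 = N := by rw [Fin.val_rev]; omega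
    rw [if_pos h1]
    by_cases hij : i = j
    · subst hij
      rw [if_pos h1, if_pos rfl]
      split_ifs
      · exact one_mul 1
      · exact hs
    · have h2 : ¬ (j : ℕ) + i.rev + 1 = N := fun h => hij (Fin.ext (by omega))
      rw [if_neg h2, if_neg hij, mul_zero]
  · intro k _ hk
    rw [dualForm_apply, if_neg, zero_mul]
    refine fun h => hk (Fin.ext ?_)
    rw [Fin.val_rev]
    omega

lemma isUnit_det_dualForm (N : ℕ) : IsUnit (dualForm N).det :=
  (Matrix.isUnit_iff_isUnit_det _).1
    (IsUnit.of_mul_eq_one _ (dualForm_mul_transpose N))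

lemma toLin'_sub_smul_pow {n : Type*} [Fintype n] [DecidableEq n] (A : Matrix n n ℂ) (a : ℂ)
    (x : ℕ) : (Matrix.toLin' A - a • 1 : Module.End ℂ (n → ℂ)) ^ x =
      Matrix.toLin' ((A - a • 1) ^ x) := by
  change _ = Matrix.toLinAlgEquiv' ((A - a • 1) ^ x)
  rw [map_pow, map_sub, map_smul, map_one]
  rfl

lemma finrank_range_toLin' {n : Type*} [Fintype n] [DecidableEq n] (A : Matrix n n ℂ) :
    Module.finrank ℂ (LinearMap.range (Matrix.toLin' A)) = A.rank := rfl

/-! ### Isometries of a nondegenerate bilinear form -/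

section Isometry

variable {n : Type*} [Fintype n] [DecidableEq n] {K g : Matrix n n ℂ}

lemma isUnit_det_of_isometry (hK : IsUnit K.det) (hg : g.transpose * K * g = K) :
    IsUnit g.det := by
  have h := congrArg Matrix.det hg
  rw [Matrix.det_mul, Matrix.det_mul] at h
  rw [← h] at hK
  exact isUnit_of_mul_isUnit_right hK

lemma transpose_mul_of_isometry (hK : IsUnit K.det) (hg : g.transpose * K * g = K) :
    g.transpose * K = K * g⁻¹ := by
  conv_rhs => rw [← hg]
  rw [Matrix.mul_assoc, Matrix.mul_nonsing_inv _ (isUnit_det_of_isometry hK hg), Matrix.mul_one]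

/-- K conjugates g⁻¹ to the transpose of g, so g - a has the ranks of g⁻¹ - a, which is the unit -a
g⁻¹ times g - a⁻¹. -/
lemma rank_sub_smul_pow_inv (hK : IsUnit K.det) (hg : g.transpose * K * g = K) {a : ℂ}
    (ha : a ≠ 0) (x : ℕ) : ((g - a • 1) ^ x).rank = ((g - a⁻¹ • 1) ^ x).rank := by
  have hgu := isUnit_det_of_isometry hK hg
  have hsemi : SemiconjBy K (g⁻¹ - a • 1) (g - a • 1).transpose := by
    rw [SemiconjBy, Matrix.transpose_sub, Matrix.transpose_smul, Matrix.transpose_one, sub_mul,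
      transpose_mul_of_isometry hK hg, mul_sub, mul_smul_comm, smul_mul_assoc, one_mul, mul_one]
  have hfac : g⁻¹ - a • 1 = ((-a) • g⁻¹) * (g - a⁻¹ • 1) := by
    rw [mul_sub, smul_mul_assoc, Matrix.nonsing_inv_mul _ hgu, mul_smul_comm, mul_one, smul_smul]
    rw [mul_neg, inv_mul_cancel₀ ha]
    simp only [neg_smul, one_smul]
    abel
  have hcomm : Commute ((-a) • g⁻¹) (g - a⁻¹ • 1) := by
    refine Commute.smul_left (Commute.sub_right ?_ ((Commute.one_right _).smul_right _)) _
    rw [Commute, SemiconjBy, Matrix.nonsing_inv_mul _ hgu, Matrix.mul_nonsing_inv _ hgu]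
  have hu : IsUnit (((-a) • g⁻¹) ^ x).det := by
    rw [Matrix.det_pow, Matrix.det_smul]
    exact ((((IsUnit.mk0 _ ha).neg).pow _).mul (Matrix.isUnit_nonsing_inv_det _ hgu)).pow x
  have h1 := (hsemi.pow_right x).eq
  rw [hfac, hcomm.mul_pow] at h1
  have h2 := congrArg Matrix.rank h1
  rw [Matrix.rank_mul_eq_right_of_isUnit_det _ _ hK, Matrix.rank_mul_eq_right_of_isUnit_det _ _ hu,
    Matrix.rank_mul_eq_left_of_isUnit_det _ _ hK, ← Matrix.transpose_pow,
    Matrix.rank_transpose] at h2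
  exact h2.symm

/-- Unlike g - 1, the element g - g⁻¹ is skew-adjoint, so the condition on x makes K (g - g⁻¹)^x
skew-symmetric, hence of even rank. The two differ by the commuting factor g⁻¹ (g + 1), invertible
because g is unipotent. -/
lemma even_rank_sub_one_pow {ε : ℂ} (hK : IsUnit K.det) (hKt : K.transpose = ε • K)
    (hg : g.transpose * K * g = K) (hnil : IsNilpotent (g - 1)) {x : ℕ}
    (hx : ε * (-1) ^ x = -1) : Even ((g - 1) ^ x).rank := by
  have hgu := isUnit_det_of_isometry hK hg
  have h1 := transpose_mul_of_isometry hK hg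
  have h2 : (g⁻¹).transpose * K = K * g := by
    conv_lhs => rw [← hg]
    rw [← Matrix.mul_assoc, ← Matrix.mul_assoc, ← Matrix.transpose_mul,
      Matrix.mul_nonsing_inv _ hgu, Matrix.transpose_one, Matrix.one_mul]
  have hsemi : SemiconjBy K (-(g - g⁻¹)) (g - g⁻¹).transpose := by
    rw [SemiconjBy, Matrix.transpose_sub, sub_mul, h1, h2, neg_sub, mul_sub]
  have hskew : (K * (g - g⁻¹) ^ x).transpose = -(K * (g - g⁻¹) ^ x) := by
    rw [Matrix.transpose_mul, hKt, mul_smul_comm, Matrix.transpose_pow, ← (hsemi.pow_right x).eq,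
      neg_pow]
    have : ((-1 : Matrix n n ℂ) ^ x) = ((-1 : ℂ) ^ x) • 1 := by
      rcases Nat.even_or_odd x with h | h
      · simp [h.neg_one_pow]
      · simp [h.neg_one_pow]
    rw [this, smul_mul_assoc, one_mul, mul_smul_comm, smul_smul, hx, neg_smul, one_smul]
  have hgg : Commute g⁻¹ g := by
    rw [Commute, SemiconjBy, Matrix.nonsing_inv_mul _ hgu, Matrix.mul_nonsing_inv _ hgu]
  have hfac : g - g⁻¹ = (g⁻¹ * (g + 1)) * (g - 1) := by
    have : (g + 1) * (g - 1) = g * g - 1 := by noncomm_ring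
    rw [Matrix.mul_assoc, this, mul_sub, ← Matrix.mul_assoc, Matrix.nonsing_inv_mul _ hgu,
      Matrix.one_mul, Matrix.mul_one]
  have hcomm : Commute (g⁻¹ * (g + 1)) (g - 1) := by
    refine Commute.mul_left ?_ ?_
    · exact hgg.sub_right (Commute.one_right _)
    · exact ((Commute.refl g).sub_right (Commute.one_right _)).add_left (Commute.one_left _)
  have hplus : IsUnit (g + 1) := by
    have h3 : g + 1 = (2 : ℂ) • (1 : Matrix n n ℂ) + (g - 1) := by
      rw [two_smul]; abel
    rw [h3]
    refine hnil.isUnit_add_left_of_commute ?_ ((Commute.one_right _).smul_right _)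
    rw [← Algebra.algebraMap_eq_smul_one]
    exact (IsUnit.mk0 (2 : ℂ) two_ne_zero).map _
  have hu : IsUnit ((g⁻¹ * (g + 1)) ^ x).det := by
    rw [Matrix.det_pow, Matrix.det_mul]
    exact ((Matrix.isUnit_nonsing_inv_det _ hgu).mul
      ((Matrix.isUnit_iff_isUnit_det _).1 hplus)).pow x
  have h4 := even_rank_of_transpose_eq_neg hskew
  rwa [Matrix.rank_mul_eq_right_of_isUnit_det _ _ hK, hfac, hcomm.mul_pow,
    Matrix.rank_mul_eq_right_of_isUnit_det _ _ hu] at h4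

end Isometry

end Ranks

/-! ## The standard representation of a parameter -/

section StdRep

variable {Γ : Type*} [Group Γ] {N : ℕ}

lemma stdRep_apply (f : Γ →* DualGroup N) (g : Γ) : stdRep f g = Matrix.toLin' (matOf (f g)) := rfl

lemma matOf_mul (g h : DualGroup N) : matOf (g * h) = matOf g * matOf h := rfl

lemma matOf_one : matOf (1 : DualGroup N) = 1 := rfl

lemma matOf_injective : Function.Injective (matOf (N := N)) := fun _ _ h =>
  Subtype.ext (Units.ext h)

lemma matOf_isometry (g : DualGroup N) :
    (matOf g).transpose * dualForm N * matOf g = dualForm N := g.2.1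

lemma isAlgebraicRep_stdRep {f : SL2 →* DualGroup N}
    (hf : ∃ P : Fin N → Fin N → MvPolynomial (Fin 2 × Fin 2) ℂ, ∀ (x : SL2) (i j : Fin N),
      matOf (f x) i j = MvPolynomial.eval (fun p => x p.1 p.2) (P i j)) :
    IsAlgebraicRep (stdRep f) := by
  obtain ⟨P, hP⟩ := hf
  intro ℓ v
  refine ⟨∑ i, ∑ j, MvPolynomial.C (v j * ℓ (Pi.single i 1)) * P i j, fun g => ?_⟩
  rw [stdRep_apply, Matrix.toLin'_apply]
  conv_lhs => rw [← LinearMap.sum_single_apply (fun _ : Fin N => ℂ) ((matOf (f g)).mulVec v)]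
  rw [map_sum, map_sum]
  refine Finset.sum_congr rfl fun i _ => ?_
  have h1 : (Pi.single i ((matOf (f g)).mulVec v i) : Fin N → ℂ) =
      (matOf (f g)).mulVec v i • Pi.single i (1 : ℂ) := by
    rw [← Pi.single_smul, smul_eq_mul, mul_one]
  rw [h1, map_smul, Matrix.mulVec, dotProduct, map_sum, smul_eq_mul, Finset.sum_mul]
  refine Finset.sum_congr rfl fun j _ => ?_
  rw [hP, map_mul, MvPolynomial.eval_C]
  ring

lemma qf_eq_zero_of_sum (lam : Multiset ℕ) : qf lam lam.sum = 0 :=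
  qf_eq_zero_of_sum_le le_rfl

lemma rank_of_mem_unipotentClass {lam : Multiset ℕ} {u : DualGroup N}
    (hu : u ∈ unipotentClass N lam) (x : ℕ) : ((matOf u - 1) ^ x).rank = qf lam x := by
  have h := finrank_range_of_mem_unipotentClass hu x
  have h1 := toLin'_sub_smul_pow (matOf u) 1 x
  rw [one_smul, one_smul] at h1
  rwa [h1, finrank_range_toLin'] at h

/-- The Jordan type of a unipotent element of the dual group. -/
lemma mem_partitionSet_of_mem_unipotentClass {lam : Multiset ℕ} {u : DualGroup N}
    (hu : u ∈ unipotentClass N lam) : lam ∈ partitionSet (groupSign N) N := by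
  have hr := rank_of_mem_unipotentClass hu
  refine mem_partitionSet_of_even_qf (groupSign_eq N) hu.1 ?_ fun x hx => ?_
  · have := hr 0
    rw [pow_zero, Matrix.rank_one, Fintype.card_fin, qf_zero] at this
    exact this.symm
  · rw [← hr]
    refine even_rank_sub_one_pow (ε := ((groupSign N : ℤ) : ℂ)) (isUnit_det_dualForm N)
      (transpose_dualForm N) (matOf_isometry u) ⟨lam.sum, ?_⟩ ?_
    · have h0 := hr lam.sum
      rw [qf_eq_zero_of_sum] at h0
      refine Matrix.toLin'.injective ?_
      rw [map_zero]
      exact LinearMap.range_eq_bot.1 (Submodule.finrank_eq_zero.1 h0)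
    · rcases hx with ⟨h, hx⟩ | ⟨h, hx⟩
      · rw [h, hx.neg_one_pow]; norm_num
      · rw [h, hx.neg_one_pow]; norm_num

lemma FormDecomposition.map_dim_eq {f : SL2 →* DualGroup N} {ι : Type} [Fintype ι]
    (D : FormDecomposition (stdRep f) ι) {lam : Multiset ℕ}
    (hu : f unipSL2 ∈ unipotentClass N lam) : Finset.univ.val.map D.dim = lam := by
  refine eq_of_qf_eq ?_ hu.1 fun x => ?_
  · intro h
    obtain ⟨i, -, hi⟩ := Multiset.mem_map.1 h
    have := D.one_le_dim i
    omega
  · rw [← D.finrank_range_sub_one_pow]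
    exact finrank_range_of_mem_unipotentClass hu x

end StdRep

/-! ## The Weil group -/

section Weil

variable {F : Type*} [Field F] [ValuativeRel F]

lemma weilDeg_mul (v w : WeilGroup F) : weilDeg (v * w) = weilDeg v + weilDeg w := rfl

/-- The degree as a homomorphism. -/
def weilDegHom : WeilGroup F →* Multiplicative ℤ :=
  (MonoidHom.snd _ _).comp (WeilGroup F).subtype

lemma weilDeg_eq_toAdd (w : WeilGroup F) : weilDeg w = (weilDegHom w).toAdd := rfl

lemma weilDeg_zpow (w : WeilGroup F) (n : ℤ) : weilDeg (w ^ n) = n * weilDeg w := by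
  rw [weilDeg_eq_toAdd, map_zpow, toAdd_zpow, smul_eq_mul, weilDeg_eq_toAdd]

variable [TopologicalSpace F] [IsNonarchimedeanLocalField F]

lemma one_lt_residueCard : 1 < residueCard F := Finite.one_lt_card

lemma weilNormHalf_of_isInertia {w : WeilGroup F} (hw : IsInertia w) : weilNormHalf w = 1 := by
  ext
  have : weilDeg w = 0 := hw
  simp [weilNormHalf, this]

/-- The value at Frobenius is √q > 1, so exponents of eigenvalues are well-defined integers. -/
lemma zpow_weilNormHalf_injective {Fr : WeilGroup F} (hFr : IsFrobenius Fr) :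
    Function.Injective fun n : ℤ => ((weilNormHalf Fr : ℂˣ) : ℂ) ^ n := by
  have h1 : ((weilNormHalf Fr : ℂˣ) : ℂ) = ((Real.sqrt (residueCard F : ℝ) : ℝ) : ℂ) := by
    have : weilDeg Fr = 1 := hFr
    simp [weilNormHalf, this]
  have h2 : 1 < Real.sqrt (residueCard F : ℝ) := by
    rw [Real.lt_sqrt zero_le_one, one_pow]
    exact_mod_cast one_lt_residueCard
  intro m n hmn
  simp only [h1] at hmn
  have h3 : Real.sqrt (residueCard F : ℝ) ^ m = Real.sqrt (residueCard F : ℝ) ^ n := by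
    exact_mod_cast hmn
  exact zpow_right_injective₀ (by linarith) h2.ne' h3

end Weil

/-! ## The multisegment of a parameter -/

section Parameter

variable {F : Type*} [Field F] [ValuativeRel F] {N : ℕ}

/-- The restriction of an `L`-parameter to `SL₂`. -/
def LParameter.sl2Hom (φ : LParameter F N) : SL2 →* DualGroup N :=
  φ.hom.comp (MonoidHom.inr _ _)

/-- The restriction of an `A`-parameter to the second `SL₂`. -/
def AParameter.sl2Hom (ψ : AParameter F N) : SL2 →* DualGroup N :=
  ψ.hom.comp ((MonoidHom.inr _ _).comp (MonoidHom.inr _ _))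

lemma LParameter.sl2Hom_apply (φ : LParameter F N) (x : SL2) : φ.sl2Hom x = φ.hom (1, x) := rfl

lemma AParameter.sl2Hom_apply (ψ : AParameter F N) (x : SL2) : ψ.sl2Hom x = ψ.hom (1, 1, x) := rfl

lemma LParameter.isAlgebraicRep (φ : LParameter F N) : IsAlgebraicRep (stdRep φ.sl2Hom) :=
  isAlgebraicRep_stdRep φ.algebraic

lemma AParameter.isAlgebraicRep (ψ : AParameter F N) : IsAlgebraicRep (stdRep ψ.sl2Hom) := by
  refine isAlgebraicRep_stdRep ?_
  obtain ⟨P, hP⟩ := ψ.algebraic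
  let f : (Fin 2 × Fin 2) ⊕ (Fin 2 × Fin 2) → MvPolynomial (Fin 2 × Fin 2) ℂ :=
    Sum.elim (fun p => MvPolynomial.C ((1 : SL2) p.1 p.2)) MvPolynomial.X
  have h : ∀ (x : SL2) Q, MvPolynomial.eval (fun p => x p.1 p.2) (MvPolynomial.aeval f Q) =
      MvPolynomial.eval (Sum.elim (fun p => (1 : SL2) p.1 p.2) (fun p => x p.1 p.2)) Q := by
    intro x Q
    induction Q using MvPolynomial.induction_on with
    | C a => rw [MvPolynomial.aeval_C, MvPolynomial.algebraMap_eq, MvPolynomial.eval_C,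
        MvPolynomial.eval_C]
    | add p q hp hq => rw [map_add, map_add, map_add, hp, hq]
    | mul_X p k hp =>
      rw [map_mul, map_mul, map_mul, hp, MvPolynomial.aeval_X, MvPolynomial.eval_X]
      congr 1
      rcases k with k | k
      · exact MvPolynomial.eval_C _
      · exact MvPolynomial.eval_X _
  exact ⟨fun i j => MvPolynomial.aeval f (P i j), fun x i j => by
    rw [h, AParameter.sl2Hom_apply, hP]⟩

/-- The image of Frobenius, twisted by the sign `z`. -/
def LParameter.frobEnd (φ : LParameter F N) (Fr : WeilGroup F) (z : ℤˣ) :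
    Module.End ℂ (Fin N → ℂ) :=
  ((z : ℤ) : ℂ) • Matrix.toLin' (matOf (φ.hom (Fr, 1)))

variable (φ : LParameter F N) (Fr : WeilGroup F) (z : ℤˣ)

lemma intUnit_mul_self (z : ℤˣ) : ((z : ℤ) : ℂ) * ((z : ℤ) : ℂ) = 1 := by
  rcases Int.units_eq_one_or z with rfl | rfl <;> simp

lemma LParameter.frobEnd_isSemisimple : (φ.frobEnd Fr z).IsSemisimple :=
  Module.End.IsSemisimple_smul _ (φ.semisimple Fr)

lemma LParameter.hom_comm (w : WeilGroup F) (x : SL2) :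
    φ.hom (w, 1) * φ.hom (1, x) = φ.hom (1, x) * φ.hom (w, 1) := by
  rw [← map_mul, ← map_mul]
  simp

lemma LParameter.frobEnd_commute (x : SL2) : Commute (φ.frobEnd Fr z) (stdRep φ.sl2Hom x) := by
  refine Commute.smul_left ?_ _
  rw [Commute, SemiconjBy, stdRep_apply, Module.End.mul_eq_comp, Module.End.mul_eq_comp,
    ← Matrix.toLin'_mul, ← Matrix.toLin'_mul, ← matOf_mul, ← matOf_mul, LParameter.sl2Hom_apply,
    φ.hom_comm]

lemma LParameter.frobEnd_mul (x : SL2) : φ.frobEnd Fr z * stdRep φ.sl2Hom x =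
    Matrix.toLin' (((z : ℤ) : ℂ) • matOf (φ.hom (Fr, x))) := by
  rw [LParameter.frobEnd, stdRep_apply, smul_mul_assoc, Module.End.mul_eq_comp, ← Matrix.toLin'_mul,
    ← matOf_mul, LParameter.sl2Hom_apply, ← map_mul, map_smul, Prod.mk_mul_mk, mul_one, one_mul]

lemma smul_sign_isometry (g : DualGroup N) :
    (((z : ℤ) : ℂ) • matOf g).transpose * dualForm N * (((z : ℤ) : ℂ) • matOf g) = dualForm N := by
  rw [Matrix.transpose_smul, smul_mul_assoc, smul_mul_assoc, mul_smul_comm, smul_smul,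
    intUnit_mul_self, one_smul, matOf_isometry]

variable {φ Fr z} {ψ₀ : AParameter F N} {lam lamφ : Multiset ℕ}

lemma AParameter.IsQuasiBasic.hom_eq_one (hψ₀ : ψ₀.IsQuasiBasic Fr z lam) (x : SL2) :
    ψ₀.hom (1, x, 1) = 1 := hψ₀.1 1 x rfl

variable [TopologicalSpace F] [IsNonarchimedeanLocalField F]

lemma AParameter.infChar_apply (w : WeilGroup F) : ψ₀.infChar w =
    ψ₀.hom (w, diagSL2 (weilNormHalf w), diagSL2 (weilNormHalf w)) := rfl

/-- Frobenius acts by z and the first SL₂ trivially, so the twist by z leaves a torus element of the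
second SL₂. -/
lemma AParameter.IsQuasiBasic.smul_infChar (hψ₀ : ψ₀.IsQuasiBasic Fr z lam) :
    ((z : ℤ) : ℂ) • matOf (ψ₀.infChar Fr) = matOf (ψ₀.sl2Hom (diagSL2 (weilNormHalf Fr))) := by
  have h : ψ₀.infChar Fr = ψ₀.hom (Fr, 1, 1) * ψ₀.hom (1, diagSL2 (weilNormHalf Fr), 1) *
      ψ₀.sl2Hom (diagSL2 (weilNormHalf Fr)) := by
    rw [AParameter.sl2Hom_apply, ← map_mul, ← map_mul, AParameter.infChar_apply]
    simp
  rw [h, hψ₀.hom_eq_one, mul_one, matOf_mul, hψ₀.2.1, smul_mul_assoc, Matrix.one_mul, smul_smul,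
    intUnit_mul_self, one_smul]

lemma LParameter.charpoly_frobEnd (hψ₀ : ψ₀.IsQuasiBasic Fr z lam)
    (hχ : SameClass φ.infChar ψ₀.infChar) :
    (φ.frobEnd Fr z * stdRep φ.sl2Hom (diagSL2 (weilNormHalf Fr))).charpoly =
      (stdRep ψ₀.sl2Hom (diagSL2 (weilNormHalf Fr))).charpoly := by
  obtain ⟨g, hg⟩ := hχ
  rw [φ.frobEnd_mul, stdRep_apply, Matrix.charpoly_toLin', Matrix.charpoly_toLin',
    ← hψ₀.smul_infChar, ← hg Fr, matOf_mul, matOf_mul]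
  have h : ((z : ℤ) : ℂ) • (matOf g * matOf (φ.infChar Fr) * matOf g⁻¹) =
      (g : GL (Fin N) ℂ).val * (((z : ℤ) : ℂ) • matOf (φ.infChar Fr)) *
        ((g : GL (Fin N) ℂ).val)⁻¹ := by
    rw [mul_smul_comm, smul_mul_assoc, ← Matrix.coe_units_inv]
    rfl
  rw [h, Matrix.charpoly_units_conj]
  rfl

/-- The norm is trivial on inertia, so φ agrees there with its infinitesimal character, which is
conjugate to a trivial one. -/
lemma LParameter.hom_eq_one_of_isInertia (hψ₀ : ψ₀.IsQuasiBasic Fr z lam)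
    (hχ : SameClass φ.infChar ψ₀.infChar) {w : WeilGroup F} (hw : IsInertia w) :
    φ.hom (w, 1) = 1 := by
  obtain ⟨g, hg⟩ := hχ
  have h1 := hg w
  have h2 : φ.infChar w = φ.hom (w, 1) := by
    change φ.hom (w, diagSL2 (weilNormHalf w)) = _
    rw [weilNormHalf_of_isInertia hw, map_one]
  have h3 : ψ₀.infChar w = 1 := by
    rw [AParameter.infChar_apply, weilNormHalf_of_isInertia hw, map_one]
    exact hψ₀.1 w 1 hw
  rw [h2, h3] at h1
  exact conj_eq_one_iff.1 h1

/-- The multisegment of an `L`-parameter with a quasi-basic infinitesimal character. -/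
lemma LParameter.exists_multisegment (hFr : IsFrobenius Fr) (hψ₀ : ψ₀.IsQuasiBasic Fr z lam)
    (hχ : SameClass φ.infChar ψ₀.infChar) (hlamφ : φ.unipotent ∈ unipotentClass N lamφ) :
    ∃ (ι : Type) (_ : Fintype ι) (D : FormDecomposition (stdRep φ.sl2Hom) ι) (m : ι → ℤ),
      (∀ i p, φ.frobEnd Fr z (D.map i p) =
        ((weilNormHalf Fr : ℂˣ) : ℂ) ^ m i • D.map i p) ∧
      (Finset.univ.val.map fun i => (m i, D.dim i)).map Prod.snd = lamφ ∧
      (∀ e, segRank (Finset.univ.val.map fun i => (m i, D.dim i)) e e =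
        segRank (centred lam) e e) ∧
      (Finset.univ.val.map fun i => (m i, D.dim i)).map (fun p => (-p.1, p.2)) =
        Finset.univ.val.map fun i => (m i, D.dim i) := by
  set h := (weilNormHalf Fr : ℂˣ) with hh
  have hinj := zpow_weilNormHalf_injective hFr
  obtain ⟨ι, _, D, y, hy⟩ := φ.isAlgebraicRep.exists_formDecomposition_of_commute
    (φ.frobEnd_isSemisimple Fr z) (φ.frobEnd_commute Fr z)
  obtain ⟨ι₀, _, ⟨D₀⟩⟩ := ψ₀.isAlgebraicRep.exists_formDecomposition
  have hroots := congrArg Polynomial.roots (LParameter.charpoly_frobEnd hψ₀ hχ)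
  have h0 : ∀ i p, (1 : Module.End ℂ (Fin N → ℂ)) (D₀.map i p) = (h : ℂ) ^ (0 : ℤ) • D₀.map i p := by
    intro i p
    rw [zpow_zero, one_smul]
    rfl
  -- Up to a power of h, y i is an eigenvalue of z times the infinitesimal character at Frobenius;
  -- for ψ₀ all these eigenvalues are powers of h.
  have hm : ∀ i, ∃ m : ℤ, y i = (h : ℂ) ^ m := by
    intro i
    have h1 := D.charpoly_roots hy h
    have h2 := D₀.charpoly_roots (s := 1) (y := fun _ => 1) (fun i p => by simp) h
    rw [one_mul, ← hroots, h1] at h2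
    have h3 : y i * (h : ℂ) ^ ((D.dim i : ℤ) - 1 - 2 * ((0 : Fin (D.dim i - 1 + 1)) : ℕ)) ∈
        (Finset.univ : Finset (Σ i, Fin (D.dim i - 1 + 1))).val.map fun p =>
          y p.1 * (h : ℂ) ^ ((D.dim p.1 : ℤ) - 1 - 2 * (p.2 : ℕ)) :=
      Multiset.mem_map.2 ⟨⟨i, 0⟩, Finset.mem_univ _, rfl⟩
    rw [h2] at h3
    obtain ⟨⟨i₀, j₀⟩, -, h4⟩ := Multiset.mem_map.1 h3
    refine ⟨((D₀.dim i₀ : ℤ) - 1 - 2 * (j₀ : ℕ)) -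
      ((D.dim i : ℤ) - 1 - 2 * ((0 : Fin (D.dim i - 1 + 1)) : ℕ)), ?_⟩
    rw [zpow_sub₀ h.ne_zero, eq_div_iff (zpow_ne_zero _ h.ne_zero), ← h4, one_mul]
  choose m hm using hm
  have hy' : ∀ i p, φ.frobEnd Fr z (D.map i p) = (h : ℂ) ^ m i • D.map i p := fun i p => by
    rw [hy, hm]
  refine ⟨ι, inferInstance, D, m, hy', ?_, fun e => ?_, ?_⟩
  · rw [Multiset.map_map]
    exact D.map_dim_eq hlamφ
  · rw [← D.count_charpoly_roots hinj hy', hroots]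
    have h1 := D₀.count_charpoly_roots hinj h0 e
    rw [one_mul] at h1
    rw [h1, ← D₀.map_dim_eq hψ₀.2.2, centred, Multiset.map_map]
    rfl
  -- The operator in question is z φ(Fr, u), an isometry of the form of the dual group.
  · refine D.map_neg_eq hinj hy' fun a x ha => ?_
    rw [φ.frobEnd_mul, toLin'_sub_smul_pow, toLin'_sub_smul_pow, finrank_range_toLin',
      finrank_range_toLin']
    exact rank_sub_smul_pow_inv (isUnit_det_dualForm N) (smul_sign_isometry z _) ha x

end Parameter

/-! ## Decompositions of near-tempered shape -/

section NearTempered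

lemma exists_equiv_of_map_univ_eq {T ι X : Type*} [Fintype T] [Fintype ι] {G : T → X} {F : ι → X}
    (h : (Finset.univ : Finset T).val.map G = (Finset.univ : Finset ι).val.map F) :
    ∃ e : T ≃ ι, ∀ t, F (e t) = G t := by
  classical
  have hfib : ∀ x, Nonempty ({t // G t = x} ≃ {i // F i = x}) := by
    intro x
    refine Fintype.card_eq.1 ?_
    have h1 := congrArg (Multiset.count x) h
    rw [Multiset.count_map, Multiset.count_map, ← Finset.filter_val, ← Finset.filter_val,
      Finset.card_val, Finset.card_val] at h1
    rw [Fintype.card_subtype, Fintype.card_subtype]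
    simpa only [eq_comm] using h1
  let e : T ≃ ι := (Equiv.sigmaFiberEquiv G).symm.trans
    ((Equiv.sigmaCongrRight fun x => (hfib x).some).trans (Equiv.sigmaFiberEquiv F))
  exact ⟨e, fun t => ((hfib (G t)).some ⟨t, rfl⟩).2⟩

variable {V : Type*} [AddCommGroup V] [Module ℂ V]

/-- A decomposition of a representation of `SL₂` with a commuting endomorphism `s` into summands
`ν_a`, `a ∈ A`, on which `s` is trivial, and pairs of summands `ν_c`, `c ∈ J`, on which `s` acts by
`t` and `t⁻¹`. -/
structure PairedDecomposition (ρ : Representation ℂ SL2 V) (s : Module.End ℂ V) (t : ℂ)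
    (A : Multiset ℕ) (J : Finset ℕ) where
  one_le_left : ∀ a ∈ A, 1 ≤ a
  one_le_right : ∀ c ∈ J, 1 ≤ c
  /-- The inclusions of the summands on which `s` is trivial. -/
  mid : ∀ a : A, Forms ((a : ℕ) - 1) →ₗ[ℂ] V
  /-- The inclusions of the summands on which `s` acts by `t`. -/
  pos : ∀ c : J, Forms ((c : ℕ) - 1) →ₗ[ℂ] V
  /-- The inclusions of the summands on which `s` acts by `t⁻¹`. -/
  neg : ∀ c : J, Forms ((c : ℕ) - 1) →ₗ[ℂ] V
  mid_equivariant : ∀ a g p, mid a (nuRep (a : ℕ) g p) = ρ g (mid a p)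
  pos_equivariant : ∀ c g p, pos c (nuRep (c : ℕ) g p) = ρ g (pos c p)
  neg_equivariant : ∀ c g p, neg c (nuRep (c : ℕ) g p) = ρ g (neg c p)
  mid_eigen : ∀ a p, s (mid a p) = mid a p
  pos_eigen : ∀ c p, s (pos c p) = t • pos c p
  neg_eigen : ∀ c p, s (neg c p) = t⁻¹ • neg c p
  iSup_range : (⨆ a, LinearMap.range (mid a)) ⊔ ((⨆ c, LinearMap.range (pos c)) ⊔
    ⨆ c, LinearMap.range (neg c)) = ⊤
  finrank_eq : Module.finrank ℂ V = A.sum + ∑ c ∈ J, 2 * c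

lemma FormDecomposition.exists_pairedDecomposition {ρ : Representation ℂ SL2 V} {ι : Type}
    [Fintype ι] (D : FormDecomposition ρ ι) {s : Module.End ℂ V} {t : ℂ} {m : ι → ℤ}
    (hy : ∀ i p, s (D.map i p) = t ^ m i • D.map i p) {A : Multiset ℕ} {J : Finset ℕ}
    (h : Finset.univ.val.map (fun i => (m i, D.dim i)) =
      centred A + (J.val.map fun c => ((1 : ℤ), c)) + J.val.map fun c => ((-1 : ℤ), c)) :
    Nonempty (PairedDecomposition ρ s t A J) := by
  let G : A ⊕ (J ⊕ J) → ℤ × ℕ :=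
    Sum.elim (fun a => (0, (a : ℕ))) (Sum.elim (fun c => (1, (c : ℕ))) fun c => (-1, (c : ℕ)))
  have hJ : ∀ n : ℤ, (Finset.univ : Finset J).val.map (fun c : J => (n, (c : ℕ))) =
      J.val.map fun c => (n, c) := by
    intro n
    have : (Finset.univ : Finset J).val.map (fun c : J => (c : ℕ)) = J.val := by
      rw [Finset.univ_eq_attach]
      exact Multiset.attach_map_val J.val
    conv_rhs => rw [← this]
    rw [Multiset.map_map]
    rfl
  have hA : (Finset.univ : Finset A).val.map (fun a : A => ((0 : ℤ), (a : ℕ))) = centred A := by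
    rw [centred]
    conv_rhs => rw [← Multiset.map_univ_coe A]
    rw [Multiset.map_map]
    rfl
  have hG : (Finset.univ : Finset (A ⊕ (J ⊕ J))).val.map G =
      (Finset.univ : Finset ι).val.map fun i => (m i, D.dim i) := by
    rw [h, ← Finset.univ_disjSum_univ, Finset.val_disjSum, Multiset.map_disjSum,
      ← Finset.univ_disjSum_univ, Finset.val_disjSum, Multiset.map_disjSum, add_assoc, ← hA,
      ← hJ, ← hJ]
    rfl
  obtain ⟨e, he⟩ := exists_equiv_of_map_univ_eq hG
  -- The spaces of forms depend on dim i. Generalising (m i, dim i) to a variable x allows the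
  -- inclusions to be transported along the bijection e.
  have hmap : ∀ (i : ι) (x : ℤ × ℕ), (m i, D.dim i) = x → 1 ≤ x.2 ∧
      ∃ f : Forms (x.2 - 1) →ₗ[ℂ] V, (∀ g p, f (nuRep x.2 g p) = ρ g (f p)) ∧
        (∀ p, s (f p) = t ^ x.1 • f p) ∧ LinearMap.range f = LinearMap.range (D.map i) := by
    rintro i _ rfl
    exact ⟨D.one_le_dim i, D.map i, D.equivariant i, hy i, rfl⟩
  have hmid := fun a : A => hmap (e (.inl a)) _ (he _)
  have hpos := fun c : J => hmap (e (.inr (.inl c))) _ (he _)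
  have hneg := fun c : J => hmap (e (.inr (.inr c))) _ (he _)
  choose ha f hf hfs hfr using hmid
  choose hc fp hfp hfps hfpr using hpos
  choose hc' fm hfm hfms hfmr using hneg
  refine ⟨⟨fun a h => ?_, fun c h => hc ⟨c, h⟩, f, fp, fm, hf, hfp, hfm, fun a p => ?_,
    fun c p => ?_, fun c p => ?_, ?_, ?_⟩⟩
  · obtain ⟨x, rfl⟩ : ∃ x : A, (x : ℕ) = a := by
      rw [← Multiset.map_univ_coe A] at h
      obtain ⟨x, -, hx⟩ := Multiset.mem_map.1 h
      exact ⟨x, hx⟩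
    exact ha x
  · exact (hfs a p).trans (by rw [show (G (.inl a)).1 = 0 from rfl, zpow_zero, one_smul]; rfl)
  · exact (hfps c p).trans (by rw [show (G (.inr (.inl c))).1 = 1 from rfl, zpow_one]; rfl)
  · exact (hfms c p).trans (by rw [show (G (.inr (.inr c))).1 = -1 from rfl, zpow_neg_one]; rfl)
  · rw [← D.iSup_range, ← Equiv.iSup_comp (g := fun i => LinearMap.range (D.map i)) e, iSup_sum,
      iSup_sum]
    congr 1
    · exact iSup_congr hfr
    · congr 1
      · exact iSup_congr hfpr
      · exact iSup_congr hfmr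
  · have h1 := congrArg (fun M : Multiset (ℤ × ℕ) => (M.map Prod.snd).sum) h
    simp only [Multiset.map_add, Multiset.map_map, Multiset.sum_add, centred,
      Function.comp_def, Multiset.map_id'] at h1
    rw [← D.sum_dim, ← Finset.mul_sum]
    rw [show ∑ i, D.dim i = (Multiset.map D.dim Finset.univ.val).sum from rfl, h1,
      show ∑ c ∈ J, c = (Multiset.map (fun c => c) J.val).sum from rfl, Multiset.map_id']
    ring

end NearTempered

/-! ## The action of the second `SL₂` -/

section Mixing

variable {W U : Type*} [AddCommGroup W] [Module ℂ W] [AddCommGroup U] [Module ℂ U]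

/-- The action of `SL₂` on `W × U × U` that is trivial on `W` and by `2 × 2` matrices on
`U × U`. -/
def mixRep (W U : Type*) [AddCommGroup W] [Module ℂ W] [AddCommGroup U] [Module ℂ U] :
    Representation ℂ SL2 (W × U × U) where
  toFun y := (LinearMap.fst ℂ W (U × U)).prod
    (((y 0 0 • LinearMap.fst ℂ U U + y 0 1 • LinearMap.snd ℂ U U).prod
      (y 1 0 • LinearMap.fst ℂ U U + y 1 1 • LinearMap.snd ℂ U U)) ∘ₗ LinearMap.snd ℂ W (U × U))
  map_one' := by
    refine LinearMap.ext fun x => ?_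
    simp
  map_mul' y y' := by
    refine LinearMap.ext fun x => ?_
    refine Prod.ext rfl (Prod.ext ?_ ?_)
    · simp [SL2.mul_apply, add_smul, mul_smul]
      module
    · simp [SL2.mul_apply, add_smul, mul_smul]
      module

lemma mixRep_apply (y : SL2) (w : W) (u v : U) :
    mixRep W U y (w, u, v) = (w, y 0 0 • u + y 0 1 • v, y 1 0 • u + y 1 1 • v) := rfl

variable {V : Type*} [AddCommGroup V] [Module ℂ V]

lemma eq_zero_of_mul_eq {a b x : ℂ} (hab : a * b ≠ 1) (h : a * b * x = x) : x = 0 := by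
  have : (a * b - 1) * x = 0 := by linear_combination h
  exact (mul_eq_zero.1 this).resolve_left (sub_ne_zero.2 hab)

/-- Eigenvectors of the isometry s are orthogonal unless their eigenvalues multiply to 1, so only W
with itself and the two copies of U with each other can pair. By `hU` and `hB` the form on U ⊗ ℂ² is
β(u, v') - β(v, u'), and a matrix in SL₂ multiplies it by its determinant. -/
lemma mixRep_isometry {B : V →ₗ[ℂ] V →ₗ[ℂ] ℂ} {ε : ℂ} (hB : ∀ v w, B v w = ε * B w v)
    {s : Module.End ℂ V} (hs : ∀ v w, B (s v) (s w) = B v w) {t : ℂ} (ht1 : t ≠ 1)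
    (ht2 : t * t ≠ 1) {f : W →ₗ[ℂ] V} {fp fm : U →ₗ[ℂ] V} (hf : ∀ w, s (f w) = f w)
    (hfp : ∀ u, s (fp u) = t • fp u) (hfm : ∀ u, s (fm u) = t⁻¹ • fm u)
    (hU : ∀ u v, B (fp u) (fm v) = -ε * B (fp v) (fm u)) (y : SL2) (w w' : W) (u v u' v' : U) :
    B (f w + fp (y 0 0 • u + y 0 1 • v) + fm (y 1 0 • u + y 1 1 • v))
      (f w' + fp (y 0 0 • u' + y 0 1 • v') + fm (y 1 0 • u' + y 1 1 • v')) =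
    B (f w + fp u + fm v) (f w' + fp u' + fm v') := by
  have hti : t⁻¹ ≠ 1 := fun h => ht1 (inv_eq_one.1 h)
  have e1 : ∀ w u, B (f w) (fp u) = 0 := fun w u =>
    eq_zero_of_mul_eq (a := 1) (b := t) (by rwa [one_mul]) (by
      have := hs (f w) (fp u)
      rwa [hf, hfp, map_smul, smul_eq_mul, ← one_mul t] at this)
  have e2 : ∀ w u, B (f w) (fm u) = 0 := fun w u =>
    eq_zero_of_mul_eq (a := 1) (b := t⁻¹) (by rwa [one_mul]) (by
      have := hs (f w) (fm u)
      rwa [hf, hfm, map_smul, smul_eq_mul, ← one_mul t⁻¹] at this)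
  have e3 : ∀ u v, B (fp u) (fp v) = 0 := fun u v =>
    eq_zero_of_mul_eq ht2 (by
      have := hs (fp u) (fp v)
      rwa [hfp, hfp, map_smul, map_smul, LinearMap.smul_apply, smul_smul, smul_eq_mul] at this)
  have e4 : ∀ u v, B (fm u) (fm v) = 0 := fun u v =>
    eq_zero_of_mul_eq (a := t⁻¹) (b := t⁻¹)
      (fun h => ht2 (by rw [← mul_inv] at h; exact inv_eq_one.1 h)) (by
      have := hs (fm u) (fm v)
      rwa [hfm, hfm, map_smul, map_smul, LinearMap.smul_apply, smul_smul, smul_eq_mul] at this)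
  have e5 : ∀ u w, B (fp u) (f w) = 0 := fun u w => by rw [hB, e1, mul_zero]
  have e6 : ∀ u w, B (fm u) (f w) = 0 := fun u w => by rw [hB, e2, mul_zero]
  have e7 : ∀ u v, B (fm u) (fp v) = -B (fp u) (fm v) := fun u v => by rw [hB, hU u v]; ring
  have hd := SL2.det_eq y
  simp only [map_add, map_smul, LinearMap.add_apply, LinearMap.smul_apply, e1, e2, e3, e4, e5, e6,
    e7, smul_eq_mul]
  linear_combination (B (fp u) (fm v') - B (fp v) (fm u')) * hd

end Mixing

/-! ### Paired decompositions and the resulting second action -/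

namespace PairedDecomposition

variable {V : Type*} [AddCommGroup V] [Module ℂ V] {ρ : Representation ℂ SL2 V}
  {s : Module.End ℂ V} {t : ℂ} {A : Multiset ℕ} {J : Finset ℕ}

/-- The sum of binary forms with one summand for every part of `A`. -/
abbrev Mid (A : Multiset ℕ) : Type := ∀ a : A, Forms ((a : ℕ) - 1)

/-- The sum of binary forms with one summand for every element of `J`. -/
abbrev Outer (J : Finset ℕ) : Type := ∀ c : J, Forms ((c : ℕ) - 1)

lemma finrank_forms_sub_one {k : ℕ} (hk : 1 ≤ k) : Module.finrank ℂ (Forms (k - 1)) = k := by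
  rw [finrank_forms, Nat.sub_add_cancel hk]

lemma one_le_mid (P : PairedDecomposition ρ s t A J) (a : A) : 1 ≤ (a : ℕ) := P.one_le_left _ (Multiset.coe_mem)

lemma finrank_mid (P : PairedDecomposition ρ s t A J) :
    Module.finrank ℂ (Mid A) = A.sum := by
  rw [Module.finrank_pi_fintype, ← qf_zero, ← sum_toType]
  exact Finset.sum_congr rfl fun a _ => finrank_forms_sub_one (P.one_le_mid a)

lemma finrank_outer (P : PairedDecomposition ρ s t A J) :
    Module.finrank ℂ (Outer J) = ∑ c ∈ J, c := by
  rw [Module.finrank_pi_fintype, ← Finset.sum_coe_sort J fun c => c]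
  exact Finset.sum_congr rfl fun c _ => finrank_forms_sub_one (P.one_le_right c c.2)

variable (P : PairedDecomposition ρ s t A J)

/-- The inclusion of the part on which `s` is trivial. -/
def midSum : Mid A →ₗ[ℂ] V := ∑ a, P.mid a ∘ₗ LinearMap.proj a

/-- The inclusion of the part on which `s` acts by `t`. -/
def posSum : Outer J →ₗ[ℂ] V := ∑ c, P.pos c ∘ₗ LinearMap.proj c

/-- The inclusion of the part on which `s` acts by `t⁻¹`. -/
def negSum : Outer J →ₗ[ℂ] V := ∑ c, P.neg c ∘ₗ LinearMap.proj c

lemma midSum_apply (w : Mid A) : P.midSum w = ∑ a, P.mid a (w a) := by simp [midSum]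

lemma posSum_apply (u : Outer J) : P.posSum u = ∑ c, P.pos c (u c) := by simp [posSum]

lemma negSum_apply (u : Outer J) : P.negSum u = ∑ c, P.neg c (u c) := by simp [negSum]

lemma midSum_single [DecidableEq A] (a : A) (p : Forms ((a : ℕ) - 1)) :
    P.midSum (Pi.single a p) = P.mid a p := by
  rw [midSum_apply, Finset.sum_eq_single_of_mem a (Finset.mem_univ a), Pi.single_eq_same]
  intro b _ hb
  rw [Pi.single_eq_of_ne hb, map_zero]

lemma posSum_single (c : J) (p : Forms ((c : ℕ) - 1)) :
    P.posSum (Pi.single c p) = P.pos c p := by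
  rw [posSum_apply, Finset.sum_eq_single_of_mem c (Finset.mem_univ c), Pi.single_eq_same]
  intro b _ hb
  rw [Pi.single_eq_of_ne hb, map_zero]

lemma negSum_single (c : J) (p : Forms ((c : ℕ) - 1)) :
    P.negSum (Pi.single c p) = P.neg c p := by
  rw [negSum_apply, Finset.sum_eq_single_of_mem c (Finset.mem_univ c), Pi.single_eq_same]
  intro b _ hb
  rw [Pi.single_eq_of_ne hb, map_zero]

lemma midSum_equivariant (g : SL2) (w : Mid A) :
    P.midSum (fun a => nuRep (a : ℕ) g (w a)) = ρ g (P.midSum w) := by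
  rw [midSum_apply, midSum_apply, map_sum]
  exact Finset.sum_congr rfl fun a _ => P.mid_equivariant a g _

lemma posSum_equivariant (g : SL2) (u : Outer J) :
    P.posSum (fun c => nuRep (c : ℕ) g (u c)) = ρ g (P.posSum u) := by
  rw [posSum_apply, posSum_apply, map_sum]
  exact Finset.sum_congr rfl fun c _ => P.pos_equivariant c g _

lemma negSum_equivariant (g : SL2) (u : Outer J) :
    P.negSum (fun c => nuRep (c : ℕ) g (u c)) = ρ g (P.negSum u) := by
  rw [negSum_apply, negSum_apply, map_sum]
  exact Finset.sum_congr rfl fun c _ => P.neg_equivariant c g _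

lemma midSum_eigen (w : Mid A) : s (P.midSum w) = P.midSum w := by
  rw [midSum_apply, map_sum]
  exact Finset.sum_congr rfl fun a _ => P.mid_eigen a _

lemma posSum_eigen (u : Outer J) : s (P.posSum u) = t • P.posSum u := by
  rw [posSum_apply, map_sum, Finset.smul_sum]
  exact Finset.sum_congr rfl fun c _ => P.pos_eigen c _

lemma negSum_eigen (u : Outer J) : s (P.negSum u) = t⁻¹ • P.negSum u := by
  rw [negSum_apply, map_sum, Finset.smul_sum]
  exact Finset.sum_congr rfl fun c _ => P.neg_eigen c _

/-- Invariance kills the pairing of ν_c with ν_c' for c ≠ c', and the pairing of the two copies of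
ν_c has the sign (-1)^(c - 1). This is where the bad parity of the elements of J enters. -/
lemma pos_neg_antisymm {B : V →ₗ[ℂ] V →ₗ[ℂ] ℂ} {ε : ℂ}
    (hρ : ∀ g v w, B (ρ g v) (ρ g w) = B v w) (hJ : ∀ c ∈ J, (-1 : ℂ) ^ (c - 1) = -ε)
    (u v : Outer J) : B (P.posSum u) (P.negSum v) = -ε * B (P.posSum v) (P.negSum u) := by
  let β : ∀ c c' : J, Forms ((c : ℕ) - 1) →ₗ[ℂ] Forms ((c' : ℕ) - 1) →ₗ[ℂ] ℂ := fun c c' =>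
    B.compl₁₂ (P.pos c) (P.neg c')
  have hβ : ∀ (c c' : J) g p q, β c c' (nuRep (c : ℕ) g p) (nuRep (c' : ℕ) g q) = β c c' p q := by
    intro c c' g p q
    change B (P.pos c _) (P.neg c' _) = B (P.pos c _) (P.neg c' _)
    rw [P.pos_equivariant, P.neg_equivariant, hρ]
  -- Stated for arbitrary k, k' so that they can be replaced by n + 1, n' + 1, the form in which the
  -- lemmas on invariant forms apply.
  have hne : ∀ k k' (hk : 1 ≤ k) (hk' : 1 ≤ k') (_ : k ≠ k')
      (β : Forms (k - 1) →ₗ[ℂ] Forms (k' - 1) →ₗ[ℂ] ℂ)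
      (_ : ∀ g p q, β (nuRep k g p) (nuRep k' g q) = β p q), β = 0 := by
    intro k k' hk hk' hkk
    obtain ⟨n, rfl⟩ : ∃ n, k = n + 1 := ⟨k - 1, by omega⟩
    obtain ⟨n', rfl⟩ : ∃ n, k' = n + 1 := ⟨k' - 1, by omega⟩
    intro β hβ
    exact invariant_eq_zero (n := n) (n' := n') (fun h => hkk (by rw [h])) hβ
  have heq : ∀ k (hk : 1 ≤ k) (β : Forms (k - 1) →ₗ[ℂ] Forms (k - 1) →ₗ[ℂ] ℂ)
      (_ : ∀ g p q, β (nuRep k g p) (nuRep k g q) = β p q) p q,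
      β p q = (-1) ^ (k - 1) * β q p := by
    intro k hk
    obtain ⟨n, rfl⟩ : ∃ n, k = n + 1 := ⟨k - 1, by omega⟩
    intro β hβ
    exact invariant_symm (n := n) hβ
  have hsum : ∀ u v, B (P.posSum u) (P.negSum v) = ∑ c, β c c (u c) (v c) := by
    intro u v
    rw [posSum_apply, map_sum, LinearMap.sum_apply]
    refine Finset.sum_congr rfl fun c _ => ?_
    rw [negSum_apply, map_sum, Finset.sum_eq_single_of_mem c (Finset.mem_univ c)]
    · rfl
    · intro c' _ hc
      have := hne c c' (P.one_le_right c c.2) (P.one_le_right c' c'.2)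
        (fun h => hc (Subtype.ext h.symm)) (β c c') (hβ c c')
      exact LinearMap.congr_fun (LinearMap.congr_fun this (u c)) (v c')
  rw [hsum, hsum, Finset.mul_sum]
  refine Finset.sum_congr rfl fun c _ => ?_
  rw [heq c (P.one_le_right c c.2) (β c c) (hβ c c), hJ c c.2]

lemma exists_equiv [FiniteDimensional ℂ V] : ∃ Θ : (Mid A × Outer J × Outer J) ≃ₗ[ℂ] V,
    ∀ w u v, Θ (w, u, v) = P.midSum w + P.posSum u + P.negSum v := by
  classical
  let F : (Mid A × Outer J × Outer J) →ₗ[ℂ] V :=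
    P.midSum.coprod (P.posSum.coprod P.negSum)
  have hF : ∀ w u v, F (w, u, v) = P.midSum w + P.posSum u + P.negSum v := fun w u v => by
    simp [F, add_assoc]
  have hsurj : Function.Surjective F := by
    rw [← LinearMap.range_eq_top, eq_top_iff, ← P.iSup_range, LinearMap.range_coprod,
      LinearMap.range_coprod]
    refine sup_le_sup (iSup_le fun a => ?_) (sup_le_sup (iSup_le fun c => ?_)
      (iSup_le fun c => ?_))
    · rintro _ ⟨p, rfl⟩
      exact ⟨_, P.midSum_single a p⟩
    · rintro _ ⟨p, rfl⟩
      exact ⟨_, P.posSum_single c p⟩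
    · rintro _ ⟨p, rfl⟩
      exact ⟨_, P.negSum_single c p⟩
  have hfin : Module.finrank ℂ (Mid A × Outer J × Outer J) = Module.finrank ℂ V := by
    rw [Module.finrank_prod, Module.finrank_prod, P.finrank_mid, P.finrank_outer, P.finrank_eq,
      ← Finset.mul_sum, two_mul]
  exact ⟨LinearEquiv.ofBijective F
    ⟨(LinearMap.injective_iff_surjective_of_finrank_eq_finrank hfin).2 hsurj, hsurj⟩, hF⟩

variable [FiniteDimensional ℂ V]

/-- The isomorphism given by the decomposition. -/
def equiv : (Mid A × Outer J × Outer J) ≃ₗ[ℂ] V := P.exists_equiv.choose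

lemma equiv_apply (w : Mid A) (u v : Outer J) :
    P.equiv (w, u, v) = P.midSum w + P.posSum u + P.negSum v := P.exists_equiv.choose_spec w u v

lemma exists_eq_add (x : V) : ∃ w u v, x = P.midSum w + P.posSum u + P.negSum v := by
  obtain ⟨⟨w, u, v⟩, rfl⟩ := P.equiv.surjective x
  exact ⟨w, u, v, P.equiv_apply w u v⟩

/-- The action of `SL₂` that permutes the paired summands. -/
def secondRep : Representation ℂ SL2 V where
  toFun y := P.equiv.toLinearMap ∘ₗ mixRep (Mid A) (Outer J) y ∘ₗ P.equiv.symm.toLinearMap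
  map_one' := by
    refine LinearMap.ext fun x => ?_
    simp
  map_mul' y y' := by
    refine LinearMap.ext fun x => ?_
    simp

lemma secondRep_equiv (y : SL2) (x : Mid A × Outer J × Outer J) :
    P.secondRep y (P.equiv x) = P.equiv (mixRep _ _ y x) := by
  simp [secondRep]

lemma secondRep_apply (y : SL2) (w : Mid A) (u v : Outer J) :
    P.secondRep y (P.midSum w + P.posSum u + P.negSum v) =
      P.midSum w + P.posSum (y 0 0 • u + y 0 1 • v) + P.negSum (y 1 0 • u + y 1 1 • v) := by
  rw [← equiv_apply, secondRep_equiv, mixRep_apply, equiv_apply]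

lemma secondRep_commute (x y : SL2) : Commute (ρ x) (P.secondRep y) := by
  refine LinearMap.ext fun z => ?_
  obtain ⟨w, u, v, rfl⟩ := P.exists_eq_add z
  rw [Module.End.mul_apply, Module.End.mul_apply, secondRep_apply]
  simp only [map_add (ρ x), ← midSum_equivariant, ← posSum_equivariant, ← negSum_equivariant]
  rw [secondRep_apply]
  congr 2
  · congr 1
    funext c
    exact (map_add (nuRep (c : ℕ) x) _ _).trans (congrArg₂ (· + ·)
      (map_smul (nuRep (c : ℕ) x) (y 0 0) (u c)) (map_smul (nuRep (c : ℕ) x) (y 0 1) (v c)))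
  · funext c
    exact (map_add (nuRep (c : ℕ) x) _ _).trans (congrArg₂ (· + ·)
      (map_smul (nuRep (c : ℕ) x) (y 1 0) (u c)) (map_smul (nuRep (c : ℕ) x) (y 1 1) (v c)))

/-- Frobenius enters the second SL₂ through this torus element, so the A-parameter to be built gives
back the original Frobenius. -/
lemma secondRep_diag (h : ℂˣ) (ht : (h : ℂ) = t) : P.secondRep (diagSL2 h) = s := by
  refine LinearMap.ext fun z => ?_
  obtain ⟨w, u, v, rfl⟩ := P.exists_eq_add z
  rw [secondRep_apply, map_add s, map_add s, midSum_eigen, posSum_eigen, negSum_eigen]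
  simp [ht]

lemma isAlgebraicRep_secondRep : IsAlgebraicRep P.secondRep := by
  intro ℓ x
  obtain ⟨w, u, v, rfl⟩ := P.exists_eq_add x
  refine ⟨MvPolynomial.C (ℓ (P.midSum w)) +
    MvPolynomial.X (0, 0) * MvPolynomial.C (ℓ (P.posSum u)) +
    MvPolynomial.X (0, 1) * MvPolynomial.C (ℓ (P.posSum v)) +
    MvPolynomial.X (1, 0) * MvPolynomial.C (ℓ (P.negSum u)) +
    MvPolynomial.X (1, 1) * MvPolynomial.C (ℓ (P.negSum v)), fun y => ?_⟩
  rw [secondRep_apply]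
  simp only [map_add, map_mul, map_smul, MvPolynomial.eval_X, MvPolynomial.eval_C, smul_eq_mul]
  ring

lemma secondRep_isometry {B : V →ₗ[ℂ] V →ₗ[ℂ] ℂ} {ε : ℂ} (hB : ∀ v w, B v w = ε * B w v)
    (hρ : ∀ g v w, B (ρ g v) (ρ g w) = B v w) (hs : ∀ v w, B (s v) (s w) = B v w)
    (ht1 : t ≠ 1) (ht2 : t * t ≠ 1) (hJ : ∀ c ∈ J, (-1 : ℂ) ^ (c - 1) = -ε) (y : SL2) (v w : V) :
    B (P.secondRep y v) (P.secondRep y w) = B v w := by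
  obtain ⟨w₁, u₁, v₁, rfl⟩ := P.exists_eq_add v
  obtain ⟨w₂, u₂, v₂, rfl⟩ := P.exists_eq_add w
  rw [secondRep_apply, secondRep_apply]
  exact mixRep_isometry hB hs ht1 ht2 P.midSum_eigen P.posSum_eigen P.negSum_eigen
    (P.pos_neg_antisymm hρ hJ) y w₁ w₂ u₁ v₁ u₂ v₂

end PairedDecomposition

/-! ## Homomorphisms of `SL₂` into the dual group -/

section DualHom

lemma upperSL2_sq (b : ℂ) : upperSL2 (b / 2) * upperSL2 (b / 2) = upperSL2 b := by
  refine SL2.ext' ?_ ?_ ?_ ?_ <;> simp [SL2.mul_apply]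

lemma lowerSL2_sq (b : ℂ) : lowerSL2 (b / 2) * lowerSL2 (b / 2) = lowerSL2 b := by
  refine SL2.ext' ?_ ?_ ?_ ?_ <;> simp [SL2.mul_apply]

/-- Characters of `SL₂` of order two are trivial. -/
lemma SL2.hom_eq_one {δ : SL2 →* ℂ} (hδ : ∀ g, δ g * δ g = 1) (g : SL2) : δ g = 1 := by
  -- Unipotent and diagonal elements are squares, so δ is trivial on the big cell; any other element
  -- is moved there by an upper unipotent one.
  have hu : ∀ b, δ (upperSL2 b) = 1 := fun b => by rw [← upperSL2_sq, map_mul, hδ]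
  have hl : ∀ b, δ (lowerSL2 b) = 1 := fun b => by rw [← lowerSL2_sq, map_mul, hδ]
  have hd : ∀ t, δ (diagSL2 t) = 1 := by
    intro t
    obtain ⟨r, hr⟩ := IsAlgClosed.exists_pow_nat_eq (t : ℂ) (n := 2) (by norm_num)
    have hr0 : r ≠ 0 := by
      rintro rfl
      exact t.ne_zero (by rw [← hr]; norm_num)
    have : t = Units.mk0 r hr0 * Units.mk0 r hr0 := Units.ext (by
      rw [Units.val_mul, Units.val_mk0, ← sq, hr])
    rw [this, map_mul, map_mul, hδ]
  have hbig : ∀ g : SL2, g 0 0 ≠ 0 → δ g = 1 := by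
    intro g hg
    rw [SL2.bigCell g (Units.mk0 _ hg) rfl, map_mul, map_mul, hu, hl, hd, one_mul, one_mul]
  by_cases hg : g 0 0 = 0
  · have h1 := (SL2.row_ne_zero g).resolve_left fun h => h hg
    have h2 := hbig (upperSL2 1 * g) (by simpa [SL2.mul_apply, hg] using h1)
    rwa [map_mul, hu, one_mul] at h2
  · exact hbig g hg

variable {N : ℕ}

/-- The element of the dual group with a given matrix. -/
def DualGroup.ofMatrix (M : Matrix (Fin N) (Fin N) ℂ)
    (hM : M.transpose * dualForm N * M = dualForm N) (hdet : M.det = 1) : DualGroup N :=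
  ⟨Matrix.GeneralLinearGroup.mkOfDetNeZero M (by rw [hdet]; exact one_ne_zero), hM, hdet⟩

/-- The bilinear form of the dual group. -/
def dualBilin (N : ℕ) : (Fin N → ℂ) →ₗ[ℂ] (Fin N → ℂ) →ₗ[ℂ] ℂ :=
  Matrix.toLinearMap₂' ℂ (dualForm N)

lemma dualBilin_apply (v w : Fin N → ℂ) : dualBilin N v w = v ⬝ᵥ (dualForm N).mulVec w :=
  Matrix.toLinearMap₂'_apply' _ _ _

lemma dualBilin_symm (v w : Fin N → ℂ) :
    dualBilin N v w = ((groupSign N : ℤ) : ℂ) * dualBilin N w v := by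
  rw [dualBilin_apply, dualBilin_apply, Matrix.dotProduct_mulVec, ← Matrix.mulVec_transpose,
    transpose_dualForm, Matrix.smul_mulVec, smul_dotProduct, smul_eq_mul, dotProduct_comm]

lemma dualBilin_mulVec {M : Matrix (Fin N) (Fin N) ℂ}
    (hM : M.transpose * dualForm N * M = dualForm N) (v w : Fin N → ℂ) :
    dualBilin N (M.mulVec v) (M.mulVec w) = dualBilin N v w := by
  rw [dualBilin_apply, dualBilin_apply]
  conv_rhs => rw [← hM, Matrix.mul_assoc, ← Matrix.mulVec_mulVec, Matrix.dotProduct_mulVec v,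
    Matrix.vecMul_transpose]
  rw [Matrix.mulVec_mulVec]

lemma isometry_of_dualBilin {M : Matrix (Fin N) (Fin N) ℂ}
    (hM : ∀ v w, dualBilin N (M.mulVec v) (M.mulVec w) = dualBilin N v w) :
    M.transpose * dualForm N * M = dualForm N := by
  ext i j
  have h := hM (Pi.single i 1) (Pi.single j 1)
  rw [dualBilin_apply, dualBilin_apply] at h
  have h1 : ∀ (K : Matrix (Fin N) (Fin N) ℂ) (i j : Fin N),
      (Pi.single i 1 : Fin N → ℂ) ⬝ᵥ K.mulVec (Pi.single j 1) = K i j := by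
    intro K i j
    simp
  rw [← h1 (M.transpose * dualForm N * M), ← h1 (dualForm N), ← h, Matrix.dotProduct_mulVec,
    ← Matrix.vecMul_vecMul, ← Matrix.dotProduct_mulVec, ← Matrix.vecMul_vecMul,
    ← Matrix.dotProduct_mulVec, Matrix.vecMul_transpose]

/-- Isometries have determinant ±1, and SL₂ has no nontrivial character of order two. -/
lemma exists_dualHom {σ : Representation ℂ SL2 (Fin N → ℂ)}
    (hσ : ∀ y v w, dualBilin N (σ y v) (σ y w) = dualBilin N v w) :
    ∃ f : SL2 →* DualGroup N, stdRep f = σ := by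
  let M : SL2 →* Matrix (Fin N) (Fin N) ℂ :=
    (LinearMap.toMatrixAlgEquiv' : _ ≃ₐ[ℂ] Matrix (Fin N) (Fin N) ℂ).toMulEquiv.toMonoidHom.comp σ
  have hMσ : ∀ y, Matrix.toLin' (M y) = σ y := fun y => Matrix.toLin'_toMatrix' _
  have hM : ∀ y, (M y).transpose * dualForm N * M y = dualForm N := fun y =>
    isometry_of_dualBilin fun v w => by
      rw [← Matrix.toLin'_apply, ← Matrix.toLin'_apply, hMσ, hσ]
  have hdet : ∀ y, (M y).det = 1 := by
    refine SL2.hom_eq_one (δ := Matrix.detMonoidHom.comp M) fun y => ?_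
    have h := congrArg Matrix.det (hM y)
    rw [Matrix.det_mul, Matrix.det_mul, Matrix.det_transpose] at h
    exact mul_right_cancel₀ (isUnit_det_dualForm N).ne_zero (by
      rw [one_mul]
      conv_rhs => rw [← h]
      change (M y).det * (M y).det * _ = _
      ring)
  refine ⟨MonoidHom.mk' (fun y => DualGroup.ofMatrix (M y) (hM y) (hdet y)) fun y y' =>
    matOf_injective ?_, ?_⟩
  · exact map_mul M y y'
  · ext1 y
    exact hMσ y

end DualHom

/-! ## The `A`-parameter of a paired decomposition -/

section Construction

lemma matOf_zpow {N : ℕ} {g : DualGroup N} {z : ℤˣ}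
    (hg : matOf g = ((z : ℤ) : ℂ) • (1 : Matrix (Fin N) (Fin N) ℂ)) (n : ℤ) :
    matOf (g ^ n) = (((z ^ n : ℤˣ) : ℤ) : ℂ) • (1 : Matrix (Fin N) (Fin N) ℂ) := by
  have hgg : g ^ (2 : ℤ) = 1 := by
    rw [zpow_two]
    refine matOf_injective ?_
    rw [matOf_mul, hg, smul_mul_assoc, one_mul, smul_smul, intUnit_mul_self, one_smul, matOf_one]
  have hzz : z ^ (2 : ℤ) = 1 := by rw [zpow_two, Int.units_mul_self]
  rcases Int.even_or_odd' n with ⟨k, rfl | rfl⟩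
  · rw [zpow_mul, zpow_mul, hgg, hzz, one_zpow, one_zpow, matOf_one]
    simp
  · rw [zpow_add, zpow_add, zpow_mul, zpow_mul, hgg, hzz, one_zpow, one_zpow, zpow_one, zpow_one,
      one_mul, one_mul, hg]

lemma continuous_of_continuous_matOf {N : ℕ} {Γ : Type*} [Group Γ] [TopologicalSpace Γ]
    [ContinuousInv Γ] {f : Γ →* DualGroup N} (h : Continuous fun x => matOf (f x)) :
    Continuous f := by
  refine Continuous.subtype_mk (Units.continuous_iff.2 ⟨h, ?_⟩) _
  have h1 := h.comp continuous_inv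
  refine h1.congr fun x => ?_
  rw [Function.comp_apply, map_inv]
  rfl

lemma stdRep_apply_apply {N : ℕ} {Γ : Type*} [Group Γ] (f : Γ →* DualGroup N) (g : Γ) (i j : Fin N) :
    matOf (f g) i j = stdRep f g (Pi.single j 1) i := by
  rw [stdRep_apply, Matrix.toLin'_apply, Matrix.mulVec_single_one]
  rfl

lemma exists_polynomial_of_isAlgebraicRep {N : ℕ} {f : SL2 →* DualGroup N}
    (hf : IsAlgebraicRep (stdRep f)) :
    ∃ P : Fin N → Fin N → MvPolynomial (Fin 2 × Fin 2) ℂ, ∀ (x : SL2) (i j : Fin N),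
      matOf (f x) i j = MvPolynomial.eval (fun p => x p.1 p.2) (P i j) := by
  choose P hP using fun i j : Fin N => hf (LinearMap.proj i) (Pi.single j 1)
  exact ⟨P, fun x i j => by rw [stdRep_apply_apply, ← hP]; rfl⟩

lemma continuous_of_isAlgebraicRep {N : ℕ} {f : SL2 →* DualGroup N}
    (hf : IsAlgebraicRep (stdRep f)) : Continuous f := by
  obtain ⟨P, hP⟩ := exists_polynomial_of_isAlgebraicRep hf
  refine continuous_of_continuous_matOf (continuous_matrix fun i j => ?_)
  simp only [hP]
  refine (MvPolynomial.continuous_eval (P i j)).comp (continuous_pi fun p => ?_)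
  exact (continuous_subtype_val.matrix_elem p.1 p.2)

variable {F : Type*} [Field F] [ValuativeRel F] {N : ℕ}

lemma continuous_weilDegHom : Continuous (weilDegHom (F := F)) :=
  continuous_snd.comp continuous_subtype_val

/-- The unramified homomorphism of the Weil group that maps Frobenius elements to `g`. -/
def unramifiedHom (g : DualGroup N) : WeilGroup F →* DualGroup N :=
  (zpowersHom (DualGroup N) g).comp weilDegHom

lemma unramifiedHom_apply (g : DualGroup N) (w : WeilGroup F) :
    unramifiedHom g w = g ^ weilDeg w := rfl

lemma continuous_unramifiedHom (g : DualGroup N) :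
    Continuous (unramifiedHom (F := F) g) :=
  (continuous_of_discreteTopology (f := zpowersHom (DualGroup N) g)).comp continuous_weilDegHom

lemma matOf_unramifiedHom {g : DualGroup N} {z : ℤˣ}
    (hg : matOf g = ((z : ℤ) : ℂ) • (1 : Matrix (Fin N) (Fin N) ℂ)) (w : WeilGroup F) :
    matOf (unramifiedHom g w) =
      ((unramifiedSign z w : ℂˣ) : ℂ) • (1 : Matrix (Fin N) (Fin N) ℂ) := by
  rw [unramifiedHom_apply, matOf_zpow hg]
  rfl

lemma norm_unramifiedSign (z : ℤˣ) (w : WeilGroup F) :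
    ‖((unramifiedSign z w : ℂˣ) : ℂ)‖ = 1 := by
  have : ((unramifiedSign z w : ℂˣ) : ℂ) = (((z ^ weilDeg w : ℤˣ) : ℤ) : ℂ) := rfl
  rw [this]
  rcases Int.units_eq_one_or (z ^ weilDeg w) with h | h <;> rw [h] <;> simp

lemma unramifiedHom_commute {g : DualGroup N} {z : ℤˣ}
    (hg : matOf g = ((z : ℤ) : ℂ) • (1 : Matrix (Fin N) (Fin N) ℂ)) (w : WeilGroup F)
    (k : DualGroup N) : Commute (unramifiedHom g w) k := by
  refine matOf_injective ?_
  rw [matOf_mul, matOf_mul, matOf_unramifiedHom hg, smul_mul_assoc, one_mul, mul_smul_comm, mul_one]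

lemma commute_of_stdRep {f f' : SL2 →* DualGroup N} (x y : SL2)
    (h : Commute (stdRep f x) (stdRep f' y)) : Commute (f x) (f' y) := by
  refine matOf_injective (Matrix.toLin'.injective ?_)
  rw [matOf_mul, matOf_mul, Matrix.toLin'_mul, Matrix.toLin'_mul]
  exact h

/-- The `A`-parameter with given restrictions to the two factors `SL₂`, whose restriction to the
Weil group is unramified and maps Frobenius elements to a central sign. -/
def AParameter.ofCommuting {g : DualGroup N} {z : ℤˣ}
    (hg : matOf g = ((z : ℤ) : ℂ) • (1 : Matrix (Fin N) (Fin N) ℂ)) (f f' : SL2 →* DualGroup N)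
    (hf : IsAlgebraicRep (stdRep f)) (hf' : IsAlgebraicRep (stdRep f'))
    (hc : ∀ x y, Commute (f x) (f' y)) : AParameter F N where
  hom := (unramifiedHom g).noncommCoprod (f.noncommCoprod f' hc)
    fun w _ => unramifiedHom_commute hg w _
  continuous_hom := by
    have h1 : Continuous fun p : WeilGroup F × SL2 × SL2 => unramifiedHom g p.1 :=
      (continuous_unramifiedHom g).comp continuous_fst
    have h2 : Continuous fun p : WeilGroup F × SL2 × SL2 => f p.2.1 :=
      (continuous_of_isAlgebraicRep hf).comp (continuous_fst.comp continuous_snd)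
    have h3 : Continuous fun p : WeilGroup F × SL2 × SL2 => f' p.2.2 :=
      (continuous_of_isAlgebraicRep hf').comp (continuous_snd.comp continuous_snd)
    exact h1.mul (h2.mul h3)
  algebraic := by
    obtain ⟨P, hP⟩ := exists_polynomial_of_isAlgebraicRep hf
    obtain ⟨P', hP'⟩ := exists_polynomial_of_isAlgebraicRep hf'
    refine ⟨fun i j => ∑ k, MvPolynomial.rename Sum.inl (P i k) *
      MvPolynomial.rename Sum.inr (P' k j), fun x y i j => ?_⟩
    have h : (unramifiedHom g).noncommCoprod (f.noncommCoprod f' hc)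
        (fun w _ => unramifiedHom_commute hg w _) ((1 : WeilGroup F), x, y) = f x * f' y := by
      rw [MonoidHom.noncommCoprod_apply, map_one, one_mul]
      rfl
    rw [h, matOf_mul, Matrix.mul_apply, map_sum]
    refine Finset.sum_congr rfl fun k _ => ?_
    rw [map_mul, MvPolynomial.eval_rename, MvPolynomial.eval_rename, Sum.elim_comp_inl,
      Sum.elim_comp_inr, hP, hP']
  semisimple := fun w => by
    have h : (unramifiedHom g).noncommCoprod (f.noncommCoprod f' hc)
        (fun w _ => unramifiedHom_commute hg w _) (w, (1 : SL2), (1 : SL2)) =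
          unramifiedHom g w := by
      rw [MonoidHom.noncommCoprod_apply]
      simp
    rw [h, matOf_unramifiedHom hg, map_smul, Matrix.toLin'_one]
    exact Module.End.IsSemisimple_smul _ Module.End.isSemisimple_id
  bounded := by
    refine ⟨1, fun w i j => ?_⟩
    have h : (unramifiedHom g).noncommCoprod (f.noncommCoprod f' hc)
        (fun w _ => unramifiedHom_commute hg w _) (w, (1 : SL2), (1 : SL2)) =
          unramifiedHom g w := by
      rw [MonoidHom.noncommCoprod_apply]
      simp
    rw [h, matOf_unramifiedHom hg, Matrix.smul_apply, norm_smul, norm_unramifiedSign, one_mul,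
      Matrix.one_apply]
    split_ifs <;> simp

variable {g : DualGroup N} {z : ℤˣ}
  (hg : matOf g = ((z : ℤ) : ℂ) • (1 : Matrix (Fin N) (Fin N) ℂ)) {f f' : SL2 →* DualGroup N}
  (hf : IsAlgebraicRep (stdRep f)) (hf' : IsAlgebraicRep (stdRep f'))
  (hc : ∀ x y, Commute (f x) (f' y))

lemma AParameter.ofCommuting_hom_apply (w : WeilGroup F) (x y : SL2) :
    (AParameter.ofCommuting hg f f' hf hf' hc).hom (w, x, y) =
      unramifiedHom g w * (f x * f' y) := rfl

lemma AParameter.stdRep_ofCommuting (w : WeilGroup F) (x y : SL2) (v : Fin N → ℂ) :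
    stdRep (AParameter.ofCommuting hg f f' hf hf' hc).hom (w, x, y) v =
      ((unramifiedSign z w : ℂˣ) : ℂ) • stdRep f x (stdRep f' y v) := by
  rw [stdRep_apply, AParameter.ofCommuting_hom_apply, matOf_mul, matOf_mul, matOf_unramifiedHom hg,
    smul_mul_assoc, one_mul, map_smul, LinearMap.smul_apply, Matrix.toLin'_mul]
  rfl

variable [TopologicalSpace F] [IsNonarchimedeanLocalField F]

lemma weilNormHalf_eq_zpow {Fr : WeilGroup F} (hFr : IsFrobenius Fr) (w : WeilGroup F) :
    IsInertia (w * Fr ^ (-weilDeg w)) ∧ weilNormHalf w = weilNormHalf Fr ^ weilDeg w := by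
  have h1 : IsInertia (w * Fr ^ (-weilDeg w)) := by
    have : weilDeg Fr = 1 := hFr
    rw [IsInertia, weilDeg_mul, weilDeg_zpow, this]
    ring
  refine ⟨h1, ?_⟩
  have h2 := weilNormHalf_of_isInertia h1
  rw [map_mul, map_zpow, zpow_neg, mul_inv_eq_one] at h2
  exact h2

/-- Both sides are trivial on inertia and agree on SL₂. At Frobenius the central sign z cancels the
z in `frobEnd`. The homomorphisms are equal, not only conjugate. -/
lemma LParameter.hom_eq_lHom {φ : LParameter F N} {Fr : WeilGroup F} (hFr : IsFrobenius Fr)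
    (hI : ∀ w, IsInertia w → φ.hom (w, 1) = 1)
    {hf : IsAlgebraicRep (stdRep φ.sl2Hom)} {hc : ∀ x y, Commute (φ.sl2Hom x) (f' y)}
    (hs : stdRep f' (diagSL2 (weilNormHalf Fr)) = φ.frobEnd Fr z) :
    (AParameter.ofCommuting hg φ.sl2Hom f' hf hf' hc).lHom = φ.hom := by
  have hFr' : g * f' (diagSL2 (weilNormHalf Fr)) = φ.hom (Fr, 1) := by
    refine matOf_injective (Matrix.toLin'.injective ?_)
    rw [matOf_mul, hg, smul_mul_assoc, one_mul, map_smul, ← stdRep_apply, hs, LParameter.frobEnd,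
      smul_smul, intUnit_mul_self, one_smul]
  have hgc : Commute g (f' (diagSL2 (weilNormHalf Fr))) := by
    have := unramifiedHom_commute hg Fr (f' (diagSL2 (weilNormHalf Fr)))
    have h1 : weilDeg Fr = 1 := hFr
    rwa [unramifiedHom_apply, h1, zpow_one] at this
  refine MonoidHom.ext ?_
  rintro ⟨w, x⟩
  obtain ⟨hw, hn⟩ := weilNormHalf_eq_zpow hFr w
  have h1 : φ.hom (w, 1) = φ.hom (Fr, 1) ^ weilDeg w := by
    have h2 := hI _ hw
    have h3 : φ.hom (w * Fr ^ (-weilDeg w), 1) = φ.hom (w, 1) * φ.hom (Fr, 1) ^ (-weilDeg w) := by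
      rw [← map_zpow, ← map_mul, Prod.pow_mk, Prod.mk_mul_mk, one_zpow, one_mul]
    rw [h3, zpow_neg, mul_inv_eq_one] at h2
    exact h2
  have h4 : φ.hom (w, x) = φ.hom (w, 1) * φ.sl2Hom x := by
    rw [LParameter.sl2Hom_apply, ← map_mul, Prod.mk_mul_mk, mul_one, one_mul]
  change unramifiedHom g w * (φ.sl2Hom x * f' (diagSL2 (weilNormHalf w))) = _
  rw [h4, h1, ← hFr', hgc.mul_zpow, unramifiedHom_apply, hn, (hc _ _).eq, map_zpow, map_zpow,
    mul_assoc]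

end Construction

/-! ## The representation of a near-tempered table -/

section Table

/-- Evaluation of binary forms. -/
def evalForm (k : ℕ) (a b : ℂ) : Forms k →ₗ[ℂ] ℂ :=
  (MvPolynomial.aeval ![a, b]).toLinearMap ∘ₗ (Forms k).subtype

lemma evalForm_apply (k : ℕ) (a b : ℂ) (q : Forms k) :
    evalForm k a b q = MvPolynomial.eval ![a, b] (q : MvPolynomial (Fin 2) ℂ) := rfl

lemma evalForm_zero (a b a' b' : ℂ) (q : Forms 0) : evalForm 0 a b q = evalForm 0 a' b' q := by
  rw [← (formBasis 0).sum_repr q]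
  simp only [formBasis_apply, evalForm_apply, eval_sum_formMonomial]
  simp

lemma evalForm_one (a b : ℂ) (q : Forms 1) :
    evalForm 1 a b q = a * evalForm 1 1 0 q + b * evalForm 1 0 1 q := by
  rw [← (formBasis 1).sum_repr q]
  simp only [formBasis_apply, evalForm_apply, eval_sum_formMonomial]
  simp
  ring

lemma evalForm_nuRep (k : ℕ) (g : SL2) (a b : ℂ) (q : Forms (k - 1)) :
    evalForm (k - 1) a b (nuRep k g q) =
      evalForm (k - 1) (a * g 0 0 + b * g 1 0) (a * g 0 1 + b * g 1 1) q := eval_nuRep k g q a b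

variable {V : Type*} [AddCommGroup V] [Module ℂ V]

/-- The space of `z ⊗ ν_a ⊗ ν_b`. -/
abbrev PairSpace (x : ℕ × ℕ) : Type := ℂ ⊗[ℂ] (Forms (x.1 - 1) ⊗[ℂ] Forms (x.2 - 1))

/-- The linear map on `z ⊗ ν_a ⊗ ν_b` given by a bilinear map. -/
def pairLift {x : ℕ × ℕ} (T : Forms (x.1 - 1) →ₗ[ℂ] Forms (x.2 - 1) →ₗ[ℂ] V) :
    PairSpace x →ₗ[ℂ] V :=
  TensorProduct.lift T ∘ₗ (TensorProduct.lid ℂ _).toLinearMap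

lemma pairLift_tmul {x : ℕ × ℕ} (T : Forms (x.1 - 1) →ₗ[ℂ] Forms (x.2 - 1) →ₗ[ℂ] V) (c : ℂ)
    (p : Forms (x.1 - 1)) (q : Forms (x.2 - 1)) :
    pairLift T (c ⊗ₜ[ℂ] (p ⊗ₜ[ℂ] q)) = c • T p q := by
  simp [pairLift]

variable {F : Type*} [Field F] [ValuativeRel F]

lemma pairRep_tmul (z : ℤˣ) (x : ℕ × ℕ) (w : WeilGroup F) (g h : SL2) (c : ℂ)
    (p : Forms (x.1 - 1)) (q : Forms (x.2 - 1)) :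
    pairRep z x.1 x.2 (w, g, h) (c ⊗ₜ[ℂ] (p ⊗ₜ[ℂ] q)) =
      (((unramifiedSign z w : ℂˣ) : ℂ) • c) ⊗ₜ[ℂ] ((nuRep x.1 g p) ⊗ₜ[ℂ] (nuRep x.2 h q)) := rfl

lemma pairLift_equivariant {x : ℕ × ℕ} {T : Forms (x.1 - 1) →ₗ[ℂ] Forms (x.2 - 1) →ₗ[ℂ] V}
    {ρ σ : Representation ℂ SL2 V}
    (hT : ∀ g h p q, T (nuRep x.1 g p) (nuRep x.2 h q) = ρ g (σ h (T p q)))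
    (z : ℤˣ) (w : WeilGroup F) (g h : SL2) (ξ : PairSpace x) :
    pairLift T (pairRep z x.1 x.2 (w, g, h) ξ) =
      ((unramifiedSign z w : ℂˣ) : ℂ) • ρ g (σ h (pairLift T ξ)) := by
  induction ξ using TensorProduct.induction_on with
  | zero => simp
  | add ξ ξ' hξ hξ' => simp only [map_add, hξ, hξ', smul_add]
  | tmul c η =>
    induction η using TensorProduct.induction_on with
    | zero => simp
    | add η η' hη hη' => simp only [TensorProduct.tmul_add, map_add, hη, hη', smul_add]
    | tmul p q =>
      rw [pairRep_tmul, pairLift_tmul, pairLift_tmul, hT, map_smul, map_smul, smul_smul,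
        smul_eq_mul]

namespace PairedDecomposition

variable {ρ : Representation ℂ SL2 V} {s : Module.End ℂ V} {t : ℂ} {A : Multiset ℕ} {J : Finset ℕ}
  [FiniteDimensional ℂ V] (P : PairedDecomposition ρ s t A J)

lemma secondRep_mid (y : SL2) (a : A) (p : Forms ((a : ℕ) - 1)) :
    P.secondRep y (P.mid a p) = P.mid a p := by
  classical
  have h := P.secondRep_apply y (Pi.single a p) 0 0
  simpa [midSum_single] using h

lemma secondRep_pos (y : SL2) (c : J) (p : Forms ((c : ℕ) - 1)) :
    P.secondRep y (P.pos c p) = y 0 0 • P.pos c p + y 1 0 • P.neg c p := by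
  have h := P.secondRep_apply y 0 (Pi.single c p) 0
  simpa [posSum_single, negSum_single] using h

lemma secondRep_neg (y : SL2) (c : J) (p : Forms ((c : ℕ) - 1)) :
    P.secondRep y (P.neg c p) = y 0 1 • P.pos c p + y 1 1 • P.neg c p := by
  have h := P.secondRep_apply y 0 0 (Pi.single c p)
  simpa [posSum_single, negSum_single] using h

/-- A form of degree zero is a scalar, read off by evaluation at (1, 0). -/
lemma exists_midLift (a : A) : ∃ T : Forms ((a : ℕ) - 1) →ₗ[ℂ] Forms (1 - 1) →ₗ[ℂ] V,
    (∀ g h p q, T (nuRep (a : ℕ) g p) (nuRep 1 h q) = ρ g (P.secondRep h (T p q))) ∧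
    LinearMap.range (P.mid a) ≤ LinearMap.range (pairLift (x := (↑a, 1)) T) := by
  let T : Forms ((a : ℕ) - 1) →ₗ[ℂ] Forms (1 - 1) →ₗ[ℂ] V :=
    LinearMap.mk₂ ℂ (fun p q => evalForm 0 1 0 q • P.mid a p)
      (fun p p' q => by rw [map_add, smul_add]) (fun c p q => by rw [map_smul, smul_comm])
      (fun p q q' => by rw [map_add, add_smul]) (fun c p q => by rw [map_smul, smul_assoc])
  have hT : ∀ p q, T p q = evalForm 0 1 0 q • P.mid a p := fun p q => rfl
  refine ⟨T, fun g h p q => ?_, ?_⟩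
  · rw [hT, hT, map_smul, map_smul, secondRep_mid, ← P.mid_equivariant]
    congr 1
    exact (evalForm_nuRep 1 h 1 0 q).trans (evalForm_zero _ _ _ _ q)
  · rintro _ ⟨p, rfl⟩
    refine ⟨(1 : ℂ) ⊗ₜ[ℂ] (p ⊗ₜ[ℂ] formMonomial 0 0), ?_⟩
    refine (pairLift_tmul (x := (↑a, 1)) T 1 p (formMonomial 0 0)).trans ?_
    rw [hT, evalForm_apply, eval_formMonomial]
    simp

/-- The variables X₀ and X₁ of ν₂ mark the two copies of ν_c. The coefficients q(1, 0) and q(0, 1)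
transform under the second SL₂ by the matrix that mixes the copies. -/
lemma exists_outerLift (c : J) : ∃ T : Forms ((c : ℕ) - 1) →ₗ[ℂ] Forms (2 - 1) →ₗ[ℂ] V,
    (∀ g h p q, T (nuRep (c : ℕ) g p) (nuRep 2 h q) = ρ g (P.secondRep h (T p q))) ∧
    LinearMap.range (P.pos c) ⊔ LinearMap.range (P.neg c) ≤
      LinearMap.range (pairLift (x := (↑c, 2)) T) := by
  let T : Forms ((c : ℕ) - 1) →ₗ[ℂ] Forms (2 - 1) →ₗ[ℂ] V :=
    LinearMap.mk₂ ℂ (fun p q => evalForm 1 1 0 q • P.pos c p + evalForm 1 0 1 q • P.neg c p)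
      (fun p p' q => by rw [map_add, map_add, smul_add, smul_add]; abel)
      (fun r p q => by rw [map_smul, map_smul, smul_add, smul_comm r, smul_comm r])
      (fun p q q' => by rw [map_add, map_add, add_smul, add_smul]; abel)
      (fun r p q => by rw [map_smul, map_smul, smul_add, smul_assoc, smul_assoc])
  have hT : ∀ p q, T p q = evalForm 1 1 0 q • P.pos c p + evalForm 1 0 1 q • P.neg c p :=
    fun p q => rfl
  refine ⟨T, fun g h p q => ?_, sup_le ?_ ?_⟩
  · have h1 : evalForm 1 1 0 (nuRep 2 h q) =
        h 0 0 * evalForm 1 1 0 q + h 0 1 * evalForm 1 0 1 q := by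
      refine (evalForm_nuRep 2 h 1 0 q).trans ((evalForm_one _ _ q).trans ?_)
      ring
    have h2 : evalForm 1 0 1 (nuRep 2 h q) =
        h 1 0 * evalForm 1 1 0 q + h 1 1 * evalForm 1 0 1 q := by
      refine (evalForm_nuRep 2 h 0 1 q).trans ((evalForm_one _ _ q).trans ?_)
      ring
    rw [hT, hT, h1, h2, P.pos_equivariant, P.neg_equivariant]
    simp only [map_add, map_smul, secondRep_pos, secondRep_neg]
    module
  · rintro _ ⟨p, rfl⟩
    refine ⟨(1 : ℂ) ⊗ₜ[ℂ] (p ⊗ₜ[ℂ] formMonomial 1 0), ?_⟩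
    refine (pairLift_tmul (x := (↑c, 2)) T 1 p (formMonomial 1 0)).trans ?_
    rw [hT, evalForm_apply, evalForm_apply, eval_formMonomial, eval_formMonomial]
    simp
  · rintro _ ⟨p, rfl⟩
    refine ⟨(1 : ℂ) ⊗ₜ[ℂ] (p ⊗ₜ[ℂ] formMonomial 1 1), ?_⟩
    refine (pairLift_tmul (x := (↑c, 2)) T 1 p (formMonomial 1 1)).trans ?_
    rw [hT, evalForm_apply, evalForm_apply, eval_formMonomial, eval_formMonomial]
    simp

end PairedDecomposition

end Table

/-! ### The table of a paired decomposition -/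

section TableEquiv

variable {F : Type*} [Field F] [ValuativeRel F]

namespace PairedDecomposition

variable {V : Type*} [AddCommGroup V] [Module ℂ V] [FiniteDimensional ℂ V]
  {ρ : Representation ℂ SL2 V} {s : Module.End ℂ V} {t : ℂ} {A : Multiset ℕ} {J : Finset ℕ}

/-- The entry of the table that belongs to a summand or a pair of summands. -/
def entry (A : Multiset ℕ) (J : Finset ℕ) : A ⊕ J → ℕ × ℕ :=
  Sum.elim (fun a => ((a : ℕ), 1)) fun c => ((c : ℕ), 2)

lemma map_entry (A : Multiset ℕ) (J : Finset ℕ) :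
    (Finset.univ : Finset (A ⊕ J)).val.map (entry A J) =
      A.map (fun a => (a, 1)) + J.val.map fun c => (c, 2) := by
  have hJ : (Finset.univ : Finset J).val.map (fun c : J => (c : ℕ)) = J.val := by
    rw [Finset.univ_eq_attach]
    exact Multiset.attach_map_val J.val
  conv_rhs => rw [← Multiset.map_univ_coe A, ← hJ]
  rw [Multiset.map_map, Multiset.map_map, ← Finset.univ_disjSum_univ, Finset.val_disjSum,
    Multiset.map_disjSum]
  rfl

variable (P : PairedDecomposition ρ s t A J)

/-- The entry is a variable x with an equation, so that the map can be attached to the equal entry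
of a table given only as a multiset. -/
lemma exists_lift (z : ℤˣ) (i : A ⊕ J) (x : ℕ × ℕ) (hx : entry A J i = x) :
    ∃ Φ : PairSpace x →ₗ[ℂ] V,
      (∀ (w : WeilGroup F) (g h : SL2) ξ, Φ (pairRep z x.1 x.2 (w, g, h) ξ) =
        ((unramifiedSign z w : ℂˣ) : ℂ) • ρ g (P.secondRep h (Φ ξ))) ∧
      Sum.elim (fun a => LinearMap.range (P.mid a))
        (fun c => LinearMap.range (P.pos c) ⊔ LinearMap.range (P.neg c)) i ≤
          LinearMap.range Φ := by
  subst hx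
  rcases i with a | c
  · obtain ⟨T, hT, hr⟩ := P.exists_midLift a
    exact ⟨pairLift (x := (↑a, 1)) T, fun w g h ξ =>
      pairLift_equivariant (x := (↑a, 1)) hT z w g h ξ, hr⟩
  · obtain ⟨T, hT, hr⟩ := P.exists_outerLift c
    exact ⟨pairLift (x := (↑c, 2)) T, fun w g h ξ =>
      pairLift_equivariant (x := (↑c, 2)) hT z w g h ξ, hr⟩

lemma finrank_pairSpace (x : ℕ × ℕ) (h1 : 1 ≤ x.1) (h2 : 1 ≤ x.2) :
    Module.finrank ℂ (PairSpace x) = x.1 * x.2 := by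
  rw [Module.finrank_tensorProduct, Module.finrank_tensorProduct, Module.finrank_self, one_mul,
    finrank_forms_sub_one h1, finrank_forms_sub_one h2]

/-- The representation of `W_F × SL₂ × SL₂` given by a paired decomposition is the one of the
table. -/
lemma nonempty_equiv_tableRep (z : ℤˣ) {τ : Representation ℂ (WeilGroup F × SL2 × SL2) V}
    (hτ : ∀ w g h v, τ (w, g, h) v =
      ((unramifiedSign z w : ℂˣ) : ℂ) • ρ g (P.secondRep h v))
    {m : Multiset (ℕ × ℕ)} (hm : m = A.map (fun a => (a, 1)) + J.val.map fun c => (c, 2)) :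
    Nonempty (τ.Equiv (tableRep z m)) := by
  classical
  have hm' : (Finset.univ : Finset m).val.map (fun i : m => i.1) =
      (Finset.univ : Finset (A ⊕ J)).val.map (entry A J) := by
    rw [map_entry, ← hm]
    exact Multiset.map_univ_coe m
  obtain ⟨e, he⟩ := exists_equiv_of_map_univ_eq hm'
  choose Φ hΦ hr using fun i : m => P.exists_lift (F := F) z (e i) i.1 (he i)
  let Ψ : (⨁ i : m, PairSpace i.1) →ₗ[ℂ] V := DirectSum.toModule ℂ m V Φ
  have hΨ : ∀ i ξ, Ψ (DirectSum.lof ℂ m (fun i : m => PairSpace i.1) i ξ) = Φ i ξ := fun i ξ =>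
    DirectSum.toModule_lof (M := fun i : m => PairSpace i.1) (φ := Φ) ℂ i ξ
  have hsurj : Function.Surjective Ψ := by
    rw [← LinearMap.range_eq_top, eq_top_iff, ← P.iSup_range]
    have h1 : ∀ i, LinearMap.range (Φ i) ≤ LinearMap.range Ψ := by
      rintro i _ ⟨ξ, rfl⟩
      exact ⟨_, hΨ i ξ⟩
    have h2 : ∀ j, Sum.elim (fun a => LinearMap.range (P.mid a))
        (fun c => LinearMap.range (P.pos c) ⊔ LinearMap.range (P.neg c)) j ≤
          LinearMap.range Ψ := by
      intro j
      obtain ⟨i, rfl⟩ := e.surjective j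
      exact (hr i).trans (h1 i)
    exact sup_le (iSup_le fun a => h2 (.inl a)) (sup_le
      (iSup_le fun c => le_sup_left.trans (h2 (.inr c)))
      (iSup_le fun c => le_sup_right.trans (h2 (.inr c))))
  have hentry : ∀ j, 1 ≤ (entry A J j).1 ∧ 1 ≤ (entry A J j).2 := by
    rintro (a | c)
    · exact ⟨P.one_le_mid a, le_rfl⟩
    · exact ⟨P.one_le_right c c.2, one_le_two⟩
  have hfin : Module.finrank ℂ (⨁ i : m, PairSpace i.1) = Module.finrank ℂ V := by
    rw [Module.finrank_directSum]
    have h1 : ∀ i : m, Module.finrank ℂ (PairSpace i.1) =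
        (entry A J (e i)).1 * (entry A J (e i)).2 := by
      intro i
      rw [he]
      exact finrank_pairSpace _ (he i ▸ (hentry (e i)).1) (he i ▸ (hentry (e i)).2)
    rw [Finset.sum_congr rfl fun i _ => h1 i,
      Equiv.sum_comp e fun j => (entry A J j).1 * (entry A J j).2, Fintype.sum_sum_type, P.finrank_eq,
      ← qf_zero, ← sum_toType, ← Finset.sum_coe_sort J fun c => 2 * c]
    congr 1
    · exact Finset.sum_congr rfl fun a _ => mul_one _
    · exact Finset.sum_congr rfl fun c _ => mul_comm _ _
  let E : (⨁ i : m, PairSpace i.1) ≃ₗ[ℂ] V := LinearEquiv.ofBijective Ψ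
    ⟨(LinearMap.injective_iff_surjective_of_finrank_eq_finrank hfin).2 hsurj, hsurj⟩
  refine ⟨(Representation.Equiv.mk (ρ := tableRep z m) (σ := τ) E ?_).symm⟩
  rintro ⟨w, g, h⟩
  refine DirectSum.linearMap_ext ℂ fun i => LinearMap.ext fun ξ => ?_
  have h1 : tableRep z m (w, g, h) (DirectSum.lof ℂ m (fun i : m => PairSpace i.1) i ξ) =
      DirectSum.lof ℂ m (fun i : m => PairSpace i.1) i (pairRep z i.1.1 i.1.2 (w, g, h) ξ) := by
    exact DirectSum.lmap_lof _ _ _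
  change Ψ (tableRep z m (w, g, h) (DirectSum.lof ℂ m (fun i : m => PairSpace i.1) i ξ)) =
    τ (w, g, h) (Ψ (DirectSum.lof ℂ m (fun i : m => PairSpace i.1) i ξ))
  rw [h1, hΨ, hΨ, hΦ, hτ]

end PairedDecomposition

end TableEquiv

/-! ### From a paired decomposition to a near-tempered parameter -/

section NearTemperedParameter

variable {F : Type*} [Field F] [ValuativeRel F] [TopologicalSpace F]
  [IsNonarchimedeanLocalField F] {N : ℕ}

/-- The second action is isometric and commutes with the first SL₂, so together with the central
element g it defines an A-parameter. Its L-parameter is φ itself, and 1 serves as the conjugating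
element. -/
lemma LParameter.isNearTempered_of_pairedDecomposition {φ : LParameter F N} {Fr : WeilGroup F}
    (hFr : IsFrobenius Fr) {z : ℤˣ} {g : DualGroup N}
    (hg : matOf g = ((z : ℤ) : ℂ) • (1 : Matrix (Fin N) (Fin N) ℂ))
    (hI : ∀ w, IsInertia w → φ.hom (w, 1) = 1) {lam : Multiset ℕ} {J : Finset ℕ}
    (hJ : J ⊆ JSet (groupSign N) lam) (hJ' : ∀ c ∈ J, ¬ GoodParity (groupSign N) c)
    (P : PairedDecomposition (stdRep φ.sl2Hom) (φ.frobEnd Fr z) ((weilNormHalf Fr : ℂˣ) : ℂ)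
      (lam - outerPairs J) J) : φ.IsNearTempered z lam (TJ J lam) := by
  have hinj := zpow_weilNormHalf_injective hFr
  -- Since c has bad parity, the sign of the invariant form on ν_c is opposite to that of the dual
  -- group.
  have hsign : ∀ c ∈ J, (-1 : ℂ) ^ (c - 1) = -((groupSign N : ℤ) : ℂ) := by
    intro c hc
    obtain ⟨n, rfl⟩ : ∃ n, c = n + 1 := ⟨c - 1, by have := P.one_le_right c hc; omega⟩
    have h1 := hJ' _ hc
    rw [goodParity_succ (groupSign_eq N), not_not] at h1
    rw [Nat.add_sub_cancel]
    rcases h1 with ⟨h, hn⟩ | ⟨h, hn⟩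
    · rw [h, hn.neg_one_pow]; norm_num
    · rw [h, hn.neg_one_pow]; norm_num
  have hiso := P.secondRep_isometry (B := dualBilin N) dualBilin_symm
    (fun x v w => dualBilin_mulVec (matOf_isometry (φ.sl2Hom x)) v w)
    (fun v w => by
      have h := dualBilin_mulVec (smul_sign_isometry z (φ.hom (Fr, 1))) v w
      rwa [Matrix.smul_mulVec, Matrix.smul_mulVec] at h)
    (fun h => by
      have := @hinj 1 0 (by change _ ^ (1 : ℤ) = _ ^ (0 : ℤ); rw [zpow_one, zpow_zero, h])
      exact one_ne_zero this)
    (fun h => by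
      have := @hinj 2 0 (by change _ ^ (2 : ℤ) = _ ^ (0 : ℤ); rw [zpow_two, zpow_zero, h])
      exact two_ne_zero this) hsign
  obtain ⟨f', hf'⟩ := exists_dualHom hiso
  have halg : IsAlgebraicRep (stdRep f') := hf' ▸ P.isAlgebraicRep_secondRep
  have hc : ∀ x y, Commute (φ.sl2Hom x) (f' y) := fun x y =>
    commute_of_stdRep x y (by rw [hf']; exact P.secondRep_commute x y)
  refine ⟨J, hJ, rfl, AParameter.ofCommuting hg φ.sl2Hom f' φ.isAlgebraicRep halg hc, ?_, 1,
    fun x => ?_⟩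
  · refine P.nonempty_equiv_tableRep z (fun w x y v => ?_) rfl
    rw [AParameter.stdRep_ofCommuting, hf']
  · rw [LParameter.hom_eq_lHom hg halg hFr hI (by rw [hf']; exact P.secondRep_diag _ rfl), one_mul,
      inv_one, mul_one]

end NearTemperedParameter

end

/-! ### The theorem -/

theorem mainTheorem6 {F : Type*} [Field F] [ValuativeRel F] [TopologicalSpace F]
    [IsNonarchimedeanLocalField F] [CharZero F] {N : ℕ} (hN : 3 ≤ N)
    (Fr : WeilGroup F) (hFr : IsFrobenius Fr)
    (z : ℤˣ) (hz : Odd N → z = 1)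
    (lam : Multiset ℕ) (hlam : lam ∈ partitionSet (groupSign N) N)
    -- `ψ₀` represents the quasi-basic parameter whose infinitesimal character is `χ_{z, O_lam}`
    (ψ₀ : AParameter F N) (hψ₀ : ψ₀.IsQuasiBasic Fr z lam)
    (φ : LParameter F N) (hχ : SameClass φ.infChar ψ₀.infChar)
    -- `lamφ` is the partition `lam(φ)` of the unipotent class of `φ`
    (lamφ : Multiset ℕ) (hlamφ : φ.unipotent ∈ unipotentClass N lamφ)
    (hd : bvDual (groupSign N) lamφ = bvDual (groupSign N) lam) :
    ∃ mu ∈ Spc (groupSign N) lam, φ.IsNearTempered z lam mu := by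
  have hN0 : 0 < N := by omega
  have hm : lamφ ∈ partitionSet (groupSign N) N := mem_partitionSet_of_mem_unipotentClass hlamφ
  obtain ⟨ι, _, D, m, hy, hdim, hseg, hsymm⟩ :=
    LParameter.exists_multisegment hFr hψ₀ hχ hlamφ
  -- This bound comes from the infinitesimal character; `hd` bounds the difference by one, so that
  -- it is the indicator of the defect set.
  have hle : ∀ x, qf lamφ x ≤ qf lam x := fun x => hdim ▸ qf_map_snd_le hseg x
  have hJ := defectSet_subset_JSet hN0 hlam hm hd hle
  have hS := eq_of_segRank_eq (J := defectSet lam lamφ)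
    (fun p hp => by
      obtain ⟨i, -, rfl⟩ := Multiset.mem_map.1 hp
      exact D.one_le_dim i)
    hlam.1 (fun c hc => pos_of_mem_defectSet hlam hm hc) hseg hsymm
    (fun x => hdim.symm ▸ qf_eq_add_defect hN0 hlam hm hd hle x)
  obtain ⟨P⟩ := D.exists_pairedDecomposition hy hS
  -- The central element z of the dual group is supplied by ψ₀ at (Fr, 1, 1).
  exact ⟨TJ (defectSet lam lamφ) lam, ⟨_, hJ, rfl⟩,
    LParameter.isNearTempered_of_pairedDecomposition hFr hψ₀.2.1
      (fun w hw => LParameter.hom_eq_one_of_isInertia hψ₀ hχ hw) hJ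
      (fun c hc => not_goodParity_of_mem_defectSet hlam hm hc) P⟩
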